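/- Let $K$ be a field and $\delta\in K$ such that $\delta=q+q^{-1}$ with $q$ (in an algebraic closure of $K$) not a root of unity; if $K$ has characteristic zero, the values $\delta=\pm 2$ are also allowed. Let $\mathcal{TL}(\delta)$ be the Temperley--Lieb category: its objects are the natural numbers, the morphisms from $m$ to $n$ are the linear combinations of planar diagrams joining an upper row of $m$ dots and a lower row of $n$ dots in pairs without crossings, and composition is stacking, each closed loop being replaced by a factor $\delta$. Let $A_n=TL_n(\delta)$ be the endomorphism algebra of $n$, let $\rho_{m,n}:A_m\otimes A_n\to A_{m+n}$ be given by juxtaposition of diagrams, and let $\Delta_n(p)$, $0\le p\le n/2$, be the cell module of $A_n$ spanned by the half-diagrams on $n$ dots with $p$ caps; put $\Delta_n(p)=0$ for $p>n/2$. Let $G_0(A)$ be the Grothendieck group of finitely generated $A$-modules. For an $A_m$-module $M$, an $A_n$-module $N$ and $0<k<m+n$ consider the identity $$[\mathrm{Res}^{A_{m+n}}_{A_k\otimes A_{m+n-k}}\mathrm{Ind}_{A_m\otimes A_n}^{A_{m+n}}(M\otimes N)]=\sum_{t+s=k}[\widetilde{\mathrm{Ind}}_{A_t\otimes A_{m-t}\otimes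 A_s\otimes A_{n-s}}^{A_k\otimes A_{m+n-k}}(\mathrm{Res}^{A_m}_{A_t\otimes A_{m-t}}M\otimes \mathrm{Res}^{A_n}_{A_s\otimes A_{n-s}}N)]\qquad(5)$$ in $G_0(A_k\otimes A_{m+n-k})$, where $0\le t\le m$, $0\le s\le n$, induction and restriction are along the maps $\rho$, and $\widetilde{\mathrm{Ind}}$ is induction along $(c_1\otimes c_2)\otimes(d_1\otimes d_2)\mapsto\rho_{t,s}(c_1\otimes d_1)\otimes\rho_{m-t,n-s}(c_2\otimes d_2)$. (a) Let $1\le p<n/2$, $M=\Delta_n(p)$, $N=\Delta_1(0)$, and let $k=1$ or $k=n$. Identify $[X]$, for an $A_n$-module $X$, with $[\Delta_1(0)\otimes X]\in G_0(A_1\otimes A_n)$ if $k=1$, and with $[X\otimes\Delta_1(0)]\in G_0(A_n\otimes A_1)$ if $k=n$ (recall $A_1=K$). Then the left side of (5) is $$[\Delta_n(p+1)]+2[\Delta_n(p)]+[\Delta_n(p-1)],$$ and the right side of (5) is $$[\Delta_n(p+1)]+3[\Delta_n(p)]+[\Delta_n(p-1)].$$ (b) For all $1\le p\le n/2$ and $k\in\{1,n\}$,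 the identity (5) fails for $M=\Delta_n(p)$ and $N=\Delta_1(0)$. (c) Let $G_0(\mathcal{TL}(\delta))=\bigoplus_{n\ge 0}G_0(A_n)$. There are unique homomorphisms $i_{m,n}:G_0(A_m)\otimes_{\mathbb Z} G_0(A_n)\to G_0(A_{m+n})$ with $[M]\otimes[N]\mapsto[\mathrm{Ind}_{A_m\otimes A_n}^{A_{m+n}}(M\otimes N)]$, and unique homomorphisms $r_{k,l}:G_0(A_{k+l})\to G_0(A_k)\otimes_{\mathbb Z} G_0(A_l)$ such that $r_{k,l}[N]$ is mapped to $[\mathrm{Res}_{A_k\otimes A_l}N]$ by $G_0(A_k)\otimes_{\mathbb Z} G_0(A_l)\to G_0(A_k\otimes A_l)$, $[X]\otimes[Y]\mapsto[X\otimes Y]$. Let $\pi$ be the multiplication with components $i_{m,n}$, let $\Delta$ be the comultiplication equal to $\sum_{k+l=n}r_{k,l}$ on $G_0(A_n)$, let $\mu(a)=a[K]\in G_0(A_0)$ for $a\in\mathbb Z$, and let $\epsilon$ be the homomorphism to $\mathbb Z$ with $\epsilon(a[K])=a$ on $G_0(A_0)$ and $\epsilon=0$ on $G_0(A_n)$,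 $n>0$. Then $\Delta(\pi(x\otimes y))\ne\Delta(x)\Delta(y)$ for $x=[\Delta_n(p)]$, $y=[\Delta_1(0)]$ and all $1\le p\le n/2$, the product on the right being the one of $G_0(\mathcal{TL}(\delta))\otimes_{\mathbb Z} G_0(\mathcal{TL}(\delta))$ defined by $\pi$. In particular, $(G_0(\mathcal{TL}(\delta)),\pi,\mu,\Delta,\epsilon)$ is not a bialgebra. -/

import Mathlib

open scoped TensorProduct DirectSum

universe u

namespace TemperleyLieb

/-! ### Gluing equivalence relations along a common row -/

section Glue

/-- `s` relates points of an upper row `α` and a middle row `β`, and `t` relates points of the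
middle row `β` and a lower row `γ`; this relation on all three rows is their union. -/
def GlueRel {α β γ : Type} (s : Setoid (α ⊕ β)) (t : Setoid (β ⊕ γ)) (x y : α ⊕ (β ⊕ γ)) : Prop :=
  (∃ u v, s u v ∧ Sum.map id Sum.inl u = x ∧ Sum.map id Sum.inl v = y) ∨
    (∃ u v, t u v ∧ Sum.inr u = x ∧ Sum.inr v = y)

/-- Connectivity of the picture obtained by stacking `s` on top of `t`. -/
def glue {α β γ : Type} (s : Setoid (α ⊕ β)) (t : Setoid (β ⊕ γ)) : Setoid (α ⊕ (β ⊕ γ)) :=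
  Relation.EqvGen.setoid (GlueRel s t)

/-- The inclusion of the two outer rows in the three rows. -/
def outer {α β γ : Type} : α ⊕ γ → α ⊕ (β ⊕ γ) := Sum.map id Sum.inr

/-- Connectivity of the outer points after stacking. -/
def glueComp {α β γ : Type} (s : Setoid (α ⊕ β)) (t : Setoid (β ⊕ γ)) : Setoid (α ⊕ γ) :=
  (glue s t).comap outer

/-- The number of connected components of the stacked picture which meet neither outer row:
these are the closed loops. -/
noncomputable def glueLoops {α β γ : Type} (s : Setoid (α ⊕ β)) (t : Setoid (β ⊕ γ)) : ℕ :=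
  Nat.card {q : Quotient (glue s t) // ∀ x : α ⊕ γ, Quotient.mk _ (outer x) ≠ q}

theorem glue_top {α β γ : Type} {s : Setoid (α ⊕ β)} (t : Setoid (β ⊕ γ)) {u v : α ⊕ β}
    (h : s u v) : glue s t (Sum.map id Sum.inl u) (Sum.map id Sum.inl v) :=
  Relation.EqvGen.rel _ _ (Or.inl ⟨u, v, h, rfl, rfl⟩)

theorem glue_bot {α β γ : Type} (s : Setoid (α ⊕ β)) {t : Setoid (β ⊕ γ)} {u v : β ⊕ γ}
    (h : t u v) : glue s t (Sum.inr u) (Sum.inr v) :=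
  Relation.EqvGen.rel _ _ (Or.inr ⟨u, v, h, rfl, rfl⟩)

/-- Induction principle: a relation containing `s` and `t` contains the glued relation. -/
theorem glue_le {α β γ : Type} {s : Setoid (α ⊕ β)} {t : Setoid (β ⊕ γ)}
    (r : Setoid (α ⊕ (β ⊕ γ)))
    (h1 : ∀ u v, s u v → r (Sum.map id Sum.inl u) (Sum.map id Sum.inl v))
    (h2 : ∀ u v, t u v → r (Sum.inr u) (Sum.inr v)) {x y : α ⊕ (β ⊕ γ)} (h : glue s t x y) :
    r x y := by
  refine Setoid.eqvGen_le (r := GlueRel s t) (s := r) ?_ h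
  rintro x y (⟨u, v, h, rfl, rfl⟩ | ⟨u, v, h, rfl, rfl⟩)
  · exact h1 _ _ h
  · exact h2 _ _ h

/-- A two-colouring of the points is compatible with `s` if it is constant on classes. -/
def Compat {α β : Type} (s : Setoid (α ⊕ β)) (i : α → Bool) (j : β → Bool) : Prop :=
  ∀ x y, s x y → Sum.elim i j x = Sum.elim i j y

open Classical in
/-- The 0-1 matrix of compatible two-colourings; an auxiliary device. -/
noncomputable def colMat {α β : Type} (s : Setoid (α ⊕ β)) : Matrix (α → Bool) (β → Bool) ℕ :=
  fun i j => if Compat s i j then 1 else 0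

theorem compat_glue {α β γ : Type} {s : Setoid (α ⊕ β)} {t : Setoid (β ⊕ γ)} {i : α → Bool}
    {j : β → Bool} {k : γ → Bool} (h1 : Compat s i j) (h2 : Compat t j k) {x y : α ⊕ (β ⊕ γ)}
    (h : glue s t x y) : Sum.elim i (Sum.elim j k) x = Sum.elim i (Sum.elim j k) y := by
  refine glue_le (Setoid.ker (Sum.elim i (Sum.elim j k))) ?_ ?_ h
  · intro u v huv
    have := h1 u v huv
    rcases u with u | u <;> rcases v with v | v <;> simpa [Setoid.ker_def] using this
  · intro u v huv
    have := h2 u v huv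
    rcases u with u | u <;> rcases v with v | v <;> simpa [Setoid.ker_def] using this

theorem elim_outer {α β γ : Type} (i : α → Bool) (j : β → Bool) (k : γ → Bool) (x : α ⊕ γ) :
    Sum.elim i (Sum.elim j k) (outer x) = Sum.elim i k x := by
  rcases x with x | x <;> rfl

theorem compat_comp {α β γ : Type} {s : Setoid (α ⊕ β)} {t : Setoid (β ⊕ γ)} {i : α → Bool}
    {j : β → Bool} {k : γ → Bool} (h1 : Compat s i j) (h2 : Compat t j k) :
    Compat (glueComp s t) i k := by
  intro x y hxy
  have := compat_glue h1 h2 hxy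
  simpa [elim_outer] using this

theorem card_compat {α β γ : Type} [Finite α] [Finite β] [Finite γ] (s : Setoid (α ⊕ β))
    (t : Setoid (β ⊕ γ)) (i : α → Bool) (k : γ → Bool) (hc : Compat (glueComp s t) i k) :
    Nat.card {j : β → Bool // Compat s i j ∧ Compat t j k} = 2 ^ glueLoops s t := by
  classical
  set Q := {q : Quotient (glue s t) // ∀ x : α ⊕ γ, Quotient.mk _ (outer x) ≠ q} with hQ
  let F : {j : β → Bool // Compat s i j ∧ Compat t j k} → (Q → Bool) := fun j q =>
    Quotient.lift (Sum.elim i (Sum.elim j.1 k)) (fun _ _ h => compat_glue j.2.1 j.2.2 h) q.1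
  have hF : Function.Bijective F := by
    constructor
    · rintro ⟨j, hj1, hj2⟩ ⟨j', hj1', hj2'⟩ h
      ext b
      by_cases hb : ∀ x : α ⊕ γ, Quotient.mk (glue s t) (outer x) ≠ Quotient.mk _ (Sum.inr (Sum.inl b))
      · exact congrFun h ⟨_, hb⟩
      · push Not at hb
        obtain ⟨x, hx⟩ := hb
        have hx := Quotient.exact hx
        have e1 := compat_glue hj1 hj2 hx
        have e2 := compat_glue hj1' hj2' hx
        rw [elim_outer] at e1 e2
        simpa using e1.symm.trans e2
    · intro ψ
      let Φ : Quotient (glue s t) → Bool := fun q =>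
        if h : ∀ x : α ⊕ γ, Quotient.mk _ (outer x) ≠ q then ψ ⟨q, h⟩
        else Sum.elim i k (Classical.choose (not_forall.1 h))
      have hΦ : ∀ x : α ⊕ γ, Φ (Quotient.mk _ (outer x)) = Sum.elim i k x := by
        intro x
        have hx : ¬ ∀ y : α ⊕ γ, Quotient.mk (glue s t) (outer y) ≠ Quotient.mk _ (outer x) :=
          fun h => h x rfl
        simp only [Φ, dif_neg hx]
        have := Classical.choose_spec (not_forall.1 hx)
        rw [not_not] at this
        exact hc _ _ (show glue s t _ _ from Quotient.exact this)
      let j : β → Bool := fun b => Φ (Quotient.mk _ (Sum.inr (Sum.inl b)))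
      have hj : ∀ x, Sum.elim i (Sum.elim j k) x = Φ (Quotient.mk _ x) := by
        rintro (x | x | x)
        · exact (hΦ (Sum.inl x)).symm
        · rfl
        · exact (hΦ (Sum.inr x)).symm
      refine ⟨⟨j, ?_, ?_⟩, ?_⟩
      · intro u v huv
        have h1 := congrArg Φ (Quotient.sound (s := glue s t) (glue_top t huv))
        rw [← hj, ← hj] at h1
        rcases u with u | u <;> rcases v with v | v <;> simpa using h1
      · intro u v huv
        have h1 := congrArg Φ (Quotient.sound (s := glue s t) (glue_bot s huv))
        rw [← hj, ← hj] at h1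
        simpa using h1
      · funext ⟨q, hq⟩
        induction q using Quotient.inductionOn with
        | h x =>
          change Sum.elim i (Sum.elim j k) x = _
          rw [hj]
          simp only [Φ]
          rw [dif_pos hq]
  rw [Nat.card_congr (Equiv.ofBijective F hF), Nat.card_fun]
  simp [glueLoops, hQ]

theorem colMat_mul {α β γ : Type} [Fintype α] [Fintype β] [Fintype γ] [DecidableEq β]
    (s : Setoid (α ⊕ β)) (t : Setoid (β ⊕ γ)) :
    colMat s * colMat t = 2 ^ glueLoops s t • colMat (glueComp s t) := by
  classical
  ext i k
  rw [Matrix.mul_apply, Matrix.smul_apply]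
  have h : ∀ j, colMat s i j * colMat t j k = if Compat s i j ∧ Compat t j k then 1 else 0 := by
    intro j
    simp only [colMat]
    split_ifs <;> simp_all
  simp only [h, Finset.sum_boole, Nat.cast_id]
  by_cases hc : Compat (glueComp s t) i k
  · rw [colMat, if_pos hc, ← card_compat s t i k hc, Nat.card_eq_fintype_card,
      Fintype.card_subtype]
    simp
  · rw [colMat, if_neg hc, smul_zero, Finset.card_eq_zero, Finset.filter_eq_empty_iff]
    intro j _ hj
    exact hc (compat_comp hj.1 hj.2)

theorem colMat_injective {α β : Type} {s t : Setoid (α ⊕ β)} (h : colMat s = colMat t) :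
    s = t := by
  classical
  have key : ∀ (s t : Setoid (α ⊕ β)), colMat s = colMat t → ∀ x y, s x y → t x y := by
    intro s t h x y hxy
    let c : α ⊕ β → Bool := fun z => decide (t x z)
    have hc : Compat t (c ∘ Sum.inl) (c ∘ Sum.inr) := by
      intro u v huv
      have : t x u ↔ t x v := ⟨fun h => t.trans' h huv, fun h => t.trans' h (t.symm' huv)⟩
      rcases u with u | u <;> rcases v with v | v <;> simp [c, this]
    have h1 := congrFun (congrFun h (c ∘ Sum.inl)) (c ∘ Sum.inr)
    simp only [colMat, if_pos hc] at h1
    have hs : Compat s (c ∘ Sum.inl) (c ∘ Sum.inr) := by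
      by_contra hn
      simp [hn] at h1
    have h2 := hs x y hxy
    have hx : c x = true := by simp [c]
    have : c x = c y := by
      rcases x with x | x <;> rcases y with y | y <;> simpa using h2
    rw [hx] at this
    simpa [c] using this.symm
  ext x y
  exact ⟨key s t h x y, key t s h.symm x y⟩

theorem colMat_smul_injective {α β : Type} {s t : Setoid (α ⊕ β)} {a b : ℕ}
    (h : 2 ^ a • colMat s = 2 ^ b • colMat t) : a = b ∧ s = t := by
  have hab : a = b := by
    have h1 := congrFun (congrFun h (fun _ => true)) (fun _ => true)
    have hs : ∀ s : Setoid (α ⊕ β), colMat s (fun _ => true) (fun _ => true) = 1 := by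
      intro s
      have : Compat s (fun _ => true) (fun _ => true) := by
        intro u v _
        rcases u with u | u <;> rcases v with v | v <;> rfl
      simp [colMat, this]
    simp only [Matrix.smul_apply, hs, smul_eq_mul, mul_one] at h1
    exact Nat.pow_right_injective (le_refl 2) h1
  subst hab
  refine ⟨rfl, colMat_injective ?_⟩
  ext i j
  have h1 := congrFun (congrFun h i) j
  simp only [Matrix.smul_apply, smul_eq_mul] at h1
  exact Nat.eq_of_mul_eq_mul_left (by positivity) h1

theorem glue_assoc {α β γ ε : Type} [Finite α] [Finite β] [Finite γ] [Finite ε]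
    (s : Setoid (α ⊕ β)) (t : Setoid (β ⊕ γ)) (r : Setoid (γ ⊕ ε)) :
    glueLoops s t + glueLoops (glueComp s t) r = glueLoops t r + glueLoops s (glueComp t r) ∧
      glueComp (glueComp s t) r = glueComp s (glueComp t r) := by
  classical
  have := Fintype.ofFinite α
  have := Fintype.ofFinite β
  have := Fintype.ofFinite γ
  have := Fintype.ofFinite ε
  have h := Matrix.mul_assoc (colMat s) (colMat t) (colMat r)
  rw [colMat_mul, colMat_mul, Matrix.smul_mul, Matrix.mul_smul, colMat_mul, colMat_mul,
    smul_smul, smul_smul, ← pow_add, ← pow_add] at h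
  exact colMat_smul_injective h

end Glue

/-! ### Perfect matchings -/

section Matching

/-- Every point is joined to exactly one other point. -/
def IsMatching {X : Type} (s : Setoid X) : Prop := ∀ x, ∃! y, y ≠ x ∧ s x y

theorem IsMatching.even_card {X : Type} [Fintype X] {s : Setoid X} (hs : IsMatching s)
    (S : Finset X) (hS : ∀ x y, s x y → x ∈ S → y ∈ S) : Even S.card := by
  classical
  choose f hf hf' using hs
  have h : ∑ _x ∈ S, (1 : ZMod 2) = 0 := by
    refine Finset.sum_involution (fun x _ => f x) ?_ ?_ ?_ ?_
    · intros; decide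
    · intro x _ _; exact (hf x).1
    · intro x hx; exact hS _ _ (hf x).2 hx
    · intro x _
      exact (hf' (f x) x ⟨(hf x).1.symm, s.symm' (hf x).2⟩).symm
  rw [Finset.sum_const, nsmul_eq_mul, mul_one] at h
  exact (ZMod.natCast_eq_zero_iff_even).1 h

/-- A component of the stacked picture of two matchings has at most two outer points. -/
theorem card_outer_le {α β γ : Type} [Fintype α] [Fintype β] [Fintype γ] {s : Setoid (α ⊕ β)}
    {t : Setoid (β ⊕ γ)} (hs : IsMatching s) (ht : IsMatching t) (P : α ⊕ (β ⊕ γ) → Prop)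
    [DecidablePred P] (hne : ∃ x, P x) (hP : ∀ x y, P x → (glue s t x y ↔ P y)) :
    (∑ a : α, if P (Sum.inl a) then 1 else 0) +
      (∑ c : γ, if P (Sum.inr (Sum.inr c)) then 1 else 0) ≤ 2 := by
  classical
  choose f hf hf' using hs
  choose g hg hg' using ht
  have hrs : ∀ {x y}, GlueRel s t x y → GlueRel s t y x := by
    rintro x y (⟨u, v, h, rfl, rfl⟩ | ⟨u, v, h, rfl, rfl⟩)
    · exact Or.inl ⟨v, u, s.symm' h, rfl, rfl⟩
    · exact Or.inr ⟨v, u, t.symm' h, rfl, rfl⟩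
  let G : SimpleGraph {x // P x} :=
    { Adj := fun x y => x ≠ y ∧ GlueRel s t x.1 y.1
      symm := ⟨fun x y h => ⟨h.1.symm, hrs h.2⟩⟩
      loopless := ⟨fun x h => h.1 rfl⟩ }
  let R : Setoid (α ⊕ (β ⊕ γ)) :=
    { r := fun x y => (P x ↔ P y) ∧ ∀ hx hy, G.Reachable ⟨x, hx⟩ ⟨y, hy⟩
      iseqv := ⟨fun x => ⟨Iff.rfl, fun _ _ => SimpleGraph.Reachable.refl _⟩,
        fun h => ⟨h.1.symm, fun hx hy => (h.2 hy hx).symm⟩,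
        fun h1 h2 => ⟨h1.1.trans h2.1,
          fun hx hy => (h1.2 hx (h1.1.1 hx)).trans (h2.2 (h1.1.1 hx) hy)⟩⟩ }
  have hR : ∀ x y, GlueRel s t x y → R x y := by
    intro x y h
    have hg : glue s t x y := Relation.EqvGen.rel _ _ h
    refine ⟨⟨fun hx => (hP x y hx).1 hg, fun hy => (hP y x hy).1 ((glue s t).symm' hg)⟩, ?_⟩
    intro hx hy
    by_cases hxy : x = y
    · subst hxy; exact SimpleGraph.Reachable.refl _
    · exact SimpleGraph.Adj.reachable
        (show G.Adj ⟨x, hx⟩ ⟨y, hy⟩ from ⟨fun h => hxy (congrArg Subtype.val h), h⟩)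
  have hconn : G.Connected := by
    obtain ⟨x0, hx0⟩ := hne
    have : Nonempty {x // P x} := ⟨⟨x0, hx0⟩⟩
    refine SimpleGraph.Connected.mk ?_
    rintro ⟨x, hx⟩ ⟨y, hy⟩
    have h : R x y := glue_le R (fun u v h => hR _ _ (Or.inl ⟨u, v, h, rfl, rfl⟩))
      (fun u v h => hR _ _ (Or.inr ⟨u, v, h, rfl, rfl⟩)) ((hP x y hx).2 hy)
    exact h.2 hx hy
  have hE := hconn.card_vert_le_card_edgeSet_add_one
  have hD := G.sum_degrees_eq_twice_card_edges
  let w : α ⊕ (β ⊕ γ) → ℕ := Sum.elim (fun _ => 1) (Sum.elim (fun _ => 2) (fun _ => 1))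
  have hdeg : ∀ v : {x // P x}, G.degree v ≤ w v.1 := by
    rintro ⟨x, hx⟩
    rw [← SimpleGraph.card_neighborFinset_eq_degree,
      ← Finset.card_image_of_injective _ Subtype.val_injective]
    have hsub : (G.neighborFinset ⟨x, hx⟩).image Subtype.val ⊆
        (Sum.elim (fun a => {Sum.map id Sum.inl (f (Sum.inl a))})
          (Sum.elim (fun b => {Sum.map id Sum.inl (f (Sum.inr b)), Sum.inr (g (Sum.inl b))})
            (fun c => {Sum.inr (g (Sum.inr c))})) x : Finset (α ⊕ (β ⊕ γ))) := by
      intro y hy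
      obtain ⟨⟨y, hy'⟩, hadj, rfl⟩ := Finset.mem_image.1 hy
      rw [SimpleGraph.mem_neighborFinset] at hadj
      have hne : x ≠ y := fun h => hadj.1 (Subtype.ext h)
      rcases hadj.2 with ⟨u, v, h, h1, h2⟩ | ⟨u, v, h, h1, h2⟩
      · have hv : v = f u := hf' u v ⟨fun e => hne (by subst e; exact h1.symm.trans h2), h⟩
        change Sum.map id Sum.inl u = x at h1
        change Sum.map id Sum.inl v = y at h2
        subst h1 h2 hv
        rcases u with u | u <;> simp
      · have hv : v = g u := hg' u v ⟨fun e => hne (by subst e; exact h1.symm.trans h2), h⟩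
        change Sum.inr u = x at h1
        change Sum.inr v = y at h2
        subst h1 h2 hv
        rcases u with u | u <;> simp
    refine (Finset.card_le_card hsub).trans ?_
    rcases x with x | x | x
    · simp [w]
    · exact Finset.card_le_two
    · simp [w]
  have hsum : ∑ v, G.degree v ≤ ∑ v : {x // P x}, w v.1 := Finset.sum_le_sum fun v _ => hdeg v
  have hw : ∑ v : {x // P x}, w v.1 = ∑ x, if P x then w x else 0 := by
    rw [← Finset.sum_filter]
    exact (Finset.sum_subtype _ (by simp) _).symm
  have hV : Nat.card {x // P x} = ∑ x, if P x then 1 else 0 := by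
    rw [Nat.card_eq_fintype_card, Fintype.card_subtype, Finset.card_filter]
  rw [hw, hD, Fintype.sum_sum_type, Fintype.sum_sum_type] at hsum
  rw [hV, Fintype.sum_sum_type, Fintype.sum_sum_type, Nat.card_eq_fintype_card,
    ← SimpleGraph.edgeFinset_card] at hE
  simp only [w, Sum.elim_inl, Sum.elim_inr] at hsum
  have h2 : (∑ b : β, if P (Sum.inr (Sum.inl b)) then 2 else 0) =
      2 * ∑ b : β, if P (Sum.inr (Sum.inl b)) then 1 else 0 := by
    rw [Finset.mul_sum]
    exact Finset.sum_congr rfl fun b _ => by split_ifs <;> rfl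
  omega

/-- A component of the stacked picture of two matchings has an even number of outer points. -/
theorem even_outer {α β γ : Type} [Fintype α] [Fintype β] [Fintype γ] {s : Setoid (α ⊕ β)}
    {t : Setoid (β ⊕ γ)} (hs : IsMatching s) (ht : IsMatching t) (P : α ⊕ (β ⊕ γ) → Prop)
    [DecidablePred P] (hP : ∀ x y, glue s t x y → P x → P y) :
    Even ((∑ a : α, if P (Sum.inl a) then 1 else 0) +
      (∑ c : γ, if P (Sum.inr (Sum.inr c)) then 1 else 0)) := by
  classical
  have h1 := hs.even_card (Finset.univ.filter fun u => P (Sum.map id Sum.inl u)) (by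
    intro x y hxy hx
    simp only [Finset.mem_filter, Finset.mem_univ, true_and] at hx ⊢
    exact hP _ _ (glue_top t hxy) hx)
  have h2 := ht.even_card (Finset.univ.filter fun u => P (Sum.inr u)) (by
    intro x y hxy hx
    simp only [Finset.mem_filter, Finset.mem_univ, true_and] at hx ⊢
    exact hP _ _ (glue_bot s hxy) hx)
  rw [Finset.card_filter, Fintype.sum_sum_type] at h1 h2
  change Even ((∑ a : α, if P (Sum.inl a) then 1 else 0) +
    ∑ b : β, if P (Sum.inr (Sum.inl b)) then 1 else 0) at h1
  obtain ⟨a, ha⟩ := h1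
  obtain ⟨b, hb⟩ := h2
  rw [Nat.even_iff]
  omega

theorem IsMatching.glueComp {α β γ : Type} [Fintype α] [Fintype β] [Fintype γ]
    {s : Setoid (α ⊕ β)} {t : Setoid (β ⊕ γ)} (hs : IsMatching s) (ht : IsMatching t) :
    IsMatching (glueComp s t) := by
  classical
  intro x
  have h1 := card_outer_le hs ht (fun y => glue s t (outer x) y) ⟨_, (glue s t).refl' _⟩
    (fun y z hy => ⟨fun h => (glue s t).trans' hy h,
      fun h => (glue s t).trans' ((glue s t).symm' hy) h⟩)
  have h2 := even_outer hs ht (fun y => glue s t (outer x) y)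
    (fun y z hyz hy => (glue s t).trans' hy hyz)
  have h3 : (Finset.univ.filter fun y => TemperleyLieb.glueComp s t x y).card =
      (∑ a : α, if glue s t (outer x) (Sum.inl a) then 1 else 0) +
        (∑ c : γ, if glue s t (outer x) (Sum.inr (Sum.inr c)) then 1 else 0) := by
    rw [Finset.card_filter, Fintype.sum_sum_type]
    rfl
  rw [← h3] at h1 h2
  have hx : x ∈ Finset.univ.filter fun y => TemperleyLieb.glueComp s t x y := by
    simp
  have h4 : ((Finset.univ.filter fun y => TemperleyLieb.glueComp s t x y).erase x).card = 1 := by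
    have := Finset.card_erase_add_one hx
    obtain ⟨a, ha⟩ := h2
    omega
  obtain ⟨y, hy⟩ := Finset.card_eq_one.1 h4
  have hmem : ∀ z, (z ≠ x ∧ TemperleyLieb.glueComp s t x z) ↔ z = y := by
    intro z
    have := Finset.ext_iff.1 hy z
    simpa using this
  exact ⟨y, (hmem y).2 rfl, fun z hz => (hmem z).1 hz⟩

end Matching

/-! ### Planar diagrams -/

section Planar

/-- Position of a point on the boundary of the rectangle, read clockwise from the upper left
corner: the upper row from left to right, then the lower row from right to left. -/
def pos {m n : ℕ} : Fin m ⊕ Fin n → ℕ := Sum.elim (fun i => (i : ℕ)) (fun j => m + (n - 1 - (j : ℕ)))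

theorem pos_injective {m n : ℕ} : Function.Injective (pos (m := m) (n := n)) := by
  rintro (x | x) (y | y) h <;> simp only [pos, Sum.elim_inl, Sum.elim_inr] at h <;>
    simp only [Sum.inl.injEq, Sum.inr.injEq, Fin.ext_iff, reduceCtorEq] <;> omega

/-- No two joins intersect when drawn in the rectangle. -/
def Noncrossing {m n : ℕ} (s : Setoid (Fin m ⊕ Fin n)) : Prop :=
  ∀ x y z w, pos x < pos y → pos y < pos z → pos z < pos w → s x z → ¬ s y w

open Classical in
/-- Number of points of `S` before `u` on the boundary. -/
noncomputable def cntPos {m n : ℕ} (S : Fin m ⊕ Fin n → Prop) (u : Fin m ⊕ Fin n) : ℕ :=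
  ∑ t, if S t ∧ pos t < pos u then 1 else 0

open Classical in
/-- Number of points of `S` in the same row as `u` and to the left of `u`. -/
noncomputable def cntRow {m n : ℕ} (S : Fin m ⊕ Fin n → Prop) : Fin m ⊕ Fin n → ℕ :=
  Sum.elim (fun i => ∑ t : Fin m, if S (Sum.inl t) ∧ t < i then 1 else 0)
    (fun j => ∑ t : Fin n, if S (Sum.inr t) ∧ t < j then 1 else 0)

open Classical in
theorem cntPos_mod {m n : ℕ} (S : Fin m ⊕ Fin n → Prop)
    (hS : Even (∑ t, if S t then 1 else 0)) (u : Fin m ⊕ Fin n) (hu : ¬ S u) :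
    cntPos S u % 2 = cntRow S u % 2 := by
  rw [Fintype.sum_sum_type] at hS
  rcases u with i | j
  · have h : cntPos S (Sum.inl i) = cntRow S (Sum.inl i) := by
      rw [cntPos, Fintype.sum_sum_type]
      rw [Finset.sum_eq_zero (s := (Finset.univ : Finset (Fin n))), add_zero]
      · rfl
      · intro t _
        refine if_neg ?_
        rintro ⟨-, h⟩
        simp only [pos, Sum.elim_inl, Sum.elim_inr] at h
        omega
    rw [h]
  · have h1 : cntPos S (Sum.inr j) = (∑ t : Fin m, if S (Sum.inl t) then 1 else 0) +
        ∑ t : Fin n, if S (Sum.inr t) ∧ j < t then 1 else 0 := by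
      rw [cntPos, Fintype.sum_sum_type]
      congr 1
      · refine Finset.sum_congr rfl fun t _ => if_congr ?_ rfl rfl
        simp only [pos, Sum.elim_inl, Sum.elim_inr, and_iff_left_iff_imp]
        intro _
        omega
      · refine Finset.sum_congr rfl fun t _ => if_congr ?_ rfl rfl
        simp only [pos, Sum.elim_inr, Fin.lt_def, and_congr_right_iff]
        intro _
        omega
    have h2 : (∑ t : Fin n, if S (Sum.inr t) then 1 else 0) = cntRow S (Sum.inr j) +
        ∑ t : Fin n, if S (Sum.inr t) ∧ j < t then 1 else 0 := by
      simp only [cntRow, Sum.elim_inr]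
      rw [← Finset.sum_add_distrib]
      refine Finset.sum_congr rfl fun t _ => ?_
      rcases lt_trichotomy t j with h | h | h
      · simp [h, h.not_gt]
      · subst h; simp [hu]
      · simp [h, h.not_gt]
    obtain ⟨a, ha⟩ := hS
    omega

theorem cntPos_rel_aux {m n : ℕ} {s : Setoid (Fin m ⊕ Fin n)} (hs : IsMatching s)
    (hc : Noncrossing s) (S : Fin m ⊕ Fin n → Prop) (hS : ∀ x y, s x y → S x → S y)
    {u v : Fin m ⊕ Fin n} (hu : ¬ S u) (huv : s u v) (hlt : pos u < pos v) :
    cntPos S u % 2 = cntPos S v % 2 := by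
  classical
  have h1 := hs.even_card (Finset.univ.filter fun t => S t ∧ pos u < pos t ∧ pos t < pos v) (by
    intro x y hxy hx
    simp only [Finset.mem_filter, Finset.mem_univ, true_and] at hx ⊢
    have hy := hS _ _ hxy hx.1
    have hyu : pos y ≠ pos u := fun h => hu (pos_injective h ▸ hy)
    have hyv : pos y ≠ pos v := fun h => hu (hS _ _ (s.symm' huv) (pos_injective h ▸ hy))
    refine ⟨hy, ?_, ?_⟩
    · by_contra hlt'
      exact hc y u x v (by omega) hx.2.1 hx.2.2 (s.symm' hxy) huv
    · by_contra hlt'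
      exact hc u x v y hx.2.1 hx.2.2 (by omega) huv hxy)
  rw [Finset.card_filter] at h1
  have h2 : cntPos S v = cntPos S u +
      ∑ t, if S t ∧ pos u < pos t ∧ pos t < pos v then 1 else 0 := by
    rw [cntPos, cntPos, ← Finset.sum_add_distrib]
    refine Finset.sum_congr rfl fun t _ => ?_
    by_cases hSt : S t
    · have : pos t ≠ pos u := fun h => hu (pos_injective h ▸ hSt)
      simp only [hSt, true_and]
      split_ifs <;> omega
    · simp [hSt]
  obtain ⟨a, ha⟩ := h1
  omega

open Classical in
theorem cntRow_rel {m n : ℕ} {s : Setoid (Fin m ⊕ Fin n)} (hs : IsMatching s)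
    (hc : Noncrossing s) (S : Fin m ⊕ Fin n → Prop) (hS : ∀ x y, s x y → S x → S y)
    {u v : Fin m ⊕ Fin n} (hu : ¬ S u) (huv : s u v) :
    cntRow S u % 2 = cntRow S v % 2 := by
  have hv : ¬ S v := fun h => hu (hS _ _ (s.symm' huv) h)
  have hev : Even (∑ t, if S t then 1 else 0) := by
    have := hs.even_card (Finset.univ.filter fun t => S t) (by
      intro x y hxy hx
      simp only [Finset.mem_filter, Finset.mem_univ, true_and] at hx ⊢
      exact hS _ _ hxy hx)
    rwa [Finset.card_filter] at this
  rw [← cntPos_mod S hev u hu, ← cntPos_mod S hev v hv]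
  rcases lt_trichotomy (pos u) (pos v) with h | h | h
  · exact cntPos_rel_aux hs hc S hS hu huv h
  · rw [pos_injective h]
  · exact (cntPos_rel_aux hs hc S hS hv (s.symm' huv) h).symm

theorem Noncrossing.glueComp {m n p : ℕ} {s : Setoid (Fin m ⊕ Fin n)}
    {t : Setoid (Fin n ⊕ Fin p)} (hs : IsMatching s) (ht : IsMatching t) (hs' : Noncrossing s)
    (ht' : Noncrossing t) : Noncrossing (glueComp s t) := by
  classical
  intro x y z w hxy hyz hzw hxz hyw
  have hm := IsMatching.glueComp hs ht
  set g := TemperleyLieb.glueComp s t with hg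
  have hxmem : ∀ v, g x v ↔ v = x ∨ v = z := by
    intro v
    constructor
    · intro h
      by_cases hv : v = x
      · exact Or.inl hv
      · refine Or.inr ((hm x).unique ⟨hv, h⟩ ⟨?_, hxz⟩)
        intro h'
        rw [h'] at hyz
        omega
    · rintro (rfl | rfl)
      · exact g.refl' _
      · exact hxz
  let P : Fin m ⊕ (Fin n ⊕ Fin p) → Prop := fun v => glue s t (outer x) v
  have hP : ∀ u v, glue s t u v → P u → P v := fun u v h hu => (glue s t).trans' hu h
  let σ : Fin m ⊕ (Fin n ⊕ Fin p) → ℕ :=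
    Sum.elim (fun i => ∑ a : Fin m, if P (Sum.inl a) ∧ a < i then 1 else 0)
      (Sum.elim (fun i => ∑ a : Fin n, if P (Sum.inr (Sum.inl a)) ∧ a < i then 1 else 0)
        (fun i => ∑ a : Fin p, if P (Sum.inr (Sum.inr a)) ∧ a < i then 1 else 0))
  let R : Setoid (Fin m ⊕ (Fin n ⊕ Fin p)) :=
    { r := fun u v => (P u ↔ P v) ∧ (¬ P u → σ u % 2 = σ v % 2)
      iseqv := ⟨fun _ => ⟨Iff.rfl, fun _ => rfl⟩,
        fun h => ⟨h.1.symm, fun hv => (h.2 (fun hu => hv (h.1.1 hu))).symm⟩,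
        fun h1 h2 => ⟨h1.1.trans h2.1,
          fun hu => (h1.2 hu).trans (h2.2 (fun hv => hu (h1.1.2 hv)))⟩⟩ }
  have hPiff : ∀ u v, glue s t u v → (P u ↔ P v) := fun u v h =>
    ⟨hP u v h, hP v u ((glue s t).symm' h)⟩
  have hR : R (outer y) (outer w) := by
    refine glue_le R ?_ ?_ (show glue s t (outer y) (outer w) from hyw)
    · intro u v huv
      refine ⟨hPiff _ _ (glue_top t huv), fun hu => ?_⟩
      have h := cntRow_rel hs hs' (fun v => P (Sum.map id Sum.inl v))
        (fun a b hab => hP _ _ (glue_top t hab)) hu huv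
      rcases u with u | u <;> rcases v with v | v <;> exact h
    · intro u v huv
      refine ⟨hPiff _ _ (glue_bot s huv), fun hu => ?_⟩
      have h := cntRow_rel ht ht' (fun v => P (Sum.inr v))
        (fun a b hab => hP _ _ (glue_bot s hab)) hu huv
      rcases u with u | u <;> rcases v with v | v <;> exact h
  have hPout : ∀ v, P (outer v) ↔ v = x ∨ v = z := hxmem
  have hy : ¬ P (outer y) := by
    rw [hPout]
    rintro (rfl | rfl) <;> omega
  have hw : ¬ P (outer w) := by
    rw [hPout]
    rintro (rfl | rfl) <;> omega
  have h1 := hR.2 hy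
  have hσ : ∀ v, σ (outer v) = cntRow (fun v => P (outer v)) v := by
    rintro (v | v) <;> rfl
  have hxz' : x ≠ z := by
    rintro rfl
    omega
  have hsum : ∀ (q : Fin m ⊕ Fin p → Prop) [DecidablePred q], (∑ v, if P (outer v) ∧ q v then 1 else 0) =
      (if q x then 1 else 0) + (if q z then 1 else 0) := by
    intro q _
    rw [← Finset.sum_pair (f := fun v => if q v then 1 else 0) hxz', ← Finset.sum_subset (Finset.subset_univ ({x, z} : Finset _))]
    · refine Finset.sum_congr rfl fun v hv => if_congr ?_ rfl rfl
      rw [hPout]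
      simp only [Finset.mem_insert, Finset.mem_singleton] at hv
      simp [hv]
    · intro v _ hv
      rw [if_neg]
      rintro ⟨h, -⟩
      rw [hPout] at h
      simp [h] at hv
  have hev : Even (∑ v, if P (outer v) then 1 else 0) := by
    have := hsum (fun _ => True)
    simp only [and_true, if_true] at this
    rw [this]
    decide
  have hy' := cntPos_mod (fun v => P (outer v)) hev y hy
  have hw' := cntPos_mod (fun v => P (outer v)) hev w hw
  rw [hσ, hσ, ← hy', ← hw', cntPos, cntPos, hsum, hsum] at h1
  rw [if_pos hxy, if_neg (by omega), if_pos (by omega), if_pos hzw] at h1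
  omega

end Planar

/-! ### Juxtaposition of equivalence relations -/

section Juxt

/-- The disjoint union of two equivalence relations. -/
def sumSetoid {X Y : Type} (s : Setoid X) (t : Setoid Y) : Setoid (X ⊕ Y) where
  r := Sum.LiftRel s t
  iseqv :=
    { refl := by rintro (x | x) <;> constructor <;> exact Setoid.refl' _ _
      symm := fun h => by
        cases h with
        | inl h => exact Sum.LiftRel.inl (Setoid.symm' _ h)
        | inr h => exact Sum.LiftRel.inr (Setoid.symm' _ h)
      trans := fun h h' => by
        cases h with
        | inl h => cases h' with
          | inl h' => exact Sum.LiftRel.inl (Setoid.trans' _ h h')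
        | inr h => cases h' with
          | inr h' => exact Sum.LiftRel.inr (Setoid.trans' _ h h') }

/-- Splitting both rows into a left and a right part. -/
def rowsEquiv {α α₁ α₂ β β₁ β₂ : Type} (e : α ≃ α₁ ⊕ α₂) (f : β ≃ β₁ ⊕ β₂) :
    α ⊕ β ≃ (α₁ ⊕ β₁) ⊕ (α₂ ⊕ β₂) :=
  (Equiv.sumCongr e f).trans (Equiv.sumSumSumComm α₁ α₂ β₁ β₂)

/-- `s` on the left parts of both rows, `t` on the right parts. -/
def juxtSetoid {α α₁ α₂ β β₁ β₂ : Type} (e : α ≃ α₁ ⊕ α₂) (f : β ≃ β₁ ⊕ β₂)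
    (s : Setoid (α₁ ⊕ β₁)) (t : Setoid (α₂ ⊕ β₂)) : Setoid (α ⊕ β) :=
  (sumSetoid s t).comap (rowsEquiv e f)

theorem IsMatching.sum {X Y : Type} {s : Setoid X} {t : Setoid Y} (hs : IsMatching s)
    (ht : IsMatching t) : IsMatching (sumSetoid s t) := by
  rintro (x | x)
  · obtain ⟨y, ⟨h1, h2⟩, h3⟩ := hs x
    refine ⟨Sum.inl y, ⟨by simpa using h1, Sum.LiftRel.inl h2⟩, ?_⟩
    rintro _ ⟨hne, ⟨h⟩⟩
    rw [h3 _ ⟨by simpa using hne, h⟩]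
  · obtain ⟨y, ⟨h1, h2⟩, h3⟩ := ht x
    refine ⟨Sum.inr y, ⟨by simpa using h1, Sum.LiftRel.inr h2⟩, ?_⟩
    rintro _ ⟨hne, _ | h⟩
    rw [h3 _ ⟨by simpa using hne, h⟩]

theorem IsMatching.comap {X Y : Type} (e : X ≃ Y) {s : Setoid Y} (hs : IsMatching s) :
    IsMatching (s.comap e) := by
  intro x
  obtain ⟨y, ⟨h1, h2⟩, h3⟩ := hs (e x)
  refine ⟨e.symm y, ⟨fun h => h1 (by rw [← h, e.apply_symm_apply]), ?_⟩, ?_⟩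
  · change s (e x) (e (e.symm y))
    rwa [e.apply_symm_apply]
  · rintro z ⟨hz, hz'⟩
    rw [← h3 (e z) ⟨fun h => hz (e.injective h), hz'⟩, e.symm_apply_apply]

theorem compat_juxt {α α₁ α₂ β β₁ β₂ : Type} (e : α ≃ α₁ ⊕ α₂) (f : β ≃ β₁ ⊕ β₂)
    (s : Setoid (α₁ ⊕ β₁)) (t : Setoid (α₂ ⊕ β₂)) (i₁ : α₁ → Bool) (i₂ : α₂ → Bool)
    (j₁ : β₁ → Bool) (j₂ : β₂ → Bool) :
    Compat (juxtSetoid e f s t) (Sum.elim i₁ i₂ ∘ e) (Sum.elim j₁ j₂ ∘ f) ↔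
      Compat s i₁ j₁ ∧ Compat t i₂ j₂ := by
  have key : ∀ x, Sum.elim (Sum.elim i₁ i₂ ∘ e) (Sum.elim j₁ j₂ ∘ f) ((rowsEquiv e f).symm x) =
      Sum.elim (Sum.elim i₁ j₁) (Sum.elim i₂ j₂) x := by
    rintro ((x | x) | (x | x)) <;> simp [rowsEquiv]
  constructor
  · intro h
    constructor
    · intro x y hxy
      have := h ((rowsEquiv e f).symm (Sum.inl x)) ((rowsEquiv e f).symm (Sum.inl y)) (by
        change sumSetoid s t _ _
        rw [Equiv.apply_symm_apply, Equiv.apply_symm_apply]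
        exact Sum.LiftRel.inl hxy)
      rwa [key, key] at this
    · intro x y hxy
      have := h ((rowsEquiv e f).symm (Sum.inr x)) ((rowsEquiv e f).symm (Sum.inr y)) (by
        change sumSetoid s t _ _
        rw [Equiv.apply_symm_apply, Equiv.apply_symm_apply]
        exact Sum.LiftRel.inr hxy)
      rwa [key, key] at this
  · rintro ⟨h1, h2⟩ x y hxy
    obtain ⟨x, rfl⟩ := (rowsEquiv e f).symm.surjective x
    obtain ⟨y, rfl⟩ := (rowsEquiv e f).symm.surjective y
    rw [key, key]
    change sumSetoid s t _ _ at hxy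
    rw [Equiv.apply_symm_apply, Equiv.apply_symm_apply] at hxy
    rcases hxy with h | h
    · exact h1 _ _ h
    · exact h2 _ _ h

theorem colMat_juxt {α α₁ α₂ β β₁ β₂ : Type} (e : α ≃ α₁ ⊕ α₂) (f : β ≃ β₁ ⊕ β₂)
    (s : Setoid (α₁ ⊕ β₁)) (t : Setoid (α₂ ⊕ β₂)) (i₁ : α₁ → Bool) (i₂ : α₂ → Bool)
    (j₁ : β₁ → Bool) (j₂ : β₂ → Bool) :
    colMat (juxtSetoid e f s t) (Sum.elim i₁ i₂ ∘ e) (Sum.elim j₁ j₂ ∘ f) =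
      colMat s i₁ j₁ * colMat t i₂ j₂ := by
  have h := compat_juxt e f s t i₁ i₂ j₁ j₂
  by_cases h1 : Compat s i₁ j₁ <;> by_cases h2 : Compat t i₂ j₂ <;> simp [colMat, h, h1, h2]

theorem exists_elim {α α₁ α₂ : Type} (e : α ≃ α₁ ⊕ α₂) (i : α → Bool) :
    ∃ (i₁ : α₁ → Bool) (i₂ : α₂ → Bool), i = Sum.elim i₁ i₂ ∘ e := by
  refine ⟨fun a => i (e.symm (Sum.inl a)), fun a => i (e.symm (Sum.inr a)), ?_⟩
  funext a
  obtain ⟨a, rfl⟩ := e.symm.surjective a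
  rcases a with a | a <;> simp

theorem glue_juxt {α α₁ α₂ β β₁ β₂ γ γ₁ γ₂ : Type} [Finite α] [Finite β] [Finite γ]
    (e : α ≃ α₁ ⊕ α₂) (f : β ≃ β₁ ⊕ β₂) (g : γ ≃ γ₁ ⊕ γ₂) (s : Setoid (α₁ ⊕ β₁))
    (s' : Setoid (α₂ ⊕ β₂)) (t : Setoid (β₁ ⊕ γ₁)) (t' : Setoid (β₂ ⊕ γ₂)) :
    glueLoops (juxtSetoid e f s s') (juxtSetoid f g t t') = glueLoops s t + glueLoops s' t' ∧
      glueComp (juxtSetoid e f s s') (juxtSetoid f g t t') =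
        juxtSetoid e g (glueComp s t) (glueComp s' t') := by
  classical
  have := Fintype.ofFinite α
  have := Fintype.ofFinite β
  have := Fintype.ofFinite γ
  have : Finite (α₁ ⊕ α₂) := Finite.of_equiv α e
  have : Finite (β₁ ⊕ β₂) := Finite.of_equiv β f
  have : Finite (γ₁ ⊕ γ₂) := Finite.of_equiv γ g
  have : Finite α₁ := Finite.of_injective (Sum.inl : α₁ → α₁ ⊕ α₂) Sum.inl_injective
  have : Finite α₂ := Finite.of_injective (Sum.inr : α₂ → α₁ ⊕ α₂) Sum.inr_injective
  have := Fintype.ofFinite α₂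
  have := Fintype.ofFinite α₁
  have : Finite β₁ := Finite.of_injective (Sum.inl : β₁ → β₁ ⊕ β₂) Sum.inl_injective
  have := Fintype.ofFinite β₁
  have : Finite β₂ := Finite.of_injective (Sum.inr : β₂ → β₁ ⊕ β₂) Sum.inr_injective
  have := Fintype.ofFinite β₂
  have : Finite γ₁ := Finite.of_injective (Sum.inl : γ₁ → γ₁ ⊕ γ₂) Sum.inl_injective
  have : Finite γ₂ := Finite.of_injective (Sum.inr : γ₂ → γ₁ ⊕ γ₂) Sum.inr_injective
  have := Fintype.ofFinite γ₂
  have := Fintype.ofFinite γ₁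
  apply colMat_smul_injective
  rw [← colMat_mul]
  ext i k
  obtain ⟨i₁, i₂, rfl⟩ := exists_elim e i
  obtain ⟨k₁, k₂, rfl⟩ := exists_elim g k
  have h1 := congrFun (congrFun (colMat_mul s t) i₁) k₁
  have h2 := congrFun (congrFun (colMat_mul s' t') i₂) k₂
  rw [Matrix.mul_apply, Matrix.smul_apply, smul_eq_mul] at h1 h2
  rw [Matrix.smul_apply, colMat_juxt, smul_eq_mul, pow_add, mul_mul_mul_comm, ← h1, ← h2,
    Matrix.mul_apply, Finset.sum_mul_sum, ← Finset.sum_product', Finset.univ_product_univ]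
  refine (Fintype.sum_equiv
    ((Equiv.sumArrowEquivProdArrow β₁ β₂ Bool).symm.trans (Equiv.arrowCongr f.symm (Equiv.refl _)))
    _ _ ?_).symm
  rintro ⟨j₁, j₂⟩
  have : ((Equiv.sumArrowEquivProdArrow β₁ β₂ Bool).symm.trans
      (Equiv.arrowCongr f.symm (Equiv.refl _))) (j₁, j₂) = Sum.elim j₁ j₂ ∘ f := by
    funext b
    rfl
  rw [this, colMat_juxt, colMat_juxt, mul_mul_mul_comm]

/-- Splitting a row of `N = k + l` points into its first `k` and its last `l` points. -/
def splitFin {k l N : ℕ} (h : k + l = N) : Fin N ≃ Fin k ⊕ Fin l :=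
  (finCongr h.symm).trans finSumFinEquiv.symm

theorem pos_left {a b c d m n : ℕ} (h : a + c = m) (h' : b + d = n) (x : Fin a ⊕ Fin b) :
    (pos x < a ∧ pos ((rowsEquiv (splitFin h) (splitFin h')).symm (Sum.inl x)) = pos x) ∨
      (a ≤ pos x ∧
        pos ((rowsEquiv (splitFin h) (splitFin h')).symm (Sum.inl x)) = pos x + (c + d)) := by
  subst h h'
  rcases x with x | x
  · left
    simp [rowsEquiv, splitFin, pos]
  · right
    simp [rowsEquiv, splitFin, pos]
    omega

theorem pos_right {a b c d m n : ℕ} (h : a + c = m) (h' : b + d = n) (x : Fin c ⊕ Fin d) :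
    pos x < c + d ∧
      pos ((rowsEquiv (splitFin h) (splitFin h')).symm (Sum.inr x)) = a + pos x := by
  subst h h'
  rcases x with x | x
  · simp [rowsEquiv, splitFin, pos]
    omega
  · simp [rowsEquiv, splitFin, pos]
    omega

theorem Noncrossing.juxt {a b c d m n : ℕ} (h : a + c = m) (h' : b + d = n)
    {s : Setoid (Fin a ⊕ Fin b)} {t : Setoid (Fin c ⊕ Fin d)} (hs : Noncrossing s)
    (ht : Noncrossing t) : Noncrossing (juxtSetoid (splitFin h) (splitFin h') s t) := by
  intro x y z w hxy hyz hzw hxz hyw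
  obtain ⟨x, rfl⟩ := (rowsEquiv (splitFin h) (splitFin h')).symm.surjective x
  obtain ⟨y, rfl⟩ := (rowsEquiv (splitFin h) (splitFin h')).symm.surjective y
  obtain ⟨z, rfl⟩ := (rowsEquiv (splitFin h) (splitFin h')).symm.surjective z
  obtain ⟨w, rfl⟩ := (rowsEquiv (splitFin h) (splitFin h')).symm.surjective w
  change sumSetoid s t _ _ at hxz hyw
  rw [Equiv.apply_symm_apply, Equiv.apply_symm_apply] at hxz hyw
  rcases hxz with @⟨x, z, hxz⟩ | @⟨x, z, hxz⟩ <;> rcases hyw with @⟨y, w, hyw⟩ | @⟨y, w, hyw⟩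
  · have h1 := pos_left h h' x
    have h2 := pos_left h h' y
    have h3 := pos_left h h' z
    have h4 := pos_left h h' w
    exact hs x y z w (by omega) (by omega) (by omega) hxz hyw
  · have h1 := pos_left h h' x
    have h2 := pos_right h h' y
    have h3 := pos_left h h' z
    have h4 := pos_right h h' w
    omega
  · have h1 := pos_right h h' x
    have h2 := pos_left h h' y
    have h3 := pos_right h h' z
    have h4 := pos_left h h' w
    omega
  · have h1 := pos_right h h' x
    have h2 := pos_right h h' y
    have h3 := pos_right h h' z
    have h4 := pos_right h h' w
    exact ht x y z w (by omega) (by omega) (by omega) hxz hyw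

end Juxt

/-! ### The Temperley-Lieb category -/

/-- A planar diagram with an upper row of `m` dots and a lower row of `n` dots: each dot is
joined to exactly one other dot, and no two joins intersect when drawn in the rectangle. -/
@[ext]
structure Diagram (m n : ℕ) where
  /-- Two dots are related if they are equal or joined. -/
  rel : Setoid (Fin m ⊕ Fin n)
  isMatching : IsMatching rel
  noncrossing : Noncrossing rel

namespace Diagram

instance (m n : ℕ) : Finite (Diagram m n) :=
  Finite.of_injective (fun d : Diagram m n => fun x y => d.rel x y) fun _ _ h =>
    Diagram.ext (Setoid.ext fun x y => iff_of_eq (congrFun (congrFun h x) y))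

/-- Stacking `d` on top of `e`, and forgetting the closed loops. -/
def comp {m n p : ℕ} (d : Diagram m n) (e : Diagram n p) : Diagram m p where
  rel := glueComp d.rel e.rel
  isMatching := d.isMatching.glueComp e.isMatching
  noncrossing := Noncrossing.glueComp d.isMatching e.isMatching d.noncrossing e.noncrossing

/-- The number of closed loops when `d` is stacked on top of `e`. -/
noncomputable def loops {m n p : ℕ} (d : Diagram m n) (e : Diagram n p) : ℕ :=
  glueLoops d.rel e.rel

/-- The identity diagram: `n` vertical strings. -/
def ident (n : ℕ) : Diagram n n where
  rel := Setoid.ker (Sum.elim id id)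
  isMatching := by
    rintro (x | x)
    · refine ⟨Sum.inr x, by simp [Setoid.ker_def], ?_⟩
      rintro (y | y) <;> simp +contextual [Setoid.ker_def, eq_comm]
    · refine ⟨Sum.inl x, by simp [Setoid.ker_def], ?_⟩
      rintro (y | y) <;> simp +contextual [Setoid.ker_def, eq_comm]
  noncrossing := by
    rintro (x | x) (y | y) (z | z) (w | w) h1 h2 h3 <;>
      simp only [pos, Sum.elim_inl, Sum.elim_inr, Setoid.ker_def, id, Fin.ext_iff]
        at h1 h2 h3 ⊢ <;> omega

theorem ident_rel {n : ℕ} (x y : Fin n ⊕ Fin n) :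
    (ident n).rel x y ↔ Sum.elim id id x = Sum.elim id id y := Iff.rfl

/-- Juxtaposition: `x` on the left of `y`. -/
def juxt {a b c d m n : ℕ} (h : a + c = m) (h' : b + d = n) (x : Diagram a b) (y : Diagram c d) :
    Diagram m n where
  rel := juxtSetoid (splitFin h) (splitFin h') x.rel y.rel
  isMatching := (x.isMatching.sum y.isMatching).comap _
  noncrossing := x.noncrossing.juxt h h' y.noncrossing

theorem colMat_id (n : ℕ) : colMat (ident n).rel = 1 := by
  classical
  ext i j
  rw [Matrix.one_apply, colMat]
  refine if_congr ?_ rfl rfl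
  constructor
  · intro h
    funext x
    exact h (Sum.inl x) (Sum.inr x) rfl
  · rintro rfl (x | x) (y | y) h <;> exact congrArg i h

theorem id_comp {m n : ℕ} (d : Diagram m n) : loops (ident m) d = 0 ∧ (ident m).comp d = d := by
  have h := colMat_mul (ident m).rel d.rel
  rw [colMat_id, Matrix.one_mul] at h
  have := colMat_smul_injective (a := 0) ((by rw [pow_zero, one_smul] : _ = colMat d.rel).trans h)
  exact ⟨this.1.symm, Diagram.ext this.2.symm⟩

theorem comp_id {m n : ℕ} (d : Diagram m n) : loops d (ident n) = 0 ∧ d.comp (ident n) = d := by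
  have h := colMat_mul d.rel (ident n).rel
  rw [colMat_id, Matrix.mul_one] at h
  have := colMat_smul_injective (a := 0) ((by rw [pow_zero, one_smul] : _ = colMat d.rel).trans h)
  exact ⟨this.1.symm, Diagram.ext this.2.symm⟩

theorem comp_assoc {m n p q : ℕ} (d : Diagram m n) (e : Diagram n p) (f : Diagram p q) :
    loops d e + loops (d.comp e) f = loops e f + loops d (e.comp f) ∧
      (d.comp e).comp f = d.comp (e.comp f) := by
  have h := glue_assoc d.rel e.rel f.rel
  exact ⟨h.1, Diagram.ext h.2⟩

theorem juxt_comp {k l N : ℕ} (h : k + l = N) (x x' : Diagram k k) (y y' : Diagram l l) :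
    loops (juxt h h x y) (juxt h h x' y') = loops x x' + loops y y' ∧
      (juxt h h x y).comp (juxt h h x' y') = juxt h h (x.comp x') (y.comp y') := by
  have := glue_juxt (splitFin h) (splitFin h) (splitFin h) x.rel y.rel x'.rel y'.rel
  exact ⟨this.1, Diagram.ext this.2⟩

theorem juxt_ident {k l N : ℕ} (h : k + l = N) : juxt h h (ident k) (ident l) = ident N := by
  refine Diagram.ext (Setoid.ext fun x y => ?_)
  obtain ⟨x, rfl⟩ := (rowsEquiv (splitFin h) (splitFin h)).symm.surjective x
  obtain ⟨y, rfl⟩ := (rowsEquiv (splitFin h) (splitFin h)).symm.surjective y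
  have h1 : (juxt h h (ident k) (ident l)).rel ((rowsEquiv (splitFin h) (splitFin h)).symm x)
      ((rowsEquiv (splitFin h) (splitFin h)).symm y) ↔ Sum.LiftRel (ident k).rel (ident l).rel x y := by
    change Sum.LiftRel _ _ _ _ ↔ _
    rw [Equiv.apply_symm_apply, Equiv.apply_symm_apply]
  rw [h1]
  rcases x with (x | x) | (x | x) <;> rcases y with (y | y) | (y | y) <;>
    simp [ident_rel, rowsEquiv]

end Diagram

/-- Morphisms from `m` to `n` in the Temperley-Lieb category with parameter `δ`: formal linear
combinations of planar diagrams. -/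
def Hom {K : Type u} [Field K] (_δ : K) (m n : ℕ) : Type u := Diagram m n →₀ K

section Category

variable {K : Type u} [Field K] {δ : K}

noncomputable instance (m n : ℕ) : AddCommGroup (Hom δ m n) :=
  inferInstanceAs (AddCommGroup (Diagram m n →₀ K))

noncomputable instance (m n : ℕ) : Module K (Hom δ m n) :=
  inferInstanceAs (Module K (Diagram m n →₀ K))

instance (m n : ℕ) : Module.Finite K (Hom δ m n) :=
  inferInstanceAs (Module.Finite K (Diagram m n →₀ K))

/-- A diagram, seen as a morphism. -/
noncomputable def Hom.of {m n : ℕ} (d : Diagram m n) : Hom δ m n := Finsupp.single d 1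

/-- The linear extension of a function on diagrams. -/
noncomputable def Hom.lift {V : Type*} [AddCommGroup V] [Module K V] {m n : ℕ}
    (f : Diagram m n → V) : Hom δ m n →ₗ[K] V :=
  Finsupp.lift V K (Diagram m n) f

@[simp]
theorem Hom.lift_of {V : Type*} [AddCommGroup V] [Module K V] {m n : ℕ}
    (f : Diagram m n → V) (d : Diagram m n) : Hom.lift f (Hom.of d : Hom δ m n) = f d := by
  change Finsupp.lift V K (Diagram m n) f (Finsupp.single d 1) = f d
  simp

theorem Hom.ext' {V : Type*} [AddCommGroup V] [Module K V] {m n : ℕ}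
    {f g : Hom δ m n →ₗ[K] V} (h : ∀ d, f (Hom.of d) = g (Hom.of d)) : f = g :=
  Finsupp.lhom_ext' fun d => LinearMap.ext_ring (h d)

/-- Composition of morphisms: stacking the first diagram on top of the second one, each closed
loop being replaced by a factor `δ`. -/
noncomputable def Hom.comp {m n p : ℕ} : Hom δ m n →ₗ[K] Hom δ n p →ₗ[K] Hom δ m p :=
  Hom.lift fun d => Hom.lift fun e => δ ^ d.loops e • Hom.of (d.comp e)

@[simp]
theorem Hom.comp_of {m n p : ℕ} (d : Diagram m n) (e : Diagram n p) :
    Hom.comp (Hom.of d : Hom δ m n) (Hom.of e : Hom δ n p) = δ ^ d.loops e • Hom.of (d.comp e) := by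
  simp [Hom.comp]

theorem Hom.comp_assoc {m n p q : ℕ} (x : Hom δ m n) (y : Hom δ n p) (z : Hom δ p q) :
    Hom.comp (Hom.comp x y) z = Hom.comp x (Hom.comp y z) := by
  have h : (Hom.comp (δ := δ) (m := m) (n := p) (p := q)).compr₂
      (LinearMap.id) ∘ₗ LinearMap.id = Hom.comp := rfl
  suffices H : (LinearMap.llcomp K _ _ _ (Hom.comp (δ := δ) (m := m) (n := p) (p := q))) ∘ₗ
      (Hom.comp (δ := δ) (m := m) (n := n) (p := p)) =
      (LinearMap.lcomp K _ (Hom.comp (δ := δ) (m := n) (n := p) (p := q))) ∘ₗ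
      (LinearMap.llcomp K _ _ _ ) ∘ₗ (Hom.comp (δ := δ) (m := m) (n := n) (p := q)) by
    exact LinearMap.congr_fun (LinearMap.congr_fun (LinearMap.congr_fun H x) y) z
  refine Hom.ext' fun d => Hom.ext' fun e => Hom.ext' fun f => ?_
  have h := Diagram.comp_assoc d e f
  simp [smul_smul, ← pow_add, h.1, h.2]

theorem Hom.id_comp {m n : ℕ} (x : Hom δ m n) : Hom.comp (Hom.of (Diagram.ident m)) x = x := by
  suffices H : Hom.comp (Hom.of (Diagram.ident m) : Hom δ m m) = (LinearMap.id : Hom δ m n →ₗ[K] _) by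
    rw [H]; rfl
  refine Hom.ext' fun d => ?_
  have h := Diagram.id_comp d
  simp [h.1, h.2]

theorem Hom.comp_id {m n : ℕ} (x : Hom δ m n) : Hom.comp x (Hom.of (Diagram.ident n)) = x := by
  suffices H : Hom.comp.flip (Hom.of (Diagram.ident n) : Hom δ n n) =
      (LinearMap.id : Hom δ m n →ₗ[K] _) by
    exact LinearMap.congr_fun H x
  refine Hom.ext' fun d => ?_
  have h := Diagram.comp_id d
  simp [h.1, h.2]

end Category

/-- The Temperley-Lieb algebra `TL_n(δ)`: the endomorphism algebra of the object `n` of the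
Temperley-Lieb category. -/
def TL {K : Type u} [Field K] (δ : K) (n : ℕ) : Type u := Hom δ n n

section Algebra

variable {K : Type u} [Field K] {δ : K}

noncomputable instance (n : ℕ) : AddCommGroup (TL δ n) := inferInstanceAs (AddCommGroup (Hom δ n n))

noncomputable instance (n : ℕ) : Module K (TL δ n) := inferInstanceAs (Module K (Hom δ n n))

instance (n : ℕ) : Module.Finite K (TL δ n) := inferInstanceAs (Module.Finite K (Hom δ n n))

noncomputable instance (n : ℕ) : Ring (TL δ n) :=
  { (inferInstance : AddCommGroup (TL δ n)) with
    mul := fun x y => Hom.comp (δ := δ) (m := n) (n := n) (p := n) x y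
    one := Hom.of (Diagram.ident n)
    mul_assoc := Hom.comp_assoc
    one_mul := Hom.id_comp
    mul_one := Hom.comp_id
    zero_mul := fun x => LinearMap.map_zero₂ Hom.comp x
    mul_zero := fun x => map_zero (Hom.comp x)
    left_distrib := fun x y z => map_add (Hom.comp x) y z
    right_distrib := fun x y z => LinearMap.map_add₂ Hom.comp x y z }

noncomputable instance (n : ℕ) : Algebra K (TL δ n) :=
  Algebra.ofModule
    (fun r x y => LinearMap.map_smul₂ Hom.comp r x y)
    (fun r x y => map_smul (Hom.comp x) r y)

/-- `Hom(n, k)` is a left module over `TL_n = Hom(n, n)`. -/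
noncomputable instance (n k : ℕ) : Module (TL δ n) (Hom δ n k) where
  smul a x := Hom.comp (δ := δ) (m := n) (n := n) (p := k) a x
  one_smul := Hom.id_comp
  mul_smul := Hom.comp_assoc
  smul_zero a := map_zero (Hom.comp a)
  smul_add a x y := map_add (Hom.comp a) x y
  add_smul a b x := LinearMap.map_add₂ Hom.comp a b x
  zero_smul x := LinearMap.map_zero₂ Hom.comp x

instance (n k : ℕ) : IsScalarTower K (TL δ n) (Hom δ n k) where
  smul_assoc r a x := LinearMap.map_smul₂ Hom.comp r a x

/-- A diagram, seen as an element of the Temperley-Lieb algebra. -/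
noncomputable def TL.of {n : ℕ} (d : Diagram n n) : TL δ n := Hom.of d

theorem TL.of_mul {n : ℕ} (d e : Diagram n n) :
    (TL.of d * TL.of e : TL δ n) = δ ^ d.loops e • TL.of (d.comp e) :=
  Hom.comp_of d e

theorem TL.one_def {n : ℕ} : (1 : TL δ n) = TL.of (Diagram.ident n) := rfl

theorem TL.induction {n : ℕ} {P : TL δ n → Prop} (h0 : P 0)
    (hadd : ∀ x y, P x → P y → P (x + y)) (hsmul : ∀ (c : K) x, P x → P (c • x))
    (hof : ∀ d, P (TL.of d)) (x : TL δ n) : P x := by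
  refine Finsupp.induction_linear (motive := P) x h0 hadd fun d c => ?_
  have h := hsmul c _ (hof d)
  have e : (c • TL.of d : TL δ n) = (Finsupp.single d c : Diagram n n →₀ K) := by
    change c • (Finsupp.single d 1 : Diagram n n →₀ K) = _
    simp
  rwa [e] at h

/-- Juxtaposition of diagrams, extended bilinearly. -/
noncomputable def juxtLin {k l N : ℕ} (h : k + l = N) : TL δ k →ₗ[K] TL δ l →ₗ[K] TL δ N :=
  Hom.lift fun x => Hom.lift fun y => TL.of (Diagram.juxt h h x y)

theorem juxtLin_of {k l N : ℕ} (h : k + l = N) (x : Diagram k k) (y : Diagram l l) :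
    juxtLin h (TL.of x : TL δ k) (TL.of y) = TL.of (Diagram.juxt h h x y) := by
  change (Hom.lift fun x => Hom.lift fun y => TL.of (Diagram.juxt h h x y) :
    Hom δ k k →ₗ[K] Hom δ l l →ₗ[K] TL δ N) (Hom.of x) (Hom.of y) = _
  simp

theorem juxtLin_mul {k l N : ℕ} (h : k + l = N) (a a' : TL δ k) (b b' : TL δ l) :
    juxtLin h (a * a') (b * b') = juxtLin h a b * juxtLin h a' b' := by
  induction a using TL.induction with
  | h0 => simp
  | hadd x y hx hy => simp [add_mul, hx, hy]
  | hsmul c x hx => simp [hx]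
  | hof x =>
    induction a' using TL.induction with
    | h0 => simp
    | hadd x y hx hy => simp [mul_add, hx, hy]
    | hsmul c x hx => simp [hx]
    | hof x' =>
      induction b using TL.induction with
      | h0 => simp
      | hadd x y hx hy => simp [add_mul, hx, hy]
      | hsmul c x hx => simp [hx]
      | hof y =>
        induction b' using TL.induction with
        | h0 => simp
        | hadd x y hx hy => simp [mul_add, hx, hy]
        | hsmul c x hx => simp [hx]
        | hof y' =>
          have h1 := Diagram.juxt_comp h x x' y y'
          simp [TL.of_mul, juxtLin_of, smul_smul, ← pow_add, h1.1, h1.2, add_comm]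

/-- The external multiplication `TL_k ⊗ TL_l → TL_N` for `N = k + l`, given by juxtaposition. -/
noncomputable def rho {k l N : ℕ} (h : k + l = N) : TL δ k ⊗[K] TL δ l →ₐ[K] TL δ N :=
  Algebra.TensorProduct.algHomOfLinearMapTensorProduct (TensorProduct.lift (juxtLin h))
    (fun a a' b b' => by simpa using juxtLin_mul h a a' b b')
    (by
      rw [TensorProduct.lift.tmul, TL.one_def, TL.one_def, juxtLin_of, Diagram.juxt_ident]
      rfl)

theorem rho_of {k l N : ℕ} (h : k + l = N) (x : Diagram k k) (y : Diagram l l) :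
    rho h ((TL.of x : TL δ k) ⊗ₜ[K] (TL.of y : TL δ l)) = TL.of (Diagram.juxt h h x y) :=
  juxtLin_of h x y

end Algebra

/-! ### Graded bialgebras -/

/-- Linear maps `G ⊗ H → L`. -/
abbrev FromTensor (R G H L : Type*) [CommRing R] [AddCommGroup G] [Module R G] [AddCommGroup H]
    [Module R H] [AddCommGroup L] [Module R L] := G ⊗[R] H →ₗ[R] L

/-- Linear maps `L → G ⊗ H`. -/
abbrev ToTensor (R L G H : Type*) [CommRing R] [AddCommGroup G] [Module R G] [AddCommGroup H]
    [Module R H] [AddCommGroup L] [Module R L] := L →ₗ[R] G ⊗[R] H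

section Bialgebra

variable {R : Type*} [CommRing R]

/-- The product of `G ⊗ G` defined by a product `π` of `G`:
`(a ⊗ b) (c ⊗ d) = π(a ⊗ c) ⊗ π(b ⊗ d)`. -/
noncomputable def mulTensor {G : Type*} [AddCommGroup G] [Module R G] (π : FromTensor R G G G)
    (u v : G ⊗[R] G) : G ⊗[R] G :=
  TensorProduct.map π π (TensorProduct.tensorTensorTensorComm R G G G G (u ⊗ₜ v))

/-- `Δ(x y) = Δ(x) Δ(y)`, for the product `π`. -/
def ComulMulAt {G : Type*} [AddCommGroup G] [Module R G] (π : FromTensor R G G G)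
    (Δ : ToTensor R G G G) (x y : G) : Prop :=
  Δ (π (x ⊗ₜ y)) = mulTensor π (Δ x) (Δ y)

/-- The axioms of a bialgebra over `R` for a module `G` with multiplication `π`, unit `μ`,
comultiplication `Δ` and counit `ε`. -/
structure IsBialgebra {G : Type*} [AddCommGroup G] [Module R G] (π : FromTensor R G G G)
    (μ : R →ₗ[R] G) (Δ : ToTensor R G G G) (ε : G →ₗ[R] R) : Prop where
  mul_assoc : ∀ x y z, π (π (x ⊗ₜ y) ⊗ₜ z) = π (x ⊗ₜ π (y ⊗ₜ z))
  one_mul : ∀ x, π (μ 1 ⊗ₜ x) = x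
  mul_one : ∀ x, π (x ⊗ₜ μ 1) = x
  coassoc : ∀ x, TensorProduct.assoc R G G G (TensorProduct.map Δ LinearMap.id (Δ x)) =
    TensorProduct.map LinearMap.id Δ (Δ x)
  counit_left : ∀ x, TensorProduct.lid R G (TensorProduct.map ε LinearMap.id (Δ x)) = x
  counit_right : ∀ x, TensorProduct.rid R G (TensorProduct.map LinearMap.id ε (Δ x)) = x
  comul_mul : ∀ x y, ComulMulAt π Δ x y
  comul_one : Δ (μ 1) = μ 1 ⊗ₜ μ 1
  counit_mul : ∀ x y, ε (π (x ⊗ₜ y)) = ε x * ε y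
  counit_one : ε (μ 1) = 1

variable {H : ℕ → Type*} [∀ n, AddCommGroup (H n)] [∀ n, Module R (H n)]

/-- The multiplication of `⨁ n, H n` with components `i_{m,n}`. -/
noncomputable def gradedMul (i : ∀ m n : ℕ, FromTensor R (H m) (H n) (H (m + n))) :
    FromTensor R (⨁ n, H n) (⨁ n, H n) (⨁ n, H n) :=
  (DirectSum.toModule R (ℕ × ℕ) (⨁ n, H n) fun p =>
      DirectSum.lof R ℕ H (p.1 + p.2) ∘ₗ i p.1 p.2) ∘ₗ
    (TensorProduct.directSum R R H H).toLinearMap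

/-- The comultiplication of `⨁ n, H n`, equal to the sum of the `r_{k,l}` with `k + l = n` on
`H n`. -/
noncomputable def gradedComul (r : ∀ k l n : ℕ, k + l = n → ToTensor R (H n) (H k) (H l)) :
    ToTensor R (⨁ n, H n) (⨁ n, H n) (⨁ n, H n) :=
  DirectSum.toModule R ℕ ((⨁ n, H n) ⊗[R] (⨁ n, H n)) fun n => ∑ k : Fin (n + 1),
    TensorProduct.map (DirectSum.lof R ℕ H k) (DirectSum.lof R ℕ H (n - k)) ∘ₗ
      r k (n - k) n (show (k : ℕ) + (n - k) = n by omega)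

/-- The unit `a ↦ a u`, for an element `u` of `H 0`. -/
noncomputable def gradedUnit (u : H 0) : R →ₗ[R] ⨁ n, H n :=
  LinearMap.toSpanSingleton R (⨁ n, H n) (DirectSum.lof R ℕ H 0 u)

/-- The counit equal to `e` on `H 0` and to zero on `H n` for `n > 0`. -/
noncomputable def gradedCounit (e : H 0 →ₗ[R] R) : (⨁ n, H n) →ₗ[R] R :=
  DirectSum.toModule R ℕ R fun n =>
    Nat.casesOn (motive := fun n => H n →ₗ[R] R) n e fun _ => 0

/-- These operations make `⨁ n, H n` a bialgebra. -/
def IsGradedBialgebra (i : ∀ m n : ℕ, FromTensor R (H m) (H n) (H (m + n))) (u : H 0)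
    (r : ∀ k l n : ℕ, k + l = n → ToTensor R (H n) (H k) (H l)) (e : H 0 →ₗ[R] R) : Prop :=
  IsBialgebra (gradedMul i) (gradedUnit (R := R) u) (gradedComul r) (gradedCounit e)

/-- `Δ(x y) = Δ(x) Δ(y)` for two homogeneous elements `x ∈ H m` and `y ∈ H n`. -/
def GradedComulMulAt (i : ∀ m n : ℕ, FromTensor R (H m) (H n) (H (m + n)))
    (r : ∀ k l n : ℕ, k + l = n → ToTensor R (H n) (H k) (H l)) {m n : ℕ} (x : H m) (y : H n) :
    Prop :=
  ComulMulAt (gradedMul i) (gradedComul r) (DirectSum.lof R ℕ H m x) (DirectSum.lof R ℕ H n y)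

end Bialgebra

/-! ### Modules and Grothendieck groups -/

/-- A finitely generated left module over a finite-dimensional `K`-algebra `A`, that is, a left
`A`-module which is finite-dimensional over `K`. -/
structure FDModule (K A : Type u) [Field K] [Ring A] [Algebra K A] where
  carrier : Type u
  [addCommGroup : AddCommGroup carrier]
  [moduleK : Module K carrier]
  [module : Module A carrier]
  [isScalarTower : IsScalarTower K A carrier]
  [finite : Module.Finite K carrier]

attribute [instance] FDModule.addCommGroup FDModule.moduleK FDModule.module
  FDModule.isScalarTower FDModule.finite

section Grothendieck

variable {K A B C : Type u} [Field K] [Ring A] [Algebra K A] [Ring B] [Algebra K B]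
  [Ring C] [Algebra K C]

/-- Restriction of a module along an algebra homomorphism. -/
def FDModule.res (φ : B →ₐ[K] A) (M : FDModule K A) : FDModule K B :=
  letI : Module B M.carrier := Module.compHom M.carrier φ.toRingHom
  { carrier := M.carrier
    isScalarTower := ⟨fun r b x => by
      change φ (r • b) • x = r • φ b • x
      rw [map_smul, smul_assoc]⟩ }

/-- The action of `A ⊗ B` on `M ⊗ N`: `(a ⊗ b) (x ⊗ y) = a x ⊗ b y`. -/
noncomputable def tensorAction (M : FDModule K A) (N : FDModule K B) :
    A ⊗[K] B →ₐ[K] Module.End K (M.carrier ⊗[K] N.carrier) :=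
  (Module.endTensorEndAlgHom (R := K) (S := K) (A := K)).comp
    (Algebra.TensorProduct.map (Algebra.lsmul K K M.carrier) (Algebra.lsmul K K N.carrier))

@[simp]
theorem tensorAction_tmul (M : FDModule K A) (N : FDModule K B) (a : A) (b : B) (x : M.carrier)
    (y : N.carrier) : tensorAction M N (a ⊗ₜ b) (x ⊗ₜ y) = (a • x) ⊗ₜ (b • y) :=
  rfl

/-- The external tensor product of an `A`-module and a `B`-module. -/
noncomputable def FDModule.tensor (M : FDModule K A) (N : FDModule K B) : FDModule K (A ⊗[K] B) :=
  letI : Module (A ⊗[K] B) (M.carrier ⊗[K] N.carrier) :=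
    Module.compHom _ (tensorAction M N).toRingHom
  { carrier := M.carrier ⊗[K] N.carrier
    isScalarTower := ⟨fun r c x => by
      change tensorAction M N (r • c) x = r • tensorAction M N c x
      rw [map_smul]; rfl⟩ }

/-- The relations `a φ(b) ⊗ w = a ⊗ b w` defining the induced module. -/
noncomputable def indRelations (φ : B →ₐ[K] A) (W : FDModule K B) :
    Submodule A (A ⊗[K] W.carrier) :=
  Submodule.span A
    {v | ∃ (a : A) (b : B) (w : W.carrier), v = (a * φ b) ⊗ₜ[K] w - a ⊗ₜ[K] (b • w)}

/-- Induction of a module along an algebra homomorphism `φ : B → A`: the module `A ⊗_B W`. -/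
noncomputable def FDModule.ind (φ : B →ₐ[K] A) [Module.Finite K A] (W : FDModule K B) :
    FDModule K A where
  carrier := (A ⊗[K] W.carrier) ⧸ indRelations φ W
  finite := Module.Finite.of_surjective (M := A ⊗[K] W.carrier)
    ((indRelations φ W).mkQ.restrictScalars K) (Submodule.Quotient.mk_surjective _)

/-- The regular module. -/
def FDModule.regular (K A : Type u) [Field K] [Ring A] [Algebra K A] [Module.Finite K A] :
    FDModule K A where
  carrier := A

/-- The relations `[M₂] = [M₁] + [M₃]` for the short exact sequences `0 → M₁ → M₂ → M₃ → 0`. -/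
def sesRelations (K A : Type u) [Field K] [Ring A] [Algebra K A] :
    Set (FreeAbelianGroup (FDModule K A)) :=
  {x | ∃ (M₁ M₂ M₃ : FDModule K A) (f : M₁.carrier →ₗ[A] M₂.carrier)
    (g : M₂.carrier →ₗ[A] M₃.carrier), Function.Injective f ∧ Function.Exact f g ∧
      Function.Surjective g ∧
      x = FreeAbelianGroup.of M₂ - FreeAbelianGroup.of M₁ - FreeAbelianGroup.of M₃}

/-- The Grothendieck group `G₀(A)` of the category of finitely generated `A`-modules. -/
def G0 (K A : Type u) [Field K] [Ring A] [Algebra K A] : Type (u + 1) :=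
  FreeAbelianGroup (FDModule K A) ⧸ AddSubgroup.closure (sesRelations K A)

instance (K A : Type u) [Field K] [Ring A] [Algebra K A] : AddCommGroup (G0 K A) :=
  inferInstanceAs (AddCommGroup (_ ⧸ AddSubgroup.closure (sesRelations K A)))

/-- The class `[M]` of a module in the Grothendieck group. -/
def cls (M : FDModule K A) : G0 K A :=
  QuotientAddGroup.mk (FreeAbelianGroup.of M)

/-- Additivity of a function on modules on short exact sequences. -/
def IsAdditive {V : Type*} [AddCommGroup V] (F : FDModule K A → V) : Prop :=
  ∀ (M₁ M₂ M₃ : FDModule K A) (f : M₁.carrier →ₗ[A] M₂.carrier)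
    (g : M₂.carrier →ₗ[A] M₃.carrier), Function.Injective f → Function.Exact f g →
      Function.Surjective g → F M₂ = F M₁ + F M₃

/-- The homomorphism on the Grothendieck group defined by an additive function. -/
def G0.lift {V : Type*} [AddCommGroup V] (F : FDModule K A → V) (hF : IsAdditive F) :
    G0 K A →+ V :=
  QuotientAddGroup.lift _ (FreeAbelianGroup.lift F) (by
    rw [AddSubgroup.closure_le]
    rintro _ ⟨M₁, M₂, M₃, f, g, hf, hfg, hg, rfl⟩
    simp [hF M₁ M₂ M₃ f g hf hfg hg])

@[simp]
theorem G0.lift_cls {V : Type*} [AddCommGroup V] (F : FDModule K A → V) (hF : IsAdditive F)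
    (M : FDModule K A) : G0.lift F hF (cls M) = F M :=
  FreeAbelianGroup.lift_apply_of _ _

theorem cls_additive : IsAdditive (cls : FDModule K A → G0 K A) := by
  intro M₁ M₂ M₃ f g hf hfg hg
  have h : (QuotientAddGroup.mk (FreeAbelianGroup.of M₂ - FreeAbelianGroup.of M₁ -
      FreeAbelianGroup.of M₃) : G0 K A) = 0 :=
    (QuotientAddGroup.eq_zero_iff _).2
      (AddSubgroup.subset_closure ⟨M₁, M₂, M₃, f, g, hf, hfg, hg, rfl⟩)
  have h' : cls M₂ - cls M₁ - cls M₃ = 0 := h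
  rw [sub_sub, sub_eq_zero] at h'
  exact h'

theorem G0.hom_ext {V : Type*} [AddCommGroup V] {f g : G0 K A →+ V}
    (h : ∀ M, f (cls M) = g (cls M)) : f = g :=
  QuotientAddGroup.addMonoidHom_ext _ (FreeAbelianGroup.lift_ext _ _ h)

/-- The dimension homomorphism. -/
noncomputable def G0.dim (K A : Type u) [Field K] [Ring A] [Algebra K A] : G0 K A →+ ℤ :=
  G0.lift (fun M => (Module.finrank K M.carrier : ℤ)) (by
    intro M₁ M₂ M₃ f g hf hfg hg
    have h1 := LinearMap.finrank_range_add_finrank_ker (g.restrictScalars K)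
    have h2 : LinearMap.ker (g.restrictScalars K) = LinearMap.range (f.restrictScalars K) :=
      (LinearMap.exact_iff (f := f.restrictScalars K) (g := g.restrictScalars K)).1 hfg
    have h3 : Module.finrank K (LinearMap.range (f.restrictScalars K)) =
        Module.finrank K M₁.carrier :=
      LinearMap.finrank_range_of_inj (f := f.restrictScalars K) hf
    have h4 : LinearMap.range (g.restrictScalars K) = ⊤ := LinearMap.range_eq_top.2 hg
    rw [h2, h3, h4, finrank_top] at h1
    simp only [← h1]
    push_cast
    ring)

/-- An `A`-linear map, seen as a map between restrictions. -/
def FDModule.resMap (φ : B →ₐ[K] A) {M N : FDModule K A} (f : M.carrier →ₗ[A] N.carrier) :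
    (M.res φ).carrier →ₗ[B] (N.res φ).carrier where
  toFun := f
  map_add' := map_add f
  map_smul' b x := f.map_smul (φ b) x

/-- Restriction on Grothendieck groups. -/
noncomputable def G0.res (φ : B →ₐ[K] A) : G0 K A →+ G0 K B :=
  G0.lift (fun M => cls (M.res φ)) (by
    intro M₁ M₂ M₃ f g hf hfg hg
    exact cls_additive (M₁.res φ) (M₂.res φ) (M₃.res φ) (FDModule.resMap φ f)
      (FDModule.resMap φ g) hf hfg hg)

@[simp]
theorem G0.res_cls (φ : B →ₐ[K] A) (M : FDModule K A) : G0.res φ (cls M) = cls (M.res φ) :=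
  G0.lift_cls _ _ _

/-- The `A ⊗ B`-linear map `f ⊗ g`. -/
noncomputable def FDModule.tensorMap {M M' : FDModule K A} {N N' : FDModule K B}
    (f : M.carrier →ₗ[A] M'.carrier) (g : N.carrier →ₗ[B] N'.carrier) :
    (M.tensor N).carrier →ₗ[A ⊗[K] B] (M'.tensor N').carrier :=
  { TensorProduct.map (f.restrictScalars K) (g.restrictScalars K) with
    map_smul' := fun c x => by
      change M.carrier ⊗[K] N.carrier at x
      change TensorProduct.map (f.restrictScalars K) (g.restrictScalars K) (tensorAction M N c x) =
        tensorAction M' N' c (TensorProduct.map (f.restrictScalars K) (g.restrictScalars K) x)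
      induction c with
      | zero => simp
      | add a b ha hb => simp [ha, hb]
      | tmul a b =>
        induction x with
        | zero => simp
        | add x y hx hy => simp [hx, hy]
        | tmul x y => simp }

/-- The map `G₀(B) → G₀(A ⊗ B)`, `[N] ↦ [M ⊗ N]`. -/
noncomputable def G0.tensorLeft (M : FDModule K A) : G0 K B →+ G0 K (A ⊗[K] B) :=
  G0.lift (fun N => cls (M.tensor N)) (by
    intro N₁ N₂ N₃ f g hf hfg hg
    exact cls_additive (M.tensor N₁) (M.tensor N₂) (M.tensor N₃)
      (FDModule.tensorMap LinearMap.id f) (FDModule.tensorMap LinearMap.id g)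
      (Module.Flat.lTensor_preserves_injective_linearMap (M := M.carrier)
        (f.restrictScalars K) hf)
      (lTensor_exact (f := f.restrictScalars K) (g := g.restrictScalars K) M.carrier hfg hg)
      (LinearMap.lTensor_surjective M.carrier (g := g.restrictScalars K) hg))

@[simp]
theorem G0.tensorLeft_cls (M : FDModule K A) (N : FDModule K B) :
    G0.tensorLeft M (cls N) = cls (M.tensor N) :=
  G0.lift_cls _ _ _

theorem G0.tensorLeft_additive : IsAdditive
    (fun M : FDModule K A => (G0.tensorLeft M : G0 K B →+ G0 K (A ⊗[K] B)).toIntLinearMap) := by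
  intro M₁ M₂ M₃ f g hf hfg hg
  refine LinearMap.toAddMonoidHom_injective (G0.hom_ext fun N => ?_)
  have h : cls (M₂.tensor N) = cls (M₁.tensor N) + cls (M₃.tensor N) :=
    cls_additive (M₁.tensor N) (M₂.tensor N) (M₃.tensor N)
      (FDModule.tensorMap f LinearMap.id) (FDModule.tensorMap g LinearMap.id)
      (Module.Flat.rTensor_preserves_injective_linearMap (M := N.carrier)
        (f.restrictScalars K) hf)
      (rTensor_exact (f := f.restrictScalars K) (g := g.restrictScalars K) N.carrier hfg hg)
      (LinearMap.rTensor_surjective N.carrier (g := g.restrictScalars K) hg)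
  simpa using h

/-- The map `G₀(A) ⊗ G₀(B) → G₀(A ⊗ B)`, `[M] ⊗ [N] ↦ [M ⊗ N]`. -/
noncomputable def G0.tensor (K A B : Type u) [Field K] [Ring A] [Algebra K A] [Ring B]
    [Algebra K B] : FromTensor ℤ (G0 K A) (G0 K B) (G0 K (A ⊗[K] B)) :=
  TensorProduct.lift (G0.lift _ (G0.tensorLeft_additive (A := A) (B := B))).toIntLinearMap

@[simp]
theorem G0.tensor_cls (M : FDModule K A) (N : FDModule K B) :
    G0.tensor K A B (cls M ⊗ₜ cls N) = cls (M.tensor N) := by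
  rw [G0.tensor, TensorProduct.lift.tmul, AddMonoidHom.coe_toIntLinearMap, G0.lift_cls,
    AddMonoidHom.coe_toIntLinearMap, G0.tensorLeft_cls]

end Grothendieck

/-! ### Cell modules -/

section Cell

variable {K : Type u} [Field K]

/-- Some join of the diagram has both ends in the lower row. -/
def Diagram.HasLowerArc {m n : ℕ} (d : Diagram m n) : Prop :=
  ∃ i j : Fin n, i ≠ j ∧ d.rel (Sum.inr i) (Sum.inr j)

/-- The morphisms from `n` to `n - 2 r` of less than `n - 2 r` through strings (and everything
if `2 r > n`). -/
noncomputable def cellRelations (δ : K) (n r : ℕ) : Submodule (TL δ n) (Hom δ n (n - 2 * r)) :=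
  Submodule.span (TL δ n) {v | ∃ d : Diagram n (n - 2 * r),
    (d.HasLowerArc ∨ n < 2 * r) ∧ v = Hom.of d}

/-- The cell module `Δ_n(r)` of `TL_n(δ)`. A diagram from `n` to `n - 2 r` without lower arcs is
the same as an `(n, r)`-cap diagram, with `r` caps and `n - 2 r` single points joined to the lower
row. So `Δ_n(r)` has the `(n, r)`-cap diagrams as a basis, and an `n`-diagram acts by
concatenation, the result being zero if the number of caps increases. If `2 r > n`, then
`Δ_n(r) = 0`. -/
noncomputable def cell (δ : K) (n r : ℕ) : FDModule K (TL δ n) where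
  carrier := Hom δ n (n - 2 * r) ⧸ cellRelations δ n r
  finite := Module.Finite.of_surjective (M := Hom δ n (n - 2 * r))
    ((cellRelations δ n r).mkQ.restrictScalars K) (Submodule.Quotient.mk_surjective _)

end Cell

/-! ### The two sides of the Mackey-type identity -/

section Mackey

variable {K : Type u} [Field K] {δ : K}

/-- The class of `Res (Ind (M ⊗ N))`, with induction from `TL_m ⊗ TL_n` to `TL_{m+n}` and
restriction to `TL_k ⊗ TL_l`, for `k + l = m + n`. -/
noncomputable def mackeyLeft {m n k l : ℕ} (h : k + l = m + n) (M : FDModule K (TL δ m))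
    (N : FDModule K (TL δ n)) : G0 K (TL δ k ⊗[K] TL δ l) :=
  cls (((M.tensor N).ind (rho (rfl : m + n = m + n))).res (rho h))

/-- The homomorphism
`(TL_t ⊗ TL_t') ⊗ (TL_s ⊗ TL_s') → TL_k ⊗ TL_l`,
`(c₁ ⊗ c₂) ⊗ (d₁ ⊗ d₂) ↦ ρ(c₁ ⊗ d₁) ⊗ ρ(c₂ ⊗ d₂)`, along which the twisted induction is formed. -/
noncomputable def twistedRho {t t' s s' k l : ℕ} (hk : t + s = k) (hl : t' + s' = l) :
    (TL δ t ⊗[K] TL δ t') ⊗[K] (TL δ s ⊗[K] TL δ s') →ₐ[K] TL δ k ⊗[K] TL δ l :=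
  (Algebra.TensorProduct.map (rho (δ := δ) hk) (rho (δ := δ) hl)).comp
    (Algebra.TensorProduct.tensorTensorTensorComm K K K K (TL δ t) (TL δ t') (TL δ s)
      (TL δ s')).toAlgHom

theorem twistedRho_tmul {t t' s s' k l : ℕ} (hk : t + s = k) (hl : t' + s' = l) (c₁ : TL δ t)
    (c₂ : TL δ t') (d₁ : TL δ s) (d₂ : TL δ s') :
    twistedRho hk hl ((c₁ ⊗ₜ c₂) ⊗ₜ (d₁ ⊗ₜ d₂)) =
      rho hk (c₁ ⊗ₜ d₁) ⊗ₜ[K] rho hl (c₂ ⊗ₜ d₂) := rfl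

/-- The sum over `t + s = k`, `t ≤ m`, `s ≤ n`, of the classes of the twisted inductions to
`TL_k ⊗ TL_l` of `Res M ⊗ Res N`, with restrictions to `TL_t ⊗ TL_{m-t}` and
`TL_s ⊗ TL_{n-s}`, for `k + l = m + n`. -/
noncomputable def mackeyRight {m n k l : ℕ} (h : k + l = m + n) (M : FDModule K (TL δ m))
    (N : FDModule K (TL δ n)) : G0 K (TL δ k ⊗[K] TL δ l) :=
  ∑ t : Fin (m + 1), ∑ s : Fin (n + 1), if hk : (t : ℕ) + s = k then
    cls (((M.res (rho (show (t : ℕ) + (m - t) = m by omega))).tensor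
      (N.res (rho (show (s : ℕ) + (n - s) = n by omega)))).ind
        (twistedRho hk (show (m - t) + (n - s) = l by omega)))
  else 0

end Mackey

/-! ### The operations on the Grothendieck group of the Temperley-Lieb category

The group `G₀(𝒯ℒ(δ))` is the direct sum of the groups `G₀(TL_n)`. Its multiplication `π` has the
components `i_{m,n}`, and its comultiplication `Δ` has the components `r_{k,l}`. -/

section Operations

variable {K : Type u} [Field K]

/-- `i` is the family of induction maps `i_{m,n}`, `[M] ⊗ [N] ↦ [Ind (M ⊗ N)]`. -/
def IsInduction (δ : K)
    (i : ∀ m n : ℕ, FromTensor ℤ (G0 K (TL δ m)) (G0 K (TL δ n)) (G0 K (TL δ (m + n)))) : Prop :=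
  ∀ (m n : ℕ) (M : FDModule K (TL δ m)) (N : FDModule K (TL δ n)),
    i m n (cls M ⊗ₜ cls N) = cls ((M.tensor N).ind (rho rfl))

/-- `r` is the family of restriction maps `r_{k,l}`, `[N] ↦ [Res N]`, where the class of the
`TL_k ⊗ TL_l`-module `Res N` is seen in `G₀(TL_k) ⊗ G₀(TL_l)` through
`[M] ⊗ [M'] ↦ [M ⊗ M']`. -/
def IsRestriction (δ : K) (r : ∀ k l n : ℕ, k + l = n →
    ToTensor ℤ (G0 K (TL δ n)) (G0 K (TL δ k)) (G0 K (TL δ l))) : Prop :=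
  ∀ (k l n : ℕ) (h : k + l = n) (N : FDModule K (TL δ n)),
    G0.tensor K (TL δ k) (TL δ l) (r k l n h (cls N)) = cls (N.res (rho h))

/-- The class `[K]` of the regular module of `TL_0 = K`. The unit is `μ(a) = a [K]`. -/
noncomputable def unitClass (δ : K) : G0 K (TL δ 0) := cls (FDModule.regular K (TL δ 0))

/-- The degree zero part `G₀(TL_0) → ℤ` of the counit `ε`: since `TL_0 = K`, the element `a [K]`
is sent to `a` by taking dimensions. -/
noncomputable def counitZero (δ : K) : G0 K (TL δ 0) →ₗ[ℤ] ℤ :=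
  (G0.dim K (TL δ 0)).toIntLinearMap

end Operations

/-- `δ` is generic, that is, `δ = q + q⁻¹` with `q` not a root of unity. The values `q = 1` and
`q = -1`, that is `δ = 2` and `δ = -2`, are also allowed in characteristic zero. -/
def IsGeneric {K : Type u} [Field K] (δ : K) : Prop :=
  ∀ q : AlgebraicClosure K, q ≠ 0 → q + q⁻¹ = algebraMap K (AlgebraicClosure K) δ →
    ∀ j : ℕ, 0 < j → q ^ j = 1 → q ^ 2 = 1 ∧ CharZero K

end TemperleyLieb

open TemperleyLieb

namespace TemperleyLieb

/-! ### Ranks of idempotents and Grothendieck groups -/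

section Rank

variable {K A B : Type u} [Field K] [Ring A] [Algebra K A] [Ring B] [Algebra K B]

/-! For generic `δ` the algebras `TL_n` are split semisimple and the nonzero cell modules are their
simple modules, so classes are compared by counting multiplicities. Those follow the Clebsch–Gordan
rule: adding a string on either side turns `Δ_n(p)` into `Δ_{n+1}(p)` and `Δ_{n+1}(p+1)`, and
removing a string is the transposed rule. On the left of the identity a string is added and then one
is removed. On the right there are two pairs `(t, s)`. For one of them a string of `M` is removed
and the string of `N` is added; as `p ≥ 1`, the multiplicities agree with those of the left side, so
this term alone is the left side. For the other pair the string of `N` is the separated one and `M`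
is untouched, which leaves a surplus copy of `[Δ_n(p)]`. It is not zero, so the identity fails
(`mackeyRight_one`, `mackeyRight_last`, `cls_cell_tensor_ne_zero`).

Semisimplicity is expressed by idempotents (`IsSplit`) which make the ranks `dim ε_p M` coordinates
on `G₀` (`IsSplit.cls_eq_sum`). For `TL_n` they are built from Jones–Wenzl projectors, which exist
because the quantum integers do not vanish (`wenzlProps`, `isSplit_TL`); the cell modules are the
dual basis (`rankAt_cell`). Induction and restriction are both governed by the dimensions of `ε_p
TL_k ρ(ε_q ⊗ ε_r)` (`rankAt_ind`, `rankAt_eq_sum`). Such a dimension is the number of diagrams which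
survive between projectors, and with a factor of at most one string only an identity and a single
arc can survive (`cornerRank_rho`).

The maps `i` and `r` exist because induction is exact (`ind_additive`) and `G₀(A) ⊗ G₀(B) → G₀(A ⊗
B)` is bijective (`G0.tensor_bijective`). The components of `Δ(xy)` and `Δ(x)Δ(y)` in degree `(k,
l)` correspond to the two sides of the identity, so the failure in degree `(n, 1)` excludes a
bialgebra. -/

theorem cls_eq_zero (M : FDModule K A) [Subsingleton M.carrier] : cls M = 0 := by
  have h := cls_additive M M M LinearMap.id LinearMap.id Function.injective_id
    (fun x => ⟨fun _ => ⟨x, rfl⟩, fun _ => Subsingleton.elim _ _⟩) Function.surjective_id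
  simpa using h

theorem cls_congr {M N : FDModule K A} (e : M.carrier ≃ₗ[A] N.carrier) : cls M = cls N := by
  let Z : FDModule K A := { carrier := PUnit }
  have hZ : Subsingleton Z.carrier := inferInstanceAs (Subsingleton PUnit)
  have h := cls_additive M N Z e.toLinearMap 0 e.injective
    (fun x => ⟨fun _ => e.surjective x, fun _ => Subsingleton.elim _ _⟩)
    (fun x => ⟨0, Subsingleton.elim _ _⟩)
  rw [h, cls_eq_zero Z, add_zero]

/-- The dimension of `e M`. -/
noncomputable def FDModule.rankAt (e : A) (M : FDModule K A) : ℕ :=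
  Module.finrank K (LinearMap.range (Algebra.lsmul K K M.carrier e))

theorem mem_range_lsmul {e : A} (he : IsIdempotentElem e) (M : FDModule K A) (x : M.carrier) :
    x ∈ LinearMap.range (Algebra.lsmul K K M.carrier e) ↔ e • x = x := by
  constructor
  · rintro ⟨y, rfl⟩
    change e • e • y = e • y
    rw [smul_smul, he.eq]
  · intro h
    exact ⟨x, h⟩

/-- Passing to the image of an idempotent is exact: that image is the space of vectors fixed by `e`,
and a preimage `x` of a fixed vector may be replaced by `e x`. So ranks of idempotents descend to
`G₀`. -/
theorem rankAt_additive {e : A} (he : IsIdempotentElem e) :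
    IsAdditive (fun M : FDModule K A => (M.rankAt e : ℤ)) := by
  intro M₁ M₂ M₃ f g hf hfg hg
  let E (M : FDModule K A) := LinearMap.range (Algebra.lsmul K K M.carrier e)
  let f' : E M₁ →ₗ[K] E M₂ := (f.restrictScalars K).restrict (by
    intro x hx
    rw [mem_range_lsmul he] at hx ⊢
    change e • f x = f x
    rw [← map_smul, hx])
  let g' : E M₂ →ₗ[K] E M₃ := (g.restrictScalars K).restrict (by
    intro x hx
    rw [mem_range_lsmul he] at hx ⊢
    change e • g x = g x
    rw [← map_smul, hx])
  have hf' : Function.Injective f' := fun x y h => Subtype.ext (hf (congrArg Subtype.val h))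
  have hg' : LinearMap.range g' = ⊤ := by
    rw [LinearMap.range_eq_top]
    rintro ⟨y, hy⟩
    obtain ⟨x, rfl⟩ := hg y
    rw [mem_range_lsmul he] at hy
    refine ⟨⟨e • x, x, rfl⟩, Subtype.ext ?_⟩
    change g (e • x) = g x
    rw [map_smul, hy]
  have hk : LinearMap.ker g' = LinearMap.range f' := by
    ext ⟨x, hx⟩
    rw [mem_range_lsmul he] at hx
    constructor
    · intro h
      obtain ⟨z, rfl⟩ := (hfg x).1 (congrArg Subtype.val h)
      refine ⟨⟨e • z, z, rfl⟩, Subtype.ext ?_⟩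
      change f (e • z) = f z
      rw [map_smul, hx]
    · rintro ⟨z, hz⟩
      refine Subtype.ext ?_
      change g x = 0
      exact (hfg x).2 ⟨z.1, congrArg Subtype.val hz⟩
  have h1 := LinearMap.finrank_range_add_finrank_ker g'
  rw [hk, hg', finrank_top, LinearMap.finrank_range_of_inj hf'] at h1
  change (Module.finrank K (E M₂) : ℤ) = Module.finrank K (E M₁) + Module.finrank K (E M₃)
  rw [← h1]
  push_cast
  ring

/-- The dimension of `e M`, as a function on the Grothendieck group. -/
noncomputable def G0.rankAt (e : A) (he : IsIdempotentElem e) : G0 K A →+ ℤ :=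
  G0.lift _ (rankAt_additive he)

@[simp]
theorem G0.rankAt_cls (e : A) (he : IsIdempotentElem e) (M : FDModule K A) :
    G0.rankAt e he (cls M) = M.rankAt e :=
  G0.lift_cls _ _ _

theorem G0.dim_cls (M : FDModule K A) : G0.dim K A (cls M) = Module.finrank K M.carrier :=
  G0.lift_cls _ _ _

theorem rankAt_res (φ : B →ₐ[K] A) (M : FDModule K A) (e : B) :
    (M.res φ).rankAt e = M.rankAt (φ e) := rfl

/-- Over a field tensor products preserve injections, so the surjection onto the tensor product of
the ranges, followed by the inclusion, is an image factorization. -/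
theorem finrank_range_map {V W V' W' : Type*} [AddCommGroup V] [Module K V] [AddCommGroup W]
    [Module K W] [AddCommGroup V'] [Module K V'] [AddCommGroup W'] [Module K W']
    (f : V →ₗ[K] V') (g : W →ₗ[K] W') :
    Module.finrank K (LinearMap.range (TensorProduct.map f g)) =
      Module.finrank K (LinearMap.range f) * Module.finrank K (LinearMap.range g) := by
  have h : TensorProduct.map f g =
      TensorProduct.map (LinearMap.range f).subtype (LinearMap.range g).subtype ∘ₗ
        TensorProduct.map f.rangeRestrict g.rangeRestrict := by
    rw [← TensorProduct.map_comp]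
    rfl
  have hs : Function.Surjective (TensorProduct.map f.rangeRestrict g.rangeRestrict) :=
    TensorProduct.map_surjective f.surjective_rangeRestrict g.surjective_rangeRestrict
  have hi : Function.Injective
      (TensorProduct.map (LinearMap.range f).subtype (LinearMap.range g).subtype) :=
    TensorProduct.map_injective_of_flat_flat _ _ (Submodule.subtype_injective _)
      (Submodule.subtype_injective _)
  rw [h, LinearMap.range_comp, LinearMap.range_eq_top.2 hs, Submodule.map_top,
    LinearMap.finrank_range_of_inj hi, Module.finrank_tensorProduct]

theorem rankAt_tensor (M : FDModule K A) (N : FDModule K B) (e : A) (f : B) :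
    (M.tensor N).rankAt (e ⊗ₜ[K] f) = M.rankAt e * N.rankAt f :=
  finrank_range_map (Algebra.lsmul K K M.carrier e) (Algebra.lsmul K K N.carrier f)

/-- The dimension of `e A f`. -/
noncomputable def cornerRank (K : Type u) {A : Type u} [Field K] [Ring A] [Algebra K A]
    (e f : A) : ℕ :=
  Module.finrank K (LinearMap.range (LinearMap.mulLeftRight K (e, f)))

theorem cornerRank_tmul (e f : A) (e' f' : B) :
    cornerRank K (e ⊗ₜ[K] e') (f ⊗ₜ[K] f') = cornerRank K e f * cornerRank K e' f' := by
  have h : LinearMap.mulLeftRight K (e ⊗ₜ[K] e', f ⊗ₜ[K] f') = TensorProduct.map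
      (LinearMap.mulLeftRight K (e, f)) (LinearMap.mulLeftRight K (e', f')) :=
    TensorProduct.ext' fun x y => by
      simp [LinearMap.mulLeftRight_apply, Algebra.TensorProduct.tmul_mul_tmul]
  rw [cornerRank, h, finrank_range_map]
  rfl

/-- The left ideal `A e`. -/
def FDModule.principal (K : Type u) {A : Type u} [Field K] [Ring A] [Algebra K A]
    [Module.Finite K A] (e : A) : FDModule K A where
  carrier := LinearMap.range (LinearMap.toSpanSingleton A A e)
  finite := inferInstanceAs (Module.Finite K
    ((LinearMap.range (LinearMap.toSpanSingleton A A e)).restrictScalars K))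

theorem rankAt_principal [Module.Finite K A] (e f : A) :
    (FDModule.principal K f).rankAt e = cornerRank K e f := by
  rw [FDModule.rankAt, cornerRank]
  let ι : (FDModule.principal K f).carrier →ₗ[K] A :=
    (LinearMap.range (LinearMap.toSpanSingleton A A f)).subtype.restrictScalars K
  have hι : Function.Injective ι := Submodule.subtype_injective _
  -- Both ranges are compared inside `A`, where `e (A f)` is `e A f`.
  have hr : LinearMap.range (ι ∘ₗ Algebra.lsmul K K (FDModule.principal K f).carrier e) =
      LinearMap.range (LinearMap.mulLeftRight K (e, f)) := by
    ext x
    constructor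
    · rintro ⟨⟨_, y, rfl⟩, rfl⟩
      refine ⟨y, ?_⟩
      change e * y * f = e * (y * f)
      rw [mul_assoc]
    · rintro ⟨y, rfl⟩
      refine ⟨⟨y * f, y, rfl⟩, ?_⟩
      change e * (y * f) = e * y * f
      rw [mul_assoc]
  rw [← hr, LinearMap.range_comp]
  exact (Submodule.equivMapOfInjective ι hι _).finrank_eq

end Rank

end TemperleyLieb

namespace TemperleyLieb

/-! ### Split semisimple algebras -/

section Split

variable {K A B : Type u} [Field K] [Ring A] [Algebra K A] [Ring B] [Algebra K B]
  {I J : Type*}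

/-- Idempotents (some of them possibly zero) which exhibit `A` as a split semisimple algebra: the
nonzero `A ε_i` represent the simple modules, which have only scalar endomorphisms. -/
structure IsSplit (K : Type u) {A : Type u} [Field K] [Ring A] [Algebra K A] {I : Type*}
    (ε : I → A) : Prop where
  idem : ∀ i, IsIdempotentElem (ε i)
  corner : ∀ i x, ∃ c : K, ε i * x * ε i = c • ε i
  orth : ∀ i j, i ≠ j → ∀ x, ε i * x * ε j = 0
  one_mem : (1 : A) ∈ Submodule.span K {y | ∃ a i b, y = a * ε i * b}

namespace IsSplit

variable {ε : I → A} {ε' : J → B}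

theorem exists_sum (h : IsSplit K ε) : ∃ (n : ℕ) (c : Fin n → I) (l r : Fin n → A),
    ∑ k, l k * ε (c k) * r k = 1 := by
  obtain ⟨n, f, g, hfg⟩ := Submodule.mem_span_set'.1 h.one_mem
  choose a c b hg using fun k => (g k).2
  refine ⟨n, c, fun k => f k • a k, b, ?_⟩
  rw [← hfg]
  exact Finset.sum_congr rfl fun k _ => by rw [hg]; simp

/-- If all these products vanished, expanding `1 = ∑ l ε r` would give `x = 0`. -/
theorem exists_smul_ne_zero (h : IsSplit K ε) {M : Type*} [AddCommGroup M] [Module A M] {x : M}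
    (hx : x ≠ 0) : ∃ (i : I) (a : A), ε i • a • x ≠ 0 := by
  by_contra! hn
  obtain ⟨n, c, l, r, hs⟩ := h.exists_sum
  apply hx
  rw [← one_smul A x, ← hs, Finset.sum_smul]
  exact Finset.sum_eq_zero fun k _ => by rw [mul_smul, mul_smul, hn, smul_zero]

theorem exists_mul_ne_zero (h : IsSplit K ε) {x : A} (hx : x ≠ 0) :
    ∃ i a, x * a * ε i ≠ 0 := by
  by_contra! hn
  obtain ⟨n, c, l, r, hs⟩ := h.exists_sum
  apply hx
  rw [← mul_one x, ← hs, Finset.mul_sum]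
  exact Finset.sum_eq_zero fun k _ => by rw [← mul_assoc, ← mul_assoc, hn, zero_mul]

theorem cornerRank_ne (h : IsSplit K ε) {i j : I} (hij : i ≠ j) :
    cornerRank K (ε i) (ε j) = 0 := by
  have h0 : LinearMap.mulLeftRight K (ε i, ε j) = 0 :=
    LinearMap.ext fun x => h.orth i j hij x
  rw [cornerRank, h0, LinearMap.range_zero, finrank_bot]

theorem cornerRank_self (h : IsSplit K ε) {i : I} (hi : ε i ≠ 0) :
    cornerRank K (ε i) (ε i) = 1 := by
  have hr : LinearMap.range (LinearMap.mulLeftRight K (ε i, ε i)) = Submodule.span K {ε i} := by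
    apply le_antisymm
    · rintro _ ⟨x, rfl⟩
      obtain ⟨c, hc⟩ := h.corner i x
      exact Submodule.mem_span_singleton.2 ⟨c, hc.symm⟩
    · rw [Submodule.span_singleton_le_iff_mem]
      refine ⟨1, ?_⟩
      rw [LinearMap.mulLeftRight_apply, mul_one]
      exact h.idem i
  rw [cornerRank, hr, finrank_span_singleton hi]

/-- Induction on the dimension: a nonzero vector `y = ε i • a • x` generates a copy of the simple
module `A ε i`, and the quotient by it is smaller. The coefficients are right because the ranks are
additive and the rank of `ε j` on `A ε i` is `1` or `0`. -/
theorem cls_eq_sum [Fintype I] [Module.Finite K A] (h : IsSplit K ε) (M : FDModule K A) :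
    cls M = ∑ i, M.rankAt (ε i) • cls (FDModule.principal K (ε i)) := by
  classical
  induction hn : Module.finrank K M.carrier using Nat.strong_induction_on generalizing M with
  | _ n ih =>
  by_cases hM : Subsingleton M.carrier
  · rw [cls_eq_zero M]
    refine (Finset.sum_eq_zero fun i _ => ?_).symm
    rw [FDModule.rankAt, Module.finrank_zero_of_subsingleton, zero_smul]
  · rw [not_subsingleton_iff_nontrivial] at hM
    obtain ⟨x, hx⟩ := exists_ne (0 : M.carrier)
    obtain ⟨i, a, hy⟩ := h.exists_smul_ne_zero hx
    set y := ε i • a • x with hydef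
    have hiy : ε i • y = y := by rw [hydef, smul_smul, (h.idem i).eq]
    have hi : ε i ≠ 0 := fun h0 => hy (by rw [hydef, h0, zero_smul])
    let P := FDModule.principal K (ε i)
    let f : P.carrier →ₗ[A] M.carrier :=
      LinearMap.toSpanSingleton A M.carrier y ∘ₗ Submodule.subtype _
    -- This is the simplicity of `A ε i`: a nonzero `b ε i` has some `ε j c b ε i ≠ 0`. By
    -- orthogonality `j = i`, and then the product is a nonzero multiple of `ε i`, which fixes `y`.
    have hf : Function.Injective f := by
      rw [injective_iff_map_eq_zero]
      rintro ⟨_, b, rfl⟩ hz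
      change (b * ε i) • y = 0 at hz
      by_contra hne
      have hne : b * ε i ≠ 0 := fun h0 => hne (Subtype.ext h0)
      obtain ⟨j, c, hj⟩ := h.exists_smul_ne_zero hne
      simp only [smul_eq_mul] at hj
      rw [← mul_assoc c, ← mul_assoc] at hj
      by_cases hji : j = i
      · subst hji
        obtain ⟨k, hk⟩ := h.corner j (c * b)
        have h1 : (ε j * (c * b) * ε j) • y = 0 := by
          rw [mul_assoc, mul_assoc, mul_smul, mul_smul, hz, smul_zero, smul_zero]
        rw [hk] at h1 hj
        rw [smul_assoc, hiy] at h1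
        rcases smul_eq_zero.1 h1 with h2 | h2
        · exact hj (by rw [h2, zero_smul])
        · exact hy h2
      · exact hj (h.orth j i hji _)
    let Q : FDModule K A :=
      { carrier := M.carrier ⧸ LinearMap.range f
        finite := Module.Finite.of_surjective (M := M.carrier)
          ((LinearMap.range f).mkQ.restrictScalars K) (Submodule.Quotient.mk_surjective _) }
    let g : M.carrier →ₗ[A] Q.carrier := (LinearMap.range f).mkQ
    have hg : Function.Surjective g := Submodule.mkQ_surjective _
    have hfg : Function.Exact f g := LinearMap.exact_map_mkQ_range f
    have hP : Nontrivial P.carrier :=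
      ⟨⟨⟨ε i, 1, one_mul _⟩, 0, fun h0 => hi (congrArg Subtype.val h0)⟩⟩
    have hdim := congrArg (G0.dim K A) (cls_additive P M Q f g hf hfg hg)
    rw [map_add, G0.dim_cls, G0.dim_cls, G0.dim_cls] at hdim
    have hpos : 0 < Module.finrank K P.carrier := Module.finrank_pos
    have hQ := ih (Module.finrank K Q.carrier) (by omega) Q rfl
    rw [cls_additive P M Q f g hf hfg hg, hQ]
    have hr : ∀ j, M.rankAt (ε j) = P.rankAt (ε j) + Q.rankAt (ε j) := by
      intro j
      have h1 := rankAt_additive (h.idem j) P M Q f g hf hfg hg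
      dsimp only at h1
      exact_mod_cast h1
    simp only [hr, add_smul, Finset.sum_add_distrib]
    congr 1
    rw [Finset.sum_eq_single i]
    · rw [rankAt_principal, h.cornerRank_self hi, one_smul]
    · intro j _ hj
      rw [rankAt_principal, h.cornerRank_ne hj, zero_smul]
    · simp

/-- The method behind later identities of classes: no isomorphism is constructed, only ranks are
compared. -/
theorem cls_ext [Fintype I] [Module.Finite K A] (h : IsSplit K ε) {M N : FDModule K A}
    (hMN : ∀ i, M.rankAt (ε i) = N.rankAt (ε i)) : cls M = cls N := by
  rw [h.cls_eq_sum M, h.cls_eq_sum N]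
  simp only [hMN]

theorem eq_sum [Fintype I] [Module.Finite K A] (h : IsSplit K ε) (x : G0 K A) :
    x = ∑ i, G0.rankAt (ε i) (h.idem i) x • cls (FDModule.principal K (ε i)) := by
  let F : G0 K A →+ G0 K A := 
    ∑ i, ((zmultiplesHom (G0 K A)) (cls (FDModule.principal K (ε i)))).comp
      (G0.rankAt (ε i) (h.idem i))
  have hF : AddMonoidHom.id _ = F := G0.hom_ext fun M => by
    simp [F, ← h.cls_eq_sum M]
  have := DFunLike.congr_fun hF x
  simpa [F] using this

theorem ext [Fintype I] [Module.Finite K A] (h : IsSplit K ε) {x y : G0 K A}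
    (hxy : ∀ i, G0.rankAt (ε i) (h.idem i) x = G0.rankAt (ε i) (h.idem i) y) : x = y := by
  rw [h.eq_sum x, h.eq_sum y]
  simp only [hxy]

/-- The corner and orthogonality conditions are linear in `x`, so pure tensors suffice; the two
expansions of `1` are multiplied. -/
theorem tensor (h : IsSplit K ε) (h' : IsSplit K ε') :
    IsSplit K (fun p : I × J => ε p.1 ⊗ₜ[K] ε' p.2) where
  idem p := by
    rw [IsIdempotentElem, Algebra.TensorProduct.tmul_mul_tmul, (h.idem _).eq, (h'.idem _).eq]
  corner p x := by
    induction x with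
    | zero => exact ⟨0, by simp⟩
    | add x y hx hy =>
      obtain ⟨c, hc⟩ := hx
      obtain ⟨d, hd⟩ := hy
      exact ⟨c + d, by rw [mul_add, add_mul, hc, hd, add_smul]⟩
    | tmul a b =>
      obtain ⟨c, hc⟩ := h.corner p.1 a
      obtain ⟨d, hd⟩ := h'.corner p.2 b
      refine ⟨c * d, ?_⟩
      rw [Algebra.TensorProduct.tmul_mul_tmul, Algebra.TensorProduct.tmul_mul_tmul, hc, hd,
        TensorProduct.smul_tmul_smul]
  orth p q hpq x := by
    induction x with
    | zero => simp
    | add x y hx hy => rw [mul_add, add_mul, hx, hy, add_zero]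
    | tmul a b =>
      rw [Algebra.TensorProduct.tmul_mul_tmul, Algebra.TensorProduct.tmul_mul_tmul]
      by_cases h1 : p.1 = q.1
      · rw [h'.orth _ _ (fun h2 => hpq (Prod.ext h1 h2)), TensorProduct.tmul_zero]
      · rw [h.orth _ _ h1, TensorProduct.zero_tmul]
  one_mem := by
    obtain ⟨n, c, l, r, hs⟩ := h.exists_sum
    obtain ⟨n', c', l', r', hs'⟩ := h'.exists_sum
    rw [Algebra.TensorProduct.one_def, ← hs, ← hs', TensorProduct.sum_tmul]
    refine Submodule.sum_mem _ fun k _ => ?_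
    rw [TensorProduct.tmul_sum]
    refine Submodule.sum_mem _ fun k' _ => Submodule.subset_span
      ⟨l k ⊗ₜ l' k', (c k, c' k'), r k ⊗ₜ r' k', ?_⟩
    rw [Algebra.TensorProduct.tmul_mul_tmul, Algebra.TensorProduct.tmul_mul_tmul]

/-- The product pairs `ε i A e` with `e A ε i` into the line `K ε i`, and semisimplicity makes this
pairing nondegenerate on both sides. This is the symmetry which links induction and restriction. -/
theorem cornerRank_comm [Module.Finite K A] (h : IsSplit K ε) (i : I) (e : A)
    (he : IsIdempotentElem e) : cornerRank K (ε i) e = cornerRank K e (ε i) := by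
  by_cases hi : ε i = 0
  · have h1 : LinearMap.mulLeftRight K (ε i, e) = 0 := LinearMap.ext fun x => by simp [hi]
    have h2 : LinearMap.mulLeftRight K (e, ε i) = 0 := LinearMap.ext fun x => by simp [hi]
    rw [cornerRank, cornerRank, h1, h2]
  obtain ⟨g, hg⟩ : ∃ g : A →ₗ[K] K, g (ε i) ≠ 0 := by
    by_contra! hn
    exact hi ((Module.forall_dual_apply_eq_zero_iff K _).1 hn)
  let X := LinearMap.range (LinearMap.mulLeftRight K (e, ε i))
  let Y := LinearMap.range (LinearMap.mulLeftRight K (ε i, e))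
  have hX : ∀ x : X, e * x.1 = x.1 ∧ x.1 * ε i = x.1 := by
    rintro ⟨_, x, rfl⟩
    simp only [LinearMap.mulLeftRight_apply]
    exact ⟨by rw [← mul_assoc, ← mul_assoc, he.eq], by rw [mul_assoc, (h.idem i).eq]⟩
  have hY : ∀ x : Y, ε i * x.1 = x.1 ∧ x.1 * e = x.1 := by
    rintro ⟨_, x, rfl⟩
    simp only [LinearMap.mulLeftRight_apply]
    exact ⟨by rw [← mul_assoc, ← mul_assoc, (h.idem i).eq], by rw [mul_assoc, he.eq]⟩
  let β : Y →ₗ[K] X →ₗ[K] K := ((LinearMap.mul K A).compr₂ g).domRestrict₁₂ Y X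
  have hβ : ∀ y x, β y x = g (y.1 * x.1) := fun _ _ => rfl
  -- On the line `K ε i` the functional `g` detects nonzero elements, so it turns products into a
  -- scalar pairing without loss.
  have hne : ∀ z, ε i * z * ε i ≠ 0 → g (ε i * z * ε i) ≠ 0 := by
    intro z hz
    obtain ⟨c, hc⟩ := h.corner i z
    rw [hc] at hz ⊢
    rw [map_smul, smul_eq_mul]
    exact mul_ne_zero (fun h0 => hz (by rw [h0, zero_smul])) hg
  have h1 : Function.Injective β := by
    rw [injective_iff_map_eq_zero]
    intro y hy
    by_contra hne0
    obtain ⟨j, a, ha⟩ := h.exists_mul_ne_zero (fun h0 => hne0 (Subtype.ext h0) : y.1 ≠ 0)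
    have hji : i = j := by
      by_contra hij
      rw [← (hY y).1, mul_assoc (ε i)] at ha
      exact ha (h.orth i j hij _)
    subst hji
    have h2 := LinearMap.congr_fun hy ⟨e * a * ε i, a, rfl⟩
    rw [hβ] at h2
    have h3 : y.1 * (e * a * ε i) = ε i * (y.1 * a) * ε i := by
      rw [← mul_assoc, ← mul_assoc, (hY y).2, ← mul_assoc, (hY y).1]
    simp only [LinearMap.zero_apply] at h2
    rw [h3] at h2
    refine hne _ ?_ h2
    rw [← mul_assoc, (hY y).1]
    exact ha
  have h2 : Function.Injective β.flip := by
    rw [injective_iff_map_eq_zero]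
    intro x hx
    by_contra hne0
    obtain ⟨j, a, ha⟩ := h.exists_smul_ne_zero (fun h0 => hne0 (Subtype.ext h0) : x.1 ≠ 0)
    simp only [smul_eq_mul] at ha
    rw [← mul_assoc] at ha
    have hji : j = i := by
      by_contra hij
      rw [← (hX x).2, ← mul_assoc, mul_assoc (ε j)] at ha
      exact ha (h.orth j i hij _)
    subst hji
    have h2 := LinearMap.congr_fun hx ⟨ε j * a * e, a, rfl⟩
    rw [LinearMap.flip_apply, hβ] at h2
    have h3 : ε j * a * e * x.1 = ε j * (a * x.1) * ε j := by
      rw [mul_assoc _ e, (hX x).1, mul_assoc (ε j) (a * x.1), mul_assoc a x.1, (hX x).2,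
        mul_assoc]
    simp only [LinearMap.zero_apply] at h2
    rw [h3] at h2
    refine hne _ ?_ h2
    rw [mul_assoc, mul_assoc, (hX x).2, ← mul_assoc]
    exact ha
  -- Injectivity in each variable bounds each dimension by that of the dual of the other space.
  have e1 := LinearMap.finrank_le_finrank_of_injective h1
  have e2 := LinearMap.finrank_le_finrank_of_injective h2
  have e3 := Subspace.dual_finrank_eq (K := K) (V := X)
  have e4 := Subspace.dual_finrank_eq (K := K) (V := Y)
  exact le_antisymm (e1.trans e3.le) (e2.trans e4.le)

end IsSplit

end Split

end TemperleyLieb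

namespace TemperleyLieb

/-! ### Exactness of induction, reciprocity, and Grothendieck groups of tensor products -/

section Induction

variable {K A B : Type u} [Field K] [Ring A] [Algebra K A] [Ring B] [Algebra K B]
  {I J : Type*} {ε : I → A} {ε' : J → B}

/-- A separability element `∑ l_k ⊗ r_k`. -/
theorem IsSplit.exists_separability (h : IsSplit K ε) : ∃ (n : ℕ) (l r : Fin n → A),
    ∑ k, l k * r k = 1 ∧ ∀ b, ∑ k, (b * l k) ⊗ₜ[K] r k = ∑ k, l k ⊗ₜ[K] (r k * b) := by
  obtain ⟨n, c, l, r, hs⟩ := h.exists_sum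
  refine ⟨n, fun k => l k * ε (c k), fun k => ε (c k) * r k, ?_, fun b => ?_⟩
  · rw [← hs]
    refine Finset.sum_congr rfl fun k _ => ?_
    rw [mul_assoc, ← mul_assoc (ε _) (ε _), (h.idem _).eq, mul_assoc]
  -- After `1 = ∑ l_j ε r_j` is inserted before `b`, the middle part `ε (r_j b l_k) ε` is a scalar
  -- multiple of an idempotent or zero. It can therefore be moved across the tensor sign, where the
  -- sum over `k` collapses to `1`.
  · have h1 : ∀ k, (b * (l k * ε (c k))) ⊗ₜ[K] (ε (c k) * r k) = ∑ j, (l j * ε (c j)) ⊗ₜ[K]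
        (ε (c j) * (r j * b * l k) * ε (c k) * r k) := by
      intro k
      have h2 : b * (l k * ε (c k)) = ∑ j, l j * (ε (c j) * (r j * b * l k) * ε (c k)) := by
        conv_lhs => rw [← one_mul b, ← hs, Finset.sum_mul, Finset.sum_mul]
        exact Finset.sum_congr rfl fun j _ => by simp only [mul_assoc]
      rw [h2, TensorProduct.sum_tmul]
      refine Finset.sum_congr rfl fun j _ => ?_
      by_cases hjk : c j = c k
      · rw [← hjk]
        obtain ⟨t, ht⟩ := h.corner (c j) (r j * b * l k)
        rw [ht, mul_smul_comm, TensorProduct.smul_tmul, smul_mul_assoc]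
      · rw [h.orth _ _ hjk, mul_zero, zero_mul, TensorProduct.zero_tmul, TensorProduct.tmul_zero]
    rw [Finset.sum_congr rfl fun k _ => h1 k, Finset.sum_comm]
    refine Finset.sum_congr rfl fun j _ => ?_
    rw [← TensorProduct.tmul_sum]
    congr 1
    conv_rhs => rw [← mul_one (ε (c j) * r j * b), ← hs, Finset.mul_sum]
    exact Finset.sum_congr rfl fun k _ => by simp only [mul_assoc]

/-- The map of induced modules defined by a homomorphism. -/
noncomputable def FDModule.indMap (φ : B →ₐ[K] A) [Module.Finite K A] {M N : FDModule K B}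
    (f : M.carrier →ₗ[B] N.carrier) : (M.ind φ).carrier →ₗ[A] (N.ind φ).carrier :=
  Submodule.mapQ _ _ ((f.restrictScalars K).baseChange A) (by
    rw [indRelations, Submodule.span_le]
    rintro _ ⟨a, b, w, rfl⟩
    refine Submodule.subset_span ⟨a, b, f w, ?_⟩
    rw [map_sub, LinearMap.baseChange_tmul, LinearMap.baseChange_tmul]
    simp)

section Projection

variable (φ : B →ₐ[K] A) {n : ℕ} (l r : Fin n → B) (W : FDModule K B)

/-- The projection `a ⊗ w ↦ ∑ a φ(l_k) ⊗ r_k w`. -/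
noncomputable def indProj : A ⊗[K] W.carrier →ₗ[K] A ⊗[K] W.carrier :=
  ∑ k, TensorProduct.map (LinearMap.mulRight K (φ (l k))) (Algebra.lsmul K K W.carrier (r k))

@[simp]
theorem indProj_tmul (a : A) (w : W.carrier) :
    indProj φ l r W (a ⊗ₜ w) = ∑ k, (a * φ (l k)) ⊗ₜ (r k • w) := by
  simp [indProj]

theorem indProj_smul (a : A) (x : A ⊗[K] W.carrier) :
    indProj φ l r W (a • x) = a • indProj φ l r W x := by
  induction x with
  | zero => simp
  | add x y hx hy => rw [smul_add, map_add, hx, hy, map_add, smul_add]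
  | tmul b w => simp [TensorProduct.smul_tmul', Finset.smul_sum, mul_assoc]

theorem indProj_map {W W' : FDModule K B} (f : W.carrier →ₗ[B] W'.carrier)
    (x : A ⊗[K] W.carrier) : indProj φ l r W' ((f.restrictScalars K).baseChange A x) =
      (f.restrictScalars K).baseChange A (indProj φ l r W x) := by
  induction x with
  | zero => simp
  | add x y hx hy => simp only [map_add, hx, hy]
  | tmul b w => simp [LinearMap.baseChange_tmul]

variable {l r}

/-- Since `w = ∑ l_k r_k w`, the difference is a sum of defining relations, one for each `l_k`. -/
theorem indProj_sub_mem (hs : ∑ k, l k * r k = 1) (x : A ⊗[K] W.carrier) :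
    indProj φ l r W x - x ∈ indRelations φ W := by
  induction x with
  | zero => simp
  | add x y hx hy =>
    rw [map_add, add_sub_add_comm]
    exact Submodule.add_mem _ hx hy
  | tmul a w =>
    have h : a ⊗ₜ[K] w = ∑ k, a ⊗ₜ[K] (l k • r k • w) := by
      rw [← TensorProduct.tmul_sum]
      simp only [smul_smul]
      rw [← Finset.sum_smul, hs, one_smul]
    rw [indProj_tmul, h, ← Finset.sum_sub_distrib]
    exact Submodule.sum_mem _ fun k _ => Submodule.subset_span ⟨a, l k, r k • w, rfl⟩

/-- The commutation of `b` with the separability element, transported by `x ⊗ y ↦ a φ(x) ⊗ y w`, is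
the vanishing on a relation. With `indProj_sub_mem` this identifies `A ⊗_B W` with the image of the
projection. -/
theorem indProj_eq_zero (hc : ∀ b, ∑ k, (b * l k) ⊗ₜ[K] r k = ∑ k, l k ⊗ₜ[K] (r k * b))
    {x : A ⊗[K] W.carrier} (hx : x ∈ indRelations φ W) : indProj φ l r W x = 0 := by
  induction hx using Submodule.span_induction with
  | zero => simp
  | add x y _ _ hx hy => rw [map_add, hx, hy, add_zero]
  | smul a x _ hx => rw [indProj_smul, hx, smul_zero]
  | mem x hx =>
    obtain ⟨a, b, w, rfl⟩ := hx
    have h := congrArg (TensorProduct.map (LinearMap.mulLeft K a ∘ₗ φ.toLinearMap)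
      ((LinearMap.toSpanSingleton B W.carrier w).restrictScalars K)) (hc b)
    simp only [map_sum, TensorProduct.map_tmul, LinearMap.comp_apply, LinearMap.mulLeft_apply,
      AlgHom.toLinearMap_apply, LinearMap.restrictScalars_apply,
      LinearMap.toSpanSingleton_apply, map_mul] at h
    rw [map_sub, indProj_tmul, indProj_tmul, sub_eq_zero]
    simpa only [mul_assoc, smul_smul] using h

end Projection

variable [Module.Finite K A]

/-- A separability element makes `A ⊗_B W` a direct summand of `A ⊗_K W`, naturally in `W`, and the
latter is exact in `W`. Each exactness check lifts to `A ⊗_K W` and is projected back. -/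
theorem ind_additive (hB : IsSplit K ε') (φ : B →ₐ[K] A) :
    IsAdditive (fun W : FDModule K B => cls (W.ind φ)) := by
  intro M₁ M₂ M₃ f g hf hfg hg
  obtain ⟨n, l, r, hs, hc⟩ := hB.exists_separability
  have hmk : ∀ (W : FDModule K B) x, (indRelations φ W).mkQ x = (indRelations φ W).mkQ
      (indProj φ l r W x) := by
    intro W x
    exact ((Submodule.Quotient.eq _).2 (indProj_sub_mem φ W hs x)).symm
  have hz : ∀ (W : FDModule K B) x, (indRelations φ W).mkQ x = 0 → indProj φ l r W x = 0 := by
    intro W x hx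
    exact indProj_eq_zero φ W hc ((Submodule.Quotient.mk_eq_zero _).1 hx)
  refine cls_additive (M₁.ind φ) (M₂.ind φ) (M₃.ind φ) (FDModule.indMap φ f)
    (FDModule.indMap φ g) ?_ ?_ ?_
  · rw [injective_iff_map_eq_zero]
    intro x hx
    obtain ⟨x, rfl⟩ := Submodule.mkQ_surjective _ x
    have h1 := hz M₂ _ hx
    rw [indProj_map] at h1
    have h2 : indProj φ l r M₁ x = 0 :=
      Module.Flat.lTensor_preserves_injective_linearMap (M := A) (f.restrictScalars K) hf
        (h1.trans (map_zero _).symm)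
    rw [hmk, h2, map_zero]
    rfl
  · intro x
    constructor
    · intro hx
      obtain ⟨x, rfl⟩ := Submodule.mkQ_surjective _ x
      have h1 := hz M₃ _ hx
      rw [indProj_map] at h1
      obtain ⟨y, hy⟩ := (lTensor_exact (f := f.restrictScalars K) (g := g.restrictScalars K)
        A hfg hg _).1 h1
      refine ⟨(indRelations φ M₁).mkQ y, ?_⟩
      exact ((hmk M₂ x).trans (congrArg _ hy.symm)).symm
    · rintro ⟨y, rfl⟩
      obtain ⟨y, rfl⟩ := Submodule.mkQ_surjective _ y
      have h1 : (g.restrictScalars K).baseChange A ((f.restrictScalars K).baseChange A y) = 0 :=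
        (lTensor_exact (f := f.restrictScalars K) (g := g.restrictScalars K)
          A hfg hg _).2 ⟨y, rfl⟩
      change (indRelations φ M₃).mkQ
        ((g.restrictScalars K).baseChange A ((f.restrictScalars K).baseChange A y)) = 0
      rw [h1, map_zero]
  · intro x
    obtain ⟨x, rfl⟩ := Submodule.mkQ_surjective _ x
    obtain ⟨y, rfl⟩ := LinearMap.lTensor_surjective A (g := g.restrictScalars K) hg x
    exact ⟨(indRelations φ M₂).mkQ y, rfl⟩

/-- Induction on Grothendieck groups. -/
noncomputable def G0.ind (hB : IsSplit K ε') (φ : B →ₐ[K] A) : G0 K B →+ G0 K A :=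
  G0.lift _ (ind_additive hB φ)

@[simp]
theorem G0.ind_cls (hB : IsSplit K ε') (φ : B →ₐ[K] A) (W : FDModule K B) :
    G0.ind hB φ (cls W) = cls (W.ind φ) :=
  G0.lift_cls _ _ _

/-- The isomorphism is `a ⊗ w ↦ a φ(w)`, from `A ⊗_B B e` to `A φ(e)`, with inverse `x ↦ x ⊗ e`. -/
theorem cls_ind_principal [Module.Finite K B] (φ : B →ₐ[K] A) {e : B}
    (he : IsIdempotentElem e) :
    cls ((FDModule.principal K e).ind φ) = cls (FDModule.principal K (φ e)) := by
  let P := FDModule.principal K e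
  have hP : ∀ w : P.carrier, w.1 * e = w.1 := by
    rintro ⟨_, b, rfl⟩
    change b * e * e = b * e
    rw [mul_assoc, he.eq]
  let ι : P.carrier →ₗ[K] B :=
    (LinearMap.range (LinearMap.toSpanSingleton B B e)).subtype.restrictScalars K
  let β : A →ₗ[A] P.carrier →ₗ[K] A :=
    { toFun a := LinearMap.mulLeft K a ∘ₗ φ.toLinearMap ∘ₗ ι
      map_add' a b := LinearMap.ext fun w => add_mul a b _
      map_smul' a b := LinearMap.ext fun w => mul_assoc a b _ }
  let μ : A ⊗[K] P.carrier →ₗ[A] A := TensorProduct.AlgebraTensorModule.lift β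
  have hμ : ∀ a w, μ (a ⊗ₜ w) = a * φ w.1 := fun _ _ => rfl
  have hmem : ∀ x, μ x ∈ LinearMap.range (LinearMap.toSpanSingleton A A (φ e)) := by
    intro x
    induction x with
    | zero => rw [map_zero]; exact Submodule.zero_mem _
    | add x y hx hy => rw [map_add]; exact Submodule.add_mem _ hx hy
    | tmul a w =>
      refine ⟨a * φ w.1, ?_⟩
      change a * φ w.1 * φ e = a * φ w.1
      rw [mul_assoc, ← map_mul, hP]
  have hrel : indRelations φ P ≤ LinearMap.ker (μ.codRestrict _ hmem) := by
    rw [indRelations, Submodule.span_le]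
    rintro _ ⟨a, b, w, rfl⟩
    refine Subtype.ext ?_
    change μ ((a * φ b) ⊗ₜ w - a ⊗ₜ (b • w)) = 0
    rw [map_sub, hμ, hμ]
    change a * φ b * φ w.1 - a * φ (b * w.1) = 0
    rw [map_mul, mul_assoc, sub_self]
  let g : P.carrier := ⟨e, 1, one_mul e⟩
  -- Modulo the relations a tensor is recovered from its product, so the kernel of `μ` contains
  -- nothing but relations.
  have hgen : ∀ x, (indRelations φ P).mkQ x = (indRelations φ P).mkQ (μ x ⊗ₜ g) := by
    intro x
    induction x with
    | zero => simp
    | add x y hx hy => rw [map_add, hx, hy, map_add, TensorProduct.add_tmul, map_add]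
    | tmul a w =>
      have hw : w.1 • g = w := Subtype.ext (hP w)
      have h : (a * φ w.1) ⊗ₜ[K] g - a ⊗ₜ[K] w ∈ indRelations φ P :=
        Submodule.subset_span ⟨a, w.1, g, by rw [hw]⟩
      exact ((Submodule.Quotient.eq _).2 h).symm
  let ν : (P.ind φ).carrier →ₗ[A] (FDModule.principal K (φ e)).carrier :=
    Submodule.liftQ (indRelations φ P) (μ.codRestrict _ hmem) hrel
  refine cls_congr (LinearEquiv.ofBijective ν ⟨?_, ?_⟩)
  · rw [injective_iff_map_eq_zero]
    intro x hx
    obtain ⟨x, rfl⟩ := Submodule.mkQ_surjective _ x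
    have h0 : μ x = 0 := congrArg Subtype.val hx
    rw [hgen, h0, TensorProduct.zero_tmul, map_zero]
    rfl
  · rintro ⟨_, a, rfl⟩
    exact ⟨(indRelations φ P).mkQ (a ⊗ₜ g), rfl⟩

/-- In `G₀(B)` the class of `W` is a combination of the `B ε'_j`, and induction carries these to `A
φ(ε'_j)`. -/
theorem rankAt_ind [Fintype J] [Module.Finite K B] (hB : IsSplit K ε') (φ : B →ₐ[K] A)
    (W : FDModule K B) {e : A} (he : IsIdempotentElem e) :
    (W.ind φ).rankAt e = ∑ j, W.rankAt (ε' j) * cornerRank K e (φ (ε' j)) := by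
  have h := congrArg (fun x => G0.rankAt e he (G0.ind hB φ x)) (hB.cls_eq_sum W)
  simp only [map_sum, map_nsmul, G0.ind_cls, cls_ind_principal φ (hB.idem _), G0.rankAt_cls,
    rankAt_principal, nsmul_eq_mul] at h
  exact_mod_cast h

/-- The order of the two arguments of `cornerRank` is the point: with `e = φ(ε'_j)` the coefficients
are the same numbers as in `rankAt_ind`, which is Frobenius reciprocity. -/
theorem rankAt_eq_sum [Fintype I] (hA : IsSplit K ε) (M : FDModule K A) {e : A}
    (he : IsIdempotentElem e) :
    M.rankAt e = ∑ i, M.rankAt (ε i) * cornerRank K (ε i) e := by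
  have h := congrArg (G0.rankAt e he) (hA.cls_eq_sum M)
  simp only [map_sum, map_nsmul, G0.rankAt_cls, rankAt_principal, nsmul_eq_mul] at h
  simp only [hA.cornerRank_comm _ e he]
  exact_mod_cast h

theorem cls_principal_tensor [Fintype I] [Fintype J] [Module.Finite K B] (hA : IsSplit K ε)
    (hB : IsSplit K ε') (e : A) (f : B) :
    cls (FDModule.principal K (e ⊗ₜ[K] f)) =
      cls ((FDModule.principal K e).tensor (FDModule.principal K f)) :=
  (hA.tensor hB).cls_ext fun p => by
    rw [rankAt_tensor, rankAt_principal, rankAt_principal, rankAt_principal, cornerRank_tmul]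

/-- The inverse `F` reads off the ranks of the idempotents `ε_i ⊗ ε'_j` and uses them as
coefficients of `[A ε_i] ⊗ [B ε'_j]`. -/
theorem G0.tensor_bijective [Fintype I] [Fintype J] [Module.Finite K B] (hA : IsSplit K ε)
    (hB : IsSplit K ε') : Function.Bijective (G0.tensor K A B) := by
  let hAB := hA.tensor hB
  let F : G0 K (A ⊗[K] B) →+ G0 K A ⊗[ℤ] G0 K B := ∑ p : I × J, ((zmultiplesHom _)
    (cls (FDModule.principal K (ε p.1)) ⊗ₜ[ℤ] cls (FDModule.principal K (ε' p.2)))).comp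
      (G0.rankAt _ (hAB.idem p))
  have hF : ∀ x, F x = ∑ p : I × J, G0.rankAt _ (hAB.idem p) x •
      (cls (FDModule.principal K (ε p.1)) ⊗ₜ[ℤ] cls (FDModule.principal K (ε' p.2))) := by
    intro x
    simp [F]
  have h1 : ∀ x, F (G0.tensor K A B x) = x := by
    have : F.toIntLinearMap ∘ₗ G0.tensor K A B = LinearMap.id := by
      refine TensorProduct.ext (LinearMap.toAddMonoidHom_injective (G0.hom_ext fun M =>
        LinearMap.toAddMonoidHom_injective (G0.hom_ext fun N => ?_)))
      change F (G0.tensor K A B (cls M ⊗ₜ cls N)) = cls M ⊗ₜ cls N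
      rw [hF, G0.tensor_cls]
      simp only [G0.rankAt_cls, rankAt_tensor]
      conv_rhs => rw [hA.cls_eq_sum M, hB.cls_eq_sum N]
      rw [TensorProduct.sum_tmul, Fintype.sum_prod_type]
      refine Finset.sum_congr rfl fun i _ => ?_
      rw [TensorProduct.tmul_sum]
      refine Finset.sum_congr rfl fun j _ => ?_
      simp only [← natCast_zsmul]
      rw [TensorProduct.smul_tmul_smul]
      push_cast
      rfl
    exact LinearMap.congr_fun this
  refine ⟨Function.LeftInverse.injective h1, fun x => ⟨F x, ?_⟩⟩
  rw [hF]
  simp only [map_sum, map_zsmul, G0.tensor_cls, ← cls_principal_tensor hA hB]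
  exact (hAB.eq_sum x).symm

end Induction

end TemperleyLieb

namespace TemperleyLieb

/-! ### Elementary diagrams -/

namespace Diagram

/-- Each point has a single partner, so perfect matchings cannot be properly nested. One inclusion
is therefore enough to identify a composite. -/
theorem eq_of_le {m n : ℕ} {d e : Diagram m n} (h : ∀ x y, d.rel x y → e.rel x y) : d = e := by
  refine Diagram.ext (Setoid.ext fun x y => ⟨h x y, fun hxy => ?_⟩)
  by_cases hne : y = x
  · subst hne; exact d.rel.refl' _
  · obtain ⟨z, ⟨hz, hxz⟩, -⟩ := d.isMatching x
    rwa [(e.isMatching x).unique ⟨hne, hxy⟩ ⟨hz, h x z hxz⟩]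

theorem comp_eq_of_rel {m n p : ℕ} {d : Diagram m n} {e : Diagram n p} {f : Diagram m p}
    (r : Setoid (Fin m ⊕ (Fin n ⊕ Fin p)))
    (h1 : ∀ u v, d.rel u v → r (Sum.map id Sum.inl u) (Sum.map id Sum.inl v))
    (h2 : ∀ u v, e.rel u v → r (Sum.inr u) (Sum.inr v))
    (h3 : ∀ x y, r (outer x) (outer y) → f.rel x y) : d.comp e = f :=
  eq_of_le fun x y h => h3 x y (glue_le r h1 h2 h)

/-- A labelling of the three rows which is constant on the joins is constant on the components of
the stacked picture. This turns identities of explicit diagrams into arithmetic. -/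
theorem comp_eq_of_label {m n p : ℕ} {d : Diagram m n} {e : Diagram n p} {f : Diagram m p}
    (ℓ : Fin m → ℕ) (ℓ' : Fin n → ℕ) (ℓ'' : Fin p → ℕ)
    (h1 : ∀ u v, d.rel u v → Sum.elim ℓ ℓ' u = Sum.elim ℓ ℓ' v)
    (h2 : ∀ u v, e.rel u v → Sum.elim ℓ' ℓ'' u = Sum.elim ℓ' ℓ'' v)
    (h3 : ∀ x y, Sum.elim ℓ ℓ'' x = Sum.elim ℓ ℓ'' y → f.rel x y) : d.comp e = f := by
  refine comp_eq_of_rel (Setoid.ker (Sum.elim ℓ (Sum.elim ℓ' ℓ''))) ?_ ?_ ?_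
  · intro u v h
    have := h1 u v h
    rcases u with u | u <;> rcases v with v | v <;> exact this
  · intro u v h
    exact h2 u v h
  · intro u v h
    refine h3 u v ?_
    rcases u with u | u <;> rcases v with v | v <;> exact h

/-- A closed loop contains middle points only. The three alternatives are the short routes from a
middle point to an outer row which occur in the composites below. -/
theorem loops_eq_zero {m n p : ℕ} {d : Diagram m n} {e : Diagram n p}
    (h : ∀ b : Fin n, (∃ a, d.rel (Sum.inr b) (Sum.inl a)) ∨ (∃ c, e.rel (Sum.inl b) (Sum.inr c)) ∨
      (∃ b' c, d.rel (Sum.inr b) (Sum.inr b') ∧ e.rel (Sum.inl b') (Sum.inr c))) :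
    d.loops e = 0 := by
  rw [loops, glueLoops, Nat.card_eq_zero]
  refine Or.inl ⟨fun ⟨q, hq⟩ => ?_⟩
  induction q using Quotient.inductionOn with
  | h x =>
    rcases x with x | x | x
    · exact hq (Sum.inl x) rfl
    · rcases h x with ⟨a, ha⟩ | ⟨c, hc⟩ | ⟨b', c, hb, hc⟩
      · exact hq (Sum.inl a) (Quotient.sound (glue_top e.rel (d.rel.symm' ha)))
      · exact hq (Sum.inr c) (Quotient.sound (glue_bot d.rel (e.rel.symm' hc)))
      · exact hq (Sum.inr c) (Quotient.sound ((glue d.rel e.rel).trans'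
          (glue_bot d.rel (e.rel.symm' hc)) (glue_top e.rel (d.rel.symm' hb))))
    · exact hq (Sum.inr x) rfl

theorem loops_eq_one {m n p : ℕ} {d : Diagram m n} {e : Diagram n p} (b₀ b₁ : Fin n)
    (hd : ∀ x, d.rel (Sum.inr b₀) x ↔ x = Sum.inr b₀ ∨ x = Sum.inr b₁)
    (he : ∀ x, e.rel (Sum.inl b₀) x ↔ x = Sum.inl b₀ ∨ x = Sum.inl b₁)
    (h : ∀ b : Fin n, b ≠ b₀ → b ≠ b₁ →
      (∃ a, d.rel (Sum.inr b) (Sum.inl a)) ∨ (∃ c, e.rel (Sum.inl b) (Sum.inr c))) :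
    d.loops e = 1 := by
  let P : Fin m ⊕ (Fin n ⊕ Fin p) → Prop :=
    fun x => x = Sum.inr (Sum.inl b₀) ∨ x = Sum.inr (Sum.inl b₁)
  -- The pair `b₀`, `b₁` is a class above and a class below, hence invariant under gluing; so it
  -- forms a component without outer points.
  have hP : ∀ x y, glue d.rel e.rel x y → P x = P y := by
    intro x y hxy
    refine glue_le (Setoid.ker P) ?_ ?_ hxy
    · intro u v huv
      have key : ∀ w, P (Sum.map id Sum.inl w) ↔ d.rel (Sum.inr b₀) w := by
        intro w
        rw [hd]
        rcases w with w | w <;> simp [P]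
      refine propext ((key u).trans (Iff.trans ?_ (key v).symm))
      exact ⟨fun h => d.rel.trans' h huv, fun h => d.rel.trans' h (d.rel.symm' huv)⟩
    · intro u v huv
      have key : ∀ w, P (Sum.inr w) ↔ e.rel (Sum.inl b₀) w := by
        intro w
        rw [he]
        simp [P]
      refine propext ((key u).trans (Iff.trans ?_ (key v).symm))
      exact ⟨fun h => e.rel.trans' h huv, fun h => e.rel.trans' h (e.rel.symm' huv)⟩
  have h0 : ∀ x : Fin m ⊕ Fin p,
      Quotient.mk (glue d.rel e.rel) (outer x) ≠ Quotient.mk _ (Sum.inr (Sum.inl b₀)) := by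
    intro x hx
    have h1 := (hP _ _ (Quotient.exact hx)).mpr (Or.inl rfl)
    rcases x with x | x <;> simp [P, outer] at h1
  rw [loops, glueLoops, Nat.card_eq_one_iff_unique]
  refine ⟨⟨fun q q' => ?_⟩, ⟨⟨_, h0⟩⟩⟩
  suffices H : ∀ q : {q : Quotient (glue d.rel e.rel) //
      ∀ x : Fin m ⊕ Fin p, Quotient.mk _ (outer x) ≠ q}, q = ⟨_, h0⟩ from
    (H q).trans (H q').symm
  rintro ⟨q, hq⟩
  refine Subtype.ext ?_
  induction q using Quotient.inductionOn with
  | h x =>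
    rcases x with x | x | x
    · exact absurd rfl (hq (Sum.inl x))
    · by_cases h1 : x = b₀
      · exact congrArg (fun b => Quotient.mk (glue d.rel e.rel) (Sum.inr (Sum.inl b))) h1
      by_cases h2 : x = b₁
      · have h3 := (hd (Sum.inr x)).2 (Or.inr (congrArg Sum.inr h2))
        exact Quotient.sound (glue_top e.rel (d.rel.symm' h3))
      rcases h x h1 h2 with ⟨a, ha⟩ | ⟨c, hc⟩
      · exact absurd (Quotient.sound (glue_top e.rel (d.rel.symm' ha))) (hq (Sum.inl a))
      · exact absurd (Quotient.sound (glue_bot d.rel (e.rel.symm' hc))) (hq (Sum.inr c))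
    · exact absurd rfl (hq (Sum.inr x))

/-- The position below a cap joining `i` and `i + 1` of the point `j`; `n` for `i` and `i + 1`. -/
def skip (i n j : ℕ) : ℕ := if j < i then j else if j ≤ i + 1 then n else j - 2

theorem skip_spec (i n j : ℕ) : (j < i ∧ skip i n j = j) ∨
    ((j = i ∨ j = i + 1) ∧ skip i n j = n) ∨ (i + 1 < j ∧ skip i n j = j - 2) := by
  unfold skip
  split_ifs <;> omega

/-- `n` if `j` is `i` or `i + 1`, otherwise `j`. -/
def mark (i n j : ℕ) : ℕ := if j = i ∨ j = i + 1 then n else j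

theorem mark_spec (i n j : ℕ) : ((j = i ∨ j = i + 1) ∧ mark i n j = n) ∨
    (j ≠ i ∧ j ≠ i + 1 ∧ mark i n j = j) := by
  unfold mark
  split_ifs <;> omega

/-- The diagram with a single arc, which joins the points `i` and `i + 1` of the upper row. -/
def cupTop (n i : ℕ) (hi : i ≤ n) : Diagram (n + 2) n where
  -- The lower row uses the labels `0, …, n - 1`, so the label `n` of the arc occurs at no lower
  -- point.
  rel := Setoid.ker (Sum.elim (fun j => skip i n j) (fun j => (j : ℕ)))
  isMatching := by
    rintro (x | x)
    · have hx := skip_spec i n x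
      by_cases h1 : (x : ℕ) < i
      · refine ⟨Sum.inr ⟨x, by omega⟩, ⟨by simp, ?_⟩, ?_⟩
        · simp only [Setoid.ker_def, Sum.elim_inl, Sum.elim_inr]; omega
        · rintro (y | y) ⟨hy, h⟩
          · have := skip_spec i n y
            simp only [Setoid.ker_def, Sum.elim_inl, ne_eq, Sum.inl.injEq, Fin.ext_iff] at h hy
            omega
          · simp only [Setoid.ker_def, Sum.elim_inl, Sum.elim_inr] at h
            simp only [Sum.inr.injEq, Fin.ext_iff]
            omega
      by_cases h2 : i + 1 < x
      · refine ⟨Sum.inr ⟨x - 2, by omega⟩, ⟨by simp, ?_⟩, ?_⟩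
        · simp only [Setoid.ker_def, Sum.elim_inl, Sum.elim_inr]; omega
        · rintro (y | y) ⟨hy, h⟩
          · have := skip_spec i n y
            simp only [Setoid.ker_def, Sum.elim_inl, ne_eq, Sum.inl.injEq, Fin.ext_iff] at h hy
            omega
          · simp only [Setoid.ker_def, Sum.elim_inl, Sum.elim_inr] at h
            simp only [Sum.inr.injEq, Fin.ext_iff]
            omega
      -- The reflection `x ↦ 2 i + 1 - x` exchanges `i` and `i + 1`.
      · refine ⟨Sum.inl ⟨2 * i + 1 - x, by omega⟩, ⟨?_, ?_⟩, ?_⟩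
        · simp only [ne_eq, Sum.inl.injEq, Fin.ext_iff]; omega
        · have := skip_spec i n (2 * i + 1 - x)
          simp only [Setoid.ker_def, Sum.elim_inl]; omega
        · rintro (y | y) ⟨hy, h⟩
          · have := skip_spec i n y
            simp only [Setoid.ker_def, Sum.elim_inl, ne_eq, Sum.inl.injEq, Fin.ext_iff] at h hy ⊢
            omega
          · simp only [Setoid.ker_def, Sum.elim_inl, Sum.elim_inr] at h
            omega
    · refine ⟨Sum.inl ⟨if (x : ℕ) < i then x else x + 2, by split_ifs <;> omega⟩,
        ⟨by simp, ?_⟩, ?_⟩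
      · simp only [Setoid.ker_def, Sum.elim_inl, Sum.elim_inr]
        have := skip_spec i n (if (x : ℕ) < i then x else x + 2)
        split_ifs at this ⊢ <;> omega
      · rintro (y | y) ⟨hy, h⟩
        · have := skip_spec i n y
          simp only [Setoid.ker_def, Sum.elim_inl, Sum.elim_inr, Sum.inl.injEq, Fin.ext_iff] at h ⊢
          split_ifs <;> omega
        · simp only [Setoid.ker_def, Sum.elim_inr, ne_eq, Sum.inr.injEq, Fin.ext_iff] at h hy
          omega
  noncrossing := by
    intro x y z w
    -- The arc occupies two adjacent positions. Through strings have position sum `2 n + 1` to its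
    -- left and `2 n + 3` to its right, so they are nested and nothing crosses.
    have H : ∀ u v : Fin (n + 2) ⊕ Fin n, pos u < pos v →
        Sum.elim (fun j : Fin (n + 2) => skip i n j) (fun j : Fin n => (j : ℕ)) u =
        Sum.elim (fun j : Fin (n + 2) => skip i n j) (fun j : Fin n => (j : ℕ)) v →
        (pos v = pos u + 1 ∧ pos u = i) ∨ (pos u < i ∧ pos v + pos u = 2 * n + 1) ∨
          (i + 1 < pos u ∧ pos v + pos u = 2 * n + 3) := by
      rintro (u | u) (v | v) h1 h2 <;>
        simp only [pos, Sum.elim_inl, Sum.elim_inr] at h1 h2 ⊢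
      · have := skip_spec i n u
        have := skip_spec i n v
        omega
      · have := skip_spec i n u
        omega
      · omega
      · omega
    intro h1 h2 h3 h4 h5
    have := H x z (by omega) h4
    have := H y w (by omega) h5
    omega

/-- The diagram with a single arc, which joins the points `i` and `i + 1` of the lower row. -/
def capBot (n i : ℕ) (hi : i ≤ n) : Diagram n (n + 2) where
  rel := Setoid.ker (Sum.elim (fun j => (j : ℕ)) (fun j => skip i n j))
  isMatching := by
    have h : Setoid.ker (Sum.elim (fun j : Fin n => (j : ℕ)) (fun j : Fin (n + 2) => skip i n j)) =
        (cupTop n i hi).rel.comap (Equiv.sumComm (Fin n) (Fin (n + 2))) := by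
      ext x y
      rcases x with x | x <;> rcases y with y | y <;> rfl
    rw [h]
    exact (cupTop n i hi).isMatching.comap _
  noncrossing := by
    have H : ∀ u v : Fin n ⊕ Fin (n + 2), pos u < pos v →
        Sum.elim (fun j : Fin n => (j : ℕ)) (fun j : Fin (n + 2) => skip i n j) u =
        Sum.elim (fun j : Fin n => (j : ℕ)) (fun j : Fin (n + 2) => skip i n j) v →
        (pos v = pos u + 1 ∧ pos v + i = 2 * n + 1) ∨ (pos u < i ∧ pos v + pos u = 2 * n + 1) ∨
          (i ≤ pos u ∧ pos v + i < 2 * n ∧ pos v + pos u + 1 = 2 * n) := by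
      rintro (u | u) (v | v) h1 h2 <;>
        simp only [pos, Sum.elim_inl, Sum.elim_inr] at h1 h2 ⊢
      · omega
      · have := skip_spec i n v
        omega
      · omega
      · have := skip_spec i n u
        have := skip_spec i n v
        omega
    intro x y z w h1 h2 h3 h4 h5
    have := H x z (by omega) h4
    have := H y w (by omega) h5
    omega

/-- The generator `e_i`: arcs joining the points `i` and `i + 1` of both rows. -/
def gen (n i : ℕ) (hi : i + 1 < n) : Diagram n n where
  -- The labels `n` and `n + 1` differ from each other and from all positions, so the upper and the
  -- lower arc are separate classes.
  rel := Setoid.ker (Sum.elim (fun j => mark i n j) (fun j => mark i (n + 1) j))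
  isMatching := by
    rintro (x | x)
    · have hx := mark_spec i n x
      by_cases h1 : (x : ℕ) = i ∨ (x : ℕ) = i + 1
      · refine ⟨Sum.inl ⟨2 * i + 1 - x, by omega⟩, ⟨?_, ?_⟩, ?_⟩
        · simp only [ne_eq, Sum.inl.injEq, Fin.ext_iff]; omega
        · have := mark_spec i n (2 * i + 1 - x)
          simp only [Setoid.ker_def, Sum.elim_inl]; omega
        · rintro (y | y) ⟨hy, h⟩
          · have := mark_spec i n y
            simp only [Setoid.ker_def, Sum.elim_inl, ne_eq, Sum.inl.injEq, Fin.ext_iff] at h hy ⊢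
            omega
          · have := mark_spec i (n + 1) y
            simp only [Setoid.ker_def, Sum.elim_inl, Sum.elim_inr] at h
            omega
      · refine ⟨Sum.inr x, ⟨by simp, ?_⟩, ?_⟩
        · have := mark_spec i (n + 1) x
          simp only [Setoid.ker_def, Sum.elim_inl, Sum.elim_inr]; omega
        · rintro (y | y) ⟨hy, h⟩
          · have := mark_spec i n y
            simp only [Setoid.ker_def, Sum.elim_inl, ne_eq, Sum.inl.injEq, Fin.ext_iff] at h hy
            omega
          · have := mark_spec i (n + 1) y
            simp only [Setoid.ker_def, Sum.elim_inl, Sum.elim_inr] at h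
            simp only [Sum.inr.injEq, Fin.ext_iff]
            omega
    · have hx := mark_spec i (n + 1) x
      by_cases h1 : (x : ℕ) = i ∨ (x : ℕ) = i + 1
      · refine ⟨Sum.inr ⟨2 * i + 1 - x, by omega⟩, ⟨?_, ?_⟩, ?_⟩
        · simp only [ne_eq, Sum.inr.injEq, Fin.ext_iff]; omega
        · have := mark_spec i (n + 1) (2 * i + 1 - x)
          simp only [Setoid.ker_def, Sum.elim_inr]; omega
        · rintro (y | y) ⟨hy, h⟩
          · have := mark_spec i n y
            simp only [Setoid.ker_def, Sum.elim_inl, Sum.elim_inr] at h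
            omega
          · have := mark_spec i (n + 1) y
            simp only [Setoid.ker_def, Sum.elim_inr, ne_eq, Sum.inr.injEq, Fin.ext_iff] at h hy ⊢
            omega
      · refine ⟨Sum.inl x, ⟨by simp, ?_⟩, ?_⟩
        · have := mark_spec i n x
          simp only [Setoid.ker_def, Sum.elim_inl, Sum.elim_inr]; omega
        · rintro (y | y) ⟨hy, h⟩
          · have := mark_spec i n y
            simp only [Setoid.ker_def, Sum.elim_inl, Sum.elim_inr] at h
            simp only [Sum.inl.injEq, Fin.ext_iff]
            omega
          · have := mark_spec i (n + 1) y
            simp only [Setoid.ker_def, Sum.elim_inr, ne_eq, Sum.inr.injEq, Fin.ext_iff] at h hy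
            omega
  noncrossing := by
    have H : ∀ u v : Fin n ⊕ Fin n, pos u < pos v →
        Sum.elim (fun j : Fin n => mark i n j) (fun j : Fin n => mark i (n + 1) j) u =
        Sum.elim (fun j : Fin n => mark i n j) (fun j : Fin n => mark i (n + 1) j) v →
        (pos v = pos u + 1 ∧ pos u = i) ∨ (pos v = pos u + 1 ∧ pos v + i + 1 = 2 * n) ∨
        (pos u < i ∧ pos v + pos u + 1 = 2 * n) ∨
          (i + 1 < pos u ∧ pos v + pos u + 1 = 2 * n) := by
      rintro (u | u) (v | v) h1 h2 <;>
        simp only [pos, Sum.elim_inl, Sum.elim_inr] at h1 h2 ⊢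
      · have := mark_spec i n u
        have := mark_spec i n v
        omega
      · have := mark_spec i n u
        have := mark_spec i (n + 1) v
        omega
      · omega
      · have := mark_spec i (n + 1) u
        have := mark_spec i (n + 1) v
        omega
    intro x y z w h1 h2 h3 h4 h5
    have := H x z (by omega) h4
    have := H y w (by omega) h5
    omega

theorem cupTop_rel {n i : ℕ} (hi : i ≤ n) (x y : Fin (n + 2) ⊕ Fin n) :
    (cupTop n i hi).rel x y ↔ Sum.elim (fun j : Fin (n + 2) => skip i n j)
      (fun j : Fin n => (j : ℕ)) x = Sum.elim (fun j : Fin (n + 2) => skip i n j)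
      (fun j : Fin n => (j : ℕ)) y := Iff.rfl

theorem capBot_rel {n i : ℕ} (hi : i ≤ n) (x y : Fin n ⊕ Fin (n + 2)) :
    (capBot n i hi).rel x y ↔ Sum.elim (fun j : Fin n => (j : ℕ))
      (fun j : Fin (n + 2) => skip i n j) x = Sum.elim (fun j : Fin n => (j : ℕ))
      (fun j : Fin (n + 2) => skip i n j) y := Iff.rfl

theorem gen_rel {n i : ℕ} (hi : i + 1 < n) (x y : Fin n ⊕ Fin n) :
    (gen n i hi).rel x y ↔ Sum.elim (fun j : Fin n => mark i n j)
      (fun j : Fin n => mark i (n + 1) j) x = Sum.elim (fun j : Fin n => mark i n j)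
      (fun j : Fin n => mark i (n + 1) j) y := Iff.rfl

end Diagram

end TemperleyLieb

namespace TemperleyLieb

/-! ### Composites and juxtapositions of elementary diagrams -/

namespace Diagram

/-- No middle point lies on an arc here, so no loop can close. The generator thereby factors through
an object with two dots fewer, which drives the braid relation and the induction in
`ident_mem_span`. -/
theorem cupTop_comp_capBot {n i : ℕ} (hi : i ≤ n) :
    (cupTop n i hi).comp (capBot n i hi) = gen (n + 2) i (by omega) ∧
      loops (cupTop n i hi) (capBot n i hi) = 0 := by
  constructor
  -- A middle point is labelled by the upper end of its string: `j` to the left of the arc, `j + 2`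
  -- to the right.
  · refine comp_eq_of_label (fun j => mark i (n + 2) j) (fun j => if (j : ℕ) < i then j else j + 2)
      (fun j => mark i (n + 3) j) ?_ ?_ ?_
    · intro u v h
      rw [cupTop_rel] at h
      rcases u with u | u <;> rcases v with v | v <;>
        simp only [Sum.elim_inl, Sum.elim_inr] at h ⊢
      · have := skip_spec i n u
        have := skip_spec i n v
        have := mark_spec i (n + 2) u
        have := mark_spec i (n + 2) v
        omega
      · have := skip_spec i n u
        have := mark_spec i (n + 2) u
        split_ifs <;> omega
      · have := skip_spec i n v
        have := mark_spec i (n + 2) v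
        split_ifs <;> omega
      · split_ifs <;> omega
    · intro u v h
      rw [capBot_rel] at h
      rcases u with u | u <;> rcases v with v | v <;>
        simp only [Sum.elim_inl, Sum.elim_inr] at h ⊢
      · split_ifs <;> omega
      · have := skip_spec i n v
        have := mark_spec i (n + 3) v
        split_ifs <;> omega
      · have := skip_spec i n u
        have := mark_spec i (n + 3) u
        split_ifs <;> omega
      · have := skip_spec i n u
        have := skip_spec i n v
        have := mark_spec i (n + 3) u
        have := mark_spec i (n + 3) v
        omega
    · intro x y h
      exact h
  · refine loops_eq_zero fun b => Or.inl ⟨⟨if (b : ℕ) < i then b else b + 2, by split_ifs <;> omega⟩, ?_⟩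
    rw [cupTop_rel]
    have := skip_spec i n (if (b : ℕ) < i then b else b + 2)
    simp only [Sum.elim_inl, Sum.elim_inr]
    split_ifs at this ⊢ <;> omega

theorem capBot_comp_cupTop_self {n i : ℕ} (hi : i ≤ n) :
    (capBot n i hi).comp (cupTop n i hi) = ident n ∧
      loops (capBot n i hi) (cupTop n i hi) = 1 := by
  constructor
  · refine comp_eq_of_label (fun j => j) (fun j => skip i n j) (fun j => j)
      (fun u v h => h) (fun u v h => h) ?_
    rintro (x | x) (y | y) h <;> rw [ident_rel] <;> exact Fin.ext h
  · refine loops_eq_one ⟨i, by omega⟩ ⟨i + 1, by omega⟩ ?_ ?_ ?_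
    · intro x
      rw [capBot_rel]
      have h1 := skip_spec i n i
      rcases x with x | x
      · simp only [Sum.elim_inl, Sum.elim_inr, reduceCtorEq, or_self, iff_false]
        omega
      · have h2 := skip_spec i n x
        simp only [Sum.elim_inr, Sum.inr.injEq, Fin.ext_iff]
        omega
    · intro x
      rw [cupTop_rel]
      have h1 := skip_spec i n i
      rcases x with x | x
      · have h2 := skip_spec i n x
        simp only [Sum.elim_inl, Sum.inl.injEq, Fin.ext_iff]
        omega
      · simp only [Sum.elim_inl, Sum.elim_inr, reduceCtorEq, or_self, iff_false]
        omega
    · intro b h1 h2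
      have h3 := skip_spec i n b
      simp only [ne_eq, Fin.ext_iff] at h1 h2
      refine Or.inl ⟨⟨skip i n b, by omega⟩, ?_⟩
      rw [capBot_rel]
      rfl

/-- The two arcs share the middle point `i + 1` only and form a zigzag, which straightens to a
vertical string. -/
theorem capBot_comp_cupTop_succ {n i : ℕ} (hi : i + 1 ≤ n) :
    (capBot n i (by omega)).comp (cupTop n (i + 1) hi) = ident n ∧
      loops (capBot n i (by omega)) (cupTop n (i + 1) hi) = 0 := by
  constructor
  -- The middle points `i`, `i + 1`, `i + 2` all lie on the zigzag and get the label `i` of its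
  -- outer ends.
  · refine comp_eq_of_label (fun j => j)
      (fun j => if (j : ℕ) < i then j else if (j : ℕ) ≤ i + 2 then i else j - 2) (fun j => j)
      ?_ ?_ ?_
    · intro u v h
      rw [capBot_rel] at h
      rcases u with u | u <;> rcases v with v | v <;>
        simp only [Sum.elim_inl, Sum.elim_inr] at h ⊢
      · exact h
      · have := skip_spec i n v
        split_ifs <;> omega
      · have := skip_spec i n u
        split_ifs <;> omega
      · have := skip_spec i n u
        have := skip_spec i n v
        split_ifs <;> omega
    · intro u v h
      rw [cupTop_rel] at h
      rcases u with u | u <;> rcases v with v | v <;>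
        simp only [Sum.elim_inl, Sum.elim_inr] at h ⊢
      · have := skip_spec (i + 1) n u
        have := skip_spec (i + 1) n v
        split_ifs <;> omega
      · have := skip_spec (i + 1) n u
        split_ifs <;> omega
      · have := skip_spec (i + 1) n v
        split_ifs <;> omega
      · exact h
    · rintro (x | x) (y | y) h <;> rw [ident_rel] <;> exact Fin.ext h
  · refine loops_eq_zero fun b => ?_
    by_cases hb : (b : ℕ) = i + 1
    · refine Or.inr (Or.inr ⟨⟨i, by omega⟩, ⟨i, by omega⟩, ?_, ?_⟩)
      · rw [capBot_rel]
        have := skip_spec i n i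
        have := skip_spec i n b
        simp only [Sum.elim_inr]
        omega
      · rw [cupTop_rel]
        have := skip_spec (i + 1) n i
        simp only [Sum.elim_inl, Sum.elim_inr]
        omega
    by_cases hb' : (b : ℕ) = i
    · refine Or.inr (Or.inl ⟨⟨i, by omega⟩, ?_⟩)
      rw [cupTop_rel]
      have := skip_spec (i + 1) n b
      simp only [Sum.elim_inl, Sum.elim_inr]
      omega
    · have := skip_spec i n b
      refine Or.inl ⟨⟨skip i n b, by omega⟩, ?_⟩
      rw [capBot_rel]
      rfl

theorem capBot_succ_comp_cupTop {n i : ℕ} (hi : i + 1 ≤ n) :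
    (capBot n (i + 1) hi).comp (cupTop n i (by omega)) = ident n ∧
      loops (capBot n (i + 1) hi) (cupTop n i (by omega)) = 0 := by
  constructor
  · refine comp_eq_of_label (fun j => j)
      (fun j => if (j : ℕ) < i then j else if (j : ℕ) ≤ i + 2 then i else j - 2) (fun j => j)
      ?_ ?_ ?_
    · intro u v h
      rw [capBot_rel] at h
      rcases u with u | u <;> rcases v with v | v <;>
        simp only [Sum.elim_inl, Sum.elim_inr] at h ⊢
      · exact h
      · have := skip_spec (i + 1) n v
        split_ifs <;> omega
      · have := skip_spec (i + 1) n u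
        split_ifs <;> omega
      · have := skip_spec (i + 1) n u
        have := skip_spec (i + 1) n v
        split_ifs <;> omega
    · intro u v h
      rw [cupTop_rel] at h
      rcases u with u | u <;> rcases v with v | v <;>
        simp only [Sum.elim_inl, Sum.elim_inr] at h ⊢
      · have := skip_spec i n u
        have := skip_spec i n v
        split_ifs <;> omega
      · have := skip_spec i n u
        split_ifs <;> omega
      · have := skip_spec i n v
        split_ifs <;> omega
      · exact h
    · rintro (x | x) (y | y) h <;> rw [ident_rel] <;> exact Fin.ext h
  · refine loops_eq_zero fun b => ?_
    by_cases hb : (b : ℕ) = i + 1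
    · refine Or.inr (Or.inr ⟨⟨i + 2, by omega⟩, ⟨i, by omega⟩, ?_, ?_⟩)
      · rw [capBot_rel]
        have := skip_spec (i + 1) n (i + 2)
        have := skip_spec (i + 1) n b
        simp only [Sum.elim_inr]
        omega
      · rw [cupTop_rel]
        have := skip_spec i n (i + 2)
        simp only [Sum.elim_inl, Sum.elim_inr]
        omega
    by_cases hb' : (b : ℕ) = i + 2
    · refine Or.inr (Or.inl ⟨⟨i, by omega⟩, ?_⟩)
      rw [cupTop_rel]
      have := skip_spec i n b
      simp only [Sum.elim_inl, Sum.elim_inr]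
      omega
    · have := skip_spec (i + 1) n b
      refine Or.inl ⟨⟨skip (i + 1) n b, by omega⟩, ?_⟩
      rw [capBot_rel]
      rfl

theorem rel_arc {m n : ℕ} {d : Diagram m n} {x y : Fin m ⊕ Fin n} (hne : x ≠ y)
    (h : d.rel x y) (z : Fin m ⊕ Fin n) : d.rel x z ↔ z = x ∨ z = y := by
  constructor
  · intro hz
    by_cases hzx : z = x
    · exact Or.inl hzx
    · exact Or.inr ((d.isMatching x).unique ⟨hzx, hz⟩ ⟨hne.symm, h⟩)
  · rintro (rfl | rfl)
    · exact d.rel.refl' _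
    · exact h

theorem gen_rel_top {n i : ℕ} (hi : i + 1 < n) :
    (gen n i hi).rel (Sum.inl ⟨i, by omega⟩) (Sum.inl ⟨i + 1, hi⟩) := by
  rw [gen_rel]
  have := mark_spec i n i
  have := mark_spec i n (i + 1)
  simp only [Sum.elim_inl]
  omega

theorem gen_rel_bot {n i : ℕ} (hi : i + 1 < n) :
    (gen n i hi).rel (Sum.inr ⟨i, by omega⟩) (Sum.inr ⟨i + 1, hi⟩) := by
  rw [gen_rel]
  have := mark_spec i (n + 1) i
  have := mark_spec i (n + 1) (i + 1)
  simp only [Sum.elim_inr]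
  omega

theorem gen_rel_through {n i : ℕ} (hi : i + 1 < n) {b : Fin n} (h1 : (b : ℕ) ≠ i)
    (h2 : (b : ℕ) ≠ i + 1) : (gen n i hi).rel (Sum.inl b) (Sum.inr b) := by
  rw [gen_rel]
  have := mark_spec i n b
  have := mark_spec i (n + 1) b
  simp only [Sum.elim_inl, Sum.elim_inr]
  omega

/-- A relation which contains the joins of `e_i` contains `e_i`. -/
theorem gen_le {n i : ℕ} (hi : i + 1 < n) (r : Setoid (Fin n ⊕ Fin n))
    (h1 : r (Sum.inl ⟨i, by omega⟩) (Sum.inl ⟨i + 1, hi⟩))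
    (h2 : r (Sum.inr ⟨i, by omega⟩) (Sum.inr ⟨i + 1, hi⟩))
    (h3 : ∀ b : Fin n, (b : ℕ) ≠ i → (b : ℕ) ≠ i + 1 → r (Sum.inl b) (Sum.inr b))
    {x y : Fin n ⊕ Fin n} (h : (gen n i hi).rel x y) : r x y := by
  have key : ∀ x, ∀ y ≠ x, (gen n i hi).rel x y → r x y := by
    intro x y hxy h
    rcases x with x | x
    · by_cases hx : (x : ℕ) = i
      · have hxe : x = ⟨i, by omega⟩ := Fin.ext hx
        rw [hxe] at h hxy ⊢
        rcases (rel_arc (by simp) (gen_rel_top hi) y).1 h with rfl | rfl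
        exacts [absurd rfl hxy, h1]
      by_cases hx' : (x : ℕ) = i + 1
      · have hxe : x = ⟨i + 1, hi⟩ := Fin.ext hx'
        rw [hxe] at h hxy ⊢
        rcases (rel_arc (by simp) ((gen n i hi).rel.symm' (gen_rel_top hi)) y).1 h with rfl | rfl
        exacts [absurd rfl hxy, r.symm' h1]
      · rcases (rel_arc (by simp) (gen_rel_through hi hx hx') y).1 h with rfl | rfl
        exacts [absurd rfl hxy, h3 _ hx hx']
    · by_cases hx : (x : ℕ) = i
      · have hxe : x = ⟨i, by omega⟩ := Fin.ext hx
        rw [hxe] at h hxy ⊢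
        rcases (rel_arc (by simp) (gen_rel_bot hi) y).1 h with rfl | rfl
        exacts [absurd rfl hxy, h2]
      by_cases hx' : (x : ℕ) = i + 1
      · have hxe : x = ⟨i + 1, hi⟩ := Fin.ext hx'
        rw [hxe] at h hxy ⊢
        rcases (rel_arc (by simp) ((gen n i hi).rel.symm' (gen_rel_bot hi)) y).1 h with rfl | rfl
        exacts [absurd rfl hxy, r.symm' h2]
      · rcases (rel_arc (by simp) ((gen n i hi).rel.symm' (gen_rel_through hi hx hx')) y).1 h
          with rfl | rfl
        exacts [absurd rfl hxy, r.symm' (h3 _ hx hx')]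
  by_cases hxy : y = x
  · subst hxy
    exact r.refl' _
  · exact key x y hxy h

/-- The lower arc of `e_i` closes up with the arc of `d` to a loop, and the upper arc of `e_i`
replaces the lost one. -/
theorem gen_comp {m n i : ℕ} (hi : i + 1 < m) {d : Diagram m n}
    (hd : d.rel (Sum.inl ⟨i, by omega⟩) (Sum.inl ⟨i + 1, hi⟩)) :
    (gen m i hi).comp d = d ∧ loops (gen m i hi) d = 1 := by
  constructor
  -- The upper and the middle row are folded together; all joins of `e_i` then become relations of
  -- `d`.
  · refine comp_eq_of_rel (d.rel.comap (Sum.elim Sum.inl id)) (fun u v h => ?_)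
      (fun u v h => h) (fun x y h => ?_)
    · exact gen_le hi (d.rel.comap (Sum.elim Sum.inl id ∘ Sum.map id Sum.inl)) hd hd
        (fun b _ _ => d.rel.refl' _) h
    · rcases x with x | x <;> rcases y with y | y <;> exact h
  · refine loops_eq_one ⟨i, by omega⟩ ⟨i + 1, hi⟩ (rel_arc (by simp) (gen_rel_bot hi))
      (rel_arc (by simp) hd) fun b h1 h2 => Or.inl ⟨b, ?_⟩
    exact (gen m i hi).rel.symm' (gen_rel_through hi (fun h => h1 (Fin.ext h))
      (fun h => h2 (Fin.ext h)))

theorem comp_gen {m n i : ℕ} (hi : i + 1 < n) {d : Diagram m n}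
    (hd : d.rel (Sum.inr ⟨i, by omega⟩) (Sum.inr ⟨i + 1, hi⟩)) :
    d.comp (gen n i hi) = d ∧ loops d (gen n i hi) = 1 := by
  constructor
  · refine comp_eq_of_rel (d.rel.comap (Sum.elim Sum.inl (Sum.elim Sum.inr Sum.inr)))
      (fun u v h => ?_) (fun u v h => ?_) (fun x y h => ?_)
    · rcases u with u | u <;> rcases v with v | v <;> exact h
    · exact gen_le hi (d.rel.comap (Sum.elim Sum.inr Sum.inr)) hd hd
        (fun b _ _ => d.rel.refl' _) h
    · rcases x with x | x <;> rcases y with y | y <;> exact h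
  · refine loops_eq_one ⟨i, by omega⟩ ⟨i + 1, hi⟩ (rel_arc (by simp) hd)
      (rel_arc (by simp) (gen_rel_top hi)) fun b h1 h2 => Or.inr ⟨b, ?_⟩
    exact gen_rel_through hi (fun h => h1 (Fin.ext h)) (fun h => h2 (Fin.ext h))

theorem juxt_rel {a b c d m n : ℕ} (h : a + c = m) (h' : b + d = n) (x : Diagram a b)
    (y : Diagram c d) (u v : (Fin a ⊕ Fin b) ⊕ (Fin c ⊕ Fin d)) :
    (juxt h h' x y).rel ((rowsEquiv (splitFin h) (splitFin h')).symm u)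
      ((rowsEquiv (splitFin h) (splitFin h')).symm v) ↔ Sum.LiftRel x.rel y.rel u v := by
  change Sum.LiftRel _ _ _ _ ↔ _
  rw [Equiv.apply_symm_apply, Equiv.apply_symm_apply]

/-- A point of the left part of a row. -/
def leftPt {a c m : ℕ} (h : a + c = m) (i : Fin a) : Fin m := ⟨i, by omega⟩

/-- A point of the right part of a row. -/
def rightPt {a c m : ℕ} (h : a + c = m) (i : Fin c) : Fin m := ⟨a + i, by omega⟩

theorem juxt_le {a b c d m n : ℕ} (h : a + c = m) (h' : b + d = n) {x : Diagram a b}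
    {y : Diagram c d} (r : Setoid (Fin m ⊕ Fin n))
    (h1 : ∀ u v, x.rel u v → r (Sum.map (leftPt h) (leftPt h') u)
      (Sum.map (leftPt h) (leftPt h') v))
    (h2 : ∀ u v, y.rel u v → r (Sum.map (rightPt h) (rightPt h') u)
      (Sum.map (rightPt h) (rightPt h') v))
    {u v : Fin m ⊕ Fin n} (huv : (juxt h h' x y).rel u v) : r u v := by
  subst h h'
  obtain ⟨u, rfl⟩ := (rowsEquiv (splitFin rfl) (splitFin rfl)).symm.surjective u
  obtain ⟨v, rfl⟩ := (rowsEquiv (splitFin rfl) (splitFin rfl)).symm.surjective v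
  rw [juxt_rel] at huv
  rcases huv with @⟨u, v, huv⟩ | @⟨u, v, huv⟩
  · have := h1 u v huv
    rcases u with u | u <;> rcases v with v | v <;> exact this
  · have := h2 u v huv
    rcases u with u | u <;> rcases v with v | v <;> exact this

/-- By `eq_of_le` only the joins of each half have to be found in the generator on `n` points. -/
theorem juxt_gen_ident {m c n i : ℕ} (h : m + c = n) (hi : i + 1 < m) :
    juxt h h (gen m i hi) (ident c) = gen n i (by omega) := by
  refine eq_of_le fun u v huv => juxt_le h h _ ?_ ?_ huv
  · intro u v h1
    refine gen_le hi ((gen n i (by omega)).rel.comap (Sum.map (leftPt h) (leftPt h)))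
      (gen_rel_top (n := n) (i := i) _) (gen_rel_bot (n := n) (i := i) _) (fun b h1 h2 => ?_) h1
    exact gen_rel_through (b := leftPt h b) (by omega : i + 1 < n) h1 h2
  · intro u v h1
    have key : ∀ b : Fin c, (gen n i (by omega)).rel (Sum.inl (rightPt h b))
        (Sum.inr (rightPt h b)) := fun b =>
      gen_rel_through _ (by simp only [rightPt]; omega) (by simp only [rightPt]; omega)
    rw [ident_rel] at h1
    rcases u with u | u <;> rcases v with v | v <;> simp only [Sum.elim_inl, Sum.elim_inr, id] at h1 <;>
      subst h1
    exacts [Setoid.refl' _ _, key _, Setoid.symm' _ (key _), Setoid.refl' _ _]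

theorem juxt_ident_gen {m c n i : ℕ} (h : c + m = n) (hi : i + 1 < m) :
    juxt h h (ident c) (gen m i hi) = gen n (c + i) (by omega) := by
  refine eq_of_le fun u v huv => juxt_le h h _ ?_ ?_ huv
  · intro u v h1
    have key : ∀ b : Fin c, (gen n (c + i) (by omega)).rel (Sum.inl (leftPt h b))
        (Sum.inr (leftPt h b)) := fun b =>
      gen_rel_through _ (by simp only [leftPt]; omega) (by simp only [leftPt]; omega)
    rw [ident_rel] at h1
    rcases u with u | u <;> rcases v with v | v <;> simp only [Sum.elim_inl, Sum.elim_inr, id] at h1 <;>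
      subst h1
    exacts [Setoid.refl' _ _, key _, Setoid.symm' _ (key _), Setoid.refl' _ _]
  · intro u v h1
    refine gen_le hi ((gen n (c + i) (by omega)).rel.comap (Sum.map (rightPt h) (rightPt h)))
      (gen_rel_top (n := n) (i := c + i) _) (gen_rel_bot (n := n) (i := c + i) _)
      (fun b h1 h2 => ?_) h1
    exact gen_rel_through (b := rightPt h b) (by omega : c + i + 1 < n) (by simp only [rightPt]; omega)
      (by simp only [rightPt]; omega)

end Diagram

end TemperleyLieb

namespace TemperleyLieb

/-! ### Innermost arcs and diagrams without upper arcs -/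

namespace Diagram

/-- Below each join there is a join of two adjacent points. -/
theorem exists_adjacent {m n : ℕ} (d : Diagram m n) {x y : Fin m ⊕ Fin n} (h : d.rel x y)
    (hxy : pos x < pos y) :
    ∃ x' y', d.rel x' y' ∧ pos x ≤ pos x' ∧ pos y' = pos x' + 1 ∧ pos y' ≤ pos y := by
  induction hk : pos y - pos x using Nat.strong_induction_on generalizing x y with
  | _ k ih =>
  by_cases h1 : pos y = pos x + 1
  · exact ⟨x, y, h, le_rfl, h1, le_rfl⟩
  -- The point `z` following `x` on the boundary is neither `x` nor `y`. Planarity confines its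
  -- partner to the positions between `z` and `y`, and the induction continues with this shorter
  -- join.
  have hz : ∃ z : Fin m ⊕ Fin n, pos z = pos x + 1 := by
    have hy : pos y < m + n := by
      rcases y with y | y <;> simp only [pos, Sum.elim_inl, Sum.elim_inr] <;> omega
    by_cases hm : pos x + 1 < m
    · exact ⟨Sum.inl ⟨pos x + 1, hm⟩, rfl⟩
    · refine ⟨Sum.inr ⟨n - 1 - (pos x + 1 - m), by omega⟩, ?_⟩
      have hx : pos x + 1 < m + n := by omega
      change m + (n - 1 - (n - 1 - (pos x + 1 - m))) = pos x + 1
      omega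
  obtain ⟨z, hz⟩ := hz
  obtain ⟨w, ⟨hwz, hzw⟩, -⟩ := d.isMatching z
  have e1 : pos w ≠ pos z := fun h => hwz (pos_injective h)
  have e2 : pos w ≠ pos x := by
    intro h2
    rw [pos_injective h2] at hzw
    rcases (rel_arc (fun h3 => by rw [h3] at hxy; omega) h z).1 (d.rel.symm' hzw) with h3 | h3 <;>
      rw [h3] at hz <;> omega
  have e3 : pos w ≠ pos y := by
    intro h2
    rw [pos_injective h2] at hzw
    rcases (rel_arc (fun h3 => by rw [h3] at hxy; omega) h z).1
      (d.rel.trans' h (d.rel.symm' hzw)) with h3 | h3 <;> rw [h3] at hz <;> omega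
  have e4 : pos x < pos w := by
    by_contra h2
    exact d.noncrossing w x z y (by omega) (by omega) (by omega) (d.rel.symm' hzw) h
  have e5 : pos w < pos y := by
    by_contra h2
    exact d.noncrossing x z y w (by omega) (by omega) (by omega) h hzw
  obtain ⟨x', y', h', h2, h3, h4⟩ := ih _ (by omega) hzw (by omega) rfl
  exact ⟨x', y', h', by omega, h3, by omega⟩

/-- The diagram joins two adjacent points of the upper row. -/
def HasTopCup {m n : ℕ} (d : Diagram m n) : Prop :=
  ∃ (a : ℕ) (h : a + 1 < m), d.rel (Sum.inl ⟨a, by omega⟩) (Sum.inl ⟨a + 1, h⟩)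

/-- The diagram joins the points `a` and `a + 1` of the lower row. -/
def HasCapAt {m n : ℕ} (d : Diagram m n) (a : ℕ) : Prop :=
  ∃ h : a + 1 < n, d.rel (Sum.inr ⟨a, by omega⟩) (Sum.inr ⟨a + 1, h⟩)

theorem hasTopCup_of_rel {m n : ℕ} {d : Diagram m n} {x y : Fin m} (hxy : x ≠ y)
    (h : d.rel (Sum.inl x) (Sum.inl y)) : d.HasTopCup := by
  wlog hlt : x < y generalizing x y
  · exact this hxy.symm (d.rel.symm' h) (lt_of_le_of_ne (not_lt.1 hlt) hxy.symm)
  obtain ⟨x', y', h', h1, h2, h3⟩ := d.exists_adjacent h hlt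
  have hy : pos y' < m := lt_of_le_of_lt h3 y.2
  rcases x' with a | a <;> rcases y' with b | b <;>
    simp only [pos, Sum.elim_inl, Sum.elim_inr] at h1 h2 h3 hy <;> try omega
  refine ⟨a, by omega, ?_⟩
  have hb : b = ⟨a + 1, by omega⟩ := Fin.ext h2
  rwa [hb] at h'

theorem hasCapAt_of_rel {m n : ℕ} {d : Diagram m n} {x y : Fin n} (hxy : x < y)
    (h : d.rel (Sum.inr x) (Sum.inr y)) : ∃ a, (x : ℕ) ≤ a ∧ a + 1 ≤ y ∧ d.HasCapAt a := by
  -- The boundary runs through the lower row from right to left, so `y` comes before `x`.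
  obtain ⟨x', y', h', h1, h2, h3⟩ := d.exists_adjacent (d.rel.symm' h) (by
    simp only [pos, Sum.elim_inr]; omega)
  rcases x' with a | a <;> rcases y' with b | b <;>
    simp only [pos, Sum.elim_inl, Sum.elim_inr] at h1 h2 h3 <;> try omega
  refine ⟨b, by omega, by omega, by omega, ?_⟩
  have ha : a = ⟨b + 1, by omega⟩ := Fin.ext (by simp only; omega)
  rw [ha] at h'
  exact d.rel.symm' h'

/-- A diagram without arcs in the upper row joins the points of the upper row to points of the lower
row, in increasing order. -/
theorem exists_strictMono {m n : ℕ} {d : Diagram m n} (hd : ¬ d.HasTopCup) :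
    ∃ σ : Fin m → Fin n, StrictMono σ ∧ (∀ a, d.rel (Sum.inl a) (Sum.inr (σ a))) ∧
      ∀ j, (∃ a, σ a = j) ↔ ¬ ∃ j', j' ≠ j ∧ d.rel (Sum.inr j) (Sum.inr j') := by
  have h : ∀ a : Fin m, ∃ j : Fin n, d.rel (Sum.inl a) (Sum.inr j) := by
    intro a
    obtain ⟨y, ⟨hy, hay⟩, -⟩ := d.isMatching (Sum.inl a)
    rcases y with y | y
    · exact absurd (hasTopCup_of_rel (fun h => hy (by rw [h])) hay) hd
    · exact ⟨y, hay⟩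
  choose σ hσ using h
  refine ⟨σ, ?_, hσ, ?_⟩
  · intro a b hab
    by_contra hn
    have hne : σ a ≠ σ b := by
      intro he
      have h1 := hσ b
      rw [← he] at h1
      rcases (rel_arc (by simp) (hσ a) (Sum.inl b)).1 (d.rel.trans' (hσ a) (d.rel.symm' h1))
        with h2 | h2 <;> simp at h2
      exact hab.ne h2.symm
    rw [← Fin.val_ne_iff] at hne
    -- If the strings from `a < b` ended in the opposite order, they would cross.
    refine d.noncrossing (Sum.inl a) (Sum.inl b) (Sum.inr (σ a)) (Sum.inr (σ b)) hab ?_ ?_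
      (hσ a) (hσ b) <;> simp only [pos, Sum.elim_inl, Sum.elim_inr] <;> omega
  · intro j
    constructor
    · rintro ⟨a, rfl⟩ ⟨j', hj', h⟩
      rcases (rel_arc (by simp) (d.rel.symm' (hσ a)) _).1 h with h1 | h1 <;> simp at h1
      exact hj' h1
    · intro h
      obtain ⟨y, ⟨hy, hjy⟩, -⟩ := d.isMatching (Sum.inr j)
      rcases y with y | y
      · refine ⟨y, ?_⟩
        rcases (rel_arc (by simp) (d.rel.symm' hjy) _).1 (hσ y) with h1 | h1 <;> simp at h1
        exact h1
      · exact absurd ⟨y, fun h1 => hy (by rw [h1]), hjy⟩ h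

/-- Without upper arcs, the upper points correspond to the lower points which are on no lower arc,
and the lower arcs determine their number. -/
theorem width_eq {m m' n : ℕ} {d : Diagram m n} {d' : Diagram m' n} (hd : ¬ d.HasTopCup)
    (hd' : ¬ d'.HasTopCup)
    (h : ∀ x y, d.rel (Sum.inr x) (Sum.inr y) ↔ d'.rel (Sum.inr x) (Sum.inr y)) : m = m' := by
  classical
  obtain ⟨σ, hσ, -, hr⟩ := exists_strictMono hd
  obtain ⟨σ', hσ', -, hr'⟩ := exists_strictMono hd'
  have h1 : Finset.univ.image σ = Finset.univ.image σ' := by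
    ext j
    simp only [Finset.mem_image, Finset.mem_univ, true_and, hr, hr', h]
  have h2 := congrArg Finset.card h1
  rwa [Finset.card_image_of_injective _ hσ.injective,
    Finset.card_image_of_injective _ hσ'.injective, Finset.card_univ, Finset.card_univ,
    Fintype.card_fin, Fintype.card_fin] at h2

/-- The through strings form an increasing map, which is determined by its range, that is, by the
complement of the lower arcs. -/
theorem eq_of_lower {m n : ℕ} {d d' : Diagram m n} (hd : ¬ d.HasTopCup) (hd' : ¬ d'.HasTopCup)
    (h : ∀ x y, d.rel (Sum.inr x) (Sum.inr y) ↔ d'.rel (Sum.inr x) (Sum.inr y)) : d = d' := by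
  obtain ⟨σ, hσ, hs, hr⟩ := exists_strictMono hd
  obtain ⟨σ', hσ', hs', hr'⟩ := exists_strictMono hd'
  have h1 : σ = σ' := by
    refine (hσ.range_inj hσ').1 ?_
    ext j
    simp only [Set.mem_range, hr, hr', h]
  subst h1
  refine eq_of_le fun x y hxy => ?_
  rcases x with x | x <;> rcases y with y | y
  · rcases (rel_arc (by simp) (hs x) _).1 hxy with h2 | h2
    · exact h2 ▸ d'.rel.refl' _
    · simp at h2
  · rcases (rel_arc (by simp) (hs x) _).1 hxy with h2 | h2
    · simp at h2
    · rw [h2]; exact hs' x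
  · rcases (rel_arc (by simp) (hs y) _).1 (d.rel.symm' hxy) with h2 | h2
    · simp at h2
    · rw [h2]; exact d'.rel.symm' (hs' y)
  · exact (h x y).1 hxy

theorem ident_not_hasTopCup (n : ℕ) : ¬ (ident n).HasTopCup := by
  rintro ⟨a, h, h1⟩
  simp [ident_rel] at h1

theorem ident_not_hasCapAt (n a : ℕ) : ¬ (ident n).HasCapAt a := by
  rintro ⟨h, h1⟩
  simp [ident_rel] at h1

theorem capBot_not_hasTopCup {n i : ℕ} (hi : i ≤ n) : ¬ (capBot n i hi).HasTopCup := by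
  rintro ⟨a, h, h1⟩
  simp [capBot_rel] at h1

theorem capBot_hasCapAt {n i a : ℕ} (hi : i ≤ n) : (capBot n i hi).HasCapAt a ↔ a = i := by
  constructor
  · rintro ⟨h, h1⟩
    rw [capBot_rel] at h1
    have := skip_spec i n a
    have := skip_spec i n (a + 1)
    simp only [Sum.elim_inr] at h1
    omega
  · rintro rfl
    refine ⟨by omega, ?_⟩
    rw [capBot_rel]
    have := skip_spec a n a
    have := skip_spec a n (a + 1)
    simp only [Sum.elim_inr]
    omega

/-- A diagram without arcs between adjacent points of one row is an identity. -/
theorem eq_ident {m n : ℕ} {d : Diagram m n} (hd : ¬ d.HasTopCup) (h : ∀ a, ¬ d.HasCapAt a) :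
    m = n ∧ ∀ hmn : n = m, d = hmn ▸ ident n := by
  have h1 : ∀ x y, d.rel (Sum.inr x) (Sum.inr y) ↔ (ident n).rel (Sum.inr x) (Sum.inr y) := by
    intro x y
    rw [ident_rel]
    refine ⟨fun hxy => ?_, fun hxy => ?_⟩
    · rcases lt_trichotomy x y with h2 | h2 | h2
      · obtain ⟨a, -, -, ha⟩ := hasCapAt_of_rel h2 hxy
        exact absurd ha (h a)
      · exact h2
      · obtain ⟨a, -, -, ha⟩ := hasCapAt_of_rel h2 (d.rel.symm' hxy)
        exact absurd ha (h a)
    · obtain rfl : x = y := hxy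
      exact d.rel.refl' _
  refine ⟨width_eq hd (ident_not_hasTopCup n) h1, ?_⟩
  rintro rfl
  exact eq_of_lower hd (ident_not_hasTopCup _) h1

/-- A diagram with at most one arc between adjacent points of one row, in the lower row at one of the
two ends. -/
theorem eq_capBot {m n i : ℕ} {d : Diagram m (n + 2)} (hi : i = 0 ∨ i = n) (hd : ¬ d.HasTopCup)
    (h : ∀ a, d.HasCapAt a → a = i) (hdi : d.HasCapAt i) :
    m = n ∧ ∀ hmn : n = m, d = hmn ▸ capBot n i (by omega) := by
  obtain ⟨hi', hdi⟩ := hdi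
  have hcap : ∀ {m : ℕ} {d : Diagram m (n + 2)} (_ : ∀ a, d.HasCapAt a → a = i)
      (_ : d.rel (Sum.inr ⟨i, by omega⟩) (Sum.inr ⟨i + 1, hi'⟩)) x y,
      d.rel (Sum.inr x) (Sum.inr y) ↔ x = y ∨ (x.1 = i ∧ y.1 = i + 1) ∨
        (x.1 = i + 1 ∧ y.1 = i) := by
    intro m d h hdi x y
    -- Any lower join spans an adjacent one, which is the arc at `i`. As that arc sits at an end of
    -- the row, the two share an end point and coincide.
    have key : ∀ x y, x < y → d.rel (Sum.inr x) (Sum.inr y) → x.1 = i ∧ y.1 = i + 1 := by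
      intro x y hlt hxy
      obtain ⟨a, h1, h2, ha⟩ := hasCapAt_of_rel hlt hxy
      obtain rfl := h a ha
      rcases hi with h0 | h0
      · have hx : x = ⟨a, by omega⟩ := Fin.ext (by simp only; omega)
        rw [hx] at hxy
        rcases (rel_arc (by simp) hdi _).1 hxy with h3 | h3 <;>
          simp only [Sum.inr.injEq] at h3 <;> subst h3
        · omega
        · exact ⟨by rw [hx], rfl⟩
      · have hy : y = ⟨a + 1, by omega⟩ := Fin.ext (by simp only; omega)
        rw [hy] at hxy
        rcases (rel_arc (by simp) (d.rel.symm' hdi) _).1 (d.rel.symm' hxy) with h3 | h3 <;>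
          simp only [Sum.inr.injEq] at h3 <;> subst h3
        · omega
        · exact ⟨rfl, by rw [hy]⟩
    constructor
    · intro hxy
      rcases lt_trichotomy x y with h2 | h2 | h2
      · exact Or.inr (Or.inl (key x y h2 hxy))
      · exact Or.inl h2
      · exact Or.inr (Or.inr (key y x h2 (d.rel.symm' hxy)).symm)
    · rintro (h1 | ⟨h1, h2⟩ | ⟨h1, h2⟩)
      · exact h1 ▸ d.rel.refl' _
      · have hx : x = ⟨i, Nat.lt_of_succ_lt hi'⟩ := Fin.ext h1
        have hy : y = ⟨i + 1, hi'⟩ := Fin.ext h2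
        rw [hx, hy]
        exact hdi
      · have hx : x = ⟨i + 1, hi'⟩ := Fin.ext h1
        have hy : y = ⟨i, Nat.lt_of_succ_lt hi'⟩ := Fin.ext h2
        rw [hx, hy]
        exact d.rel.symm' hdi
  have hin : i ≤ n := by omega
  have h1 : ∀ x y, d.rel (Sum.inr x) (Sum.inr y) ↔
      (capBot n i hin).rel (Sum.inr x) (Sum.inr y) := by
    intro x y
    obtain ⟨_, h2⟩ := (capBot_hasCapAt hin).2 rfl
    rw [hcap h hdi, hcap (fun a => (capBot_hasCapAt hin).1) h2]
  refine ⟨width_eq hd (capBot_not_hasTopCup hin) h1, ?_⟩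
  rintro rfl
  exact eq_of_lower hd (capBot_not_hasTopCup hin) h1

end Diagram

end TemperleyLieb

namespace TemperleyLieb

/-! ### Jones-Wenzl projectors -/

section Quantum

/-- The quantum integers `[k]`, as polynomials in `δ = [2]`. -/
def quantumInt {K : Type u} [Field K] (δ : K) : ℕ → K
  | 0 => 0
  | 1 => 1
  | k + 2 => δ * quantumInt δ (k + 1) - quantumInt δ k

variable {K : Type u} [Field K] {δ : K}

/-- This is `[k] = (q^k - q^{-k}) / (q - q^{-1})` with denominators cleared. The recursion has order
two, hence the pair of consecutive values. -/
theorem quantumInt_mul (L : Type*) [Field L] [Algebra K L] {q : L} (hq : q ≠ 0)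
    (h : q + q⁻¹ = algebraMap K L δ) (k : ℕ) :
    q ^ k * (q - q⁻¹) * algebraMap K L (quantumInt δ k) = q ^ (2 * k) - 1 ∧
      q ^ (k + 1) * (q - q⁻¹) * algebraMap K L (quantumInt δ (k + 1)) = q ^ (2 * (k + 1)) - 1 := by
  induction k with
  | zero =>
    constructor
    · simp [quantumInt]
    · simp only [quantumInt, map_one]
      field_simp
      ring
  | succ k ih =>
    refine ⟨ih.2, ?_⟩
    have e : algebraMap K L (quantumInt δ (k + 1 + 1)) =
        (q + q⁻¹) * algebraMap K L (quantumInt δ (k + 1)) - algebraMap K L (quantumInt δ k) := by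
      rw [h, ← map_mul, ← map_sub]
      rfl
    have e2 : q ^ (k + 1 + 1) * (q - q⁻¹) * algebraMap K L (quantumInt δ (k + 1 + 1)) =
        (q ^ 2 + 1) * (q ^ (k + 1) * (q - q⁻¹) * algebraMap K L (quantumInt δ (k + 1))) -
          q ^ 2 * (q ^ k * (q - q⁻¹) * algebraMap K L (quantumInt δ k)) := by
      rw [e]
      field_simp
      ring
    rw [e2, ih.1, ih.2]
    ring

/-- For `q = ±1` the quotient formula degenerates to `0 = 0`; its limit is `[k] = q^{k-1} k`. -/
theorem quantumInt_of_sq_eq_one (L : Type*) [Field L] [Algebra K L] {q : L} (hq : q ^ 2 = 1)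
    (h : q + q⁻¹ = algebraMap K L δ) (k : ℕ) :
    algebraMap K L (quantumInt δ k) * q = q ^ k * k ∧
      algebraMap K L (quantumInt δ (k + 1)) * q = q ^ (k + 1) * (k + 1) := by
  have hi : q⁻¹ = q := inv_eq_of_mul_eq_one_left (by rw [← sq, hq])
  induction k with
  | zero => simp [quantumInt]
  | succ k ih =>
    refine ⟨by rw [ih.2]; push_cast; ring, ?_⟩
    have e : algebraMap K L (quantumInt δ (k + 1 + 1)) =
        (q + q⁻¹) * algebraMap K L (quantumInt δ (k + 1)) - algebraMap K L (quantumInt δ k) := by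
      rw [h, ← map_mul, ← map_sub]
      rfl
    rw [e, sub_mul, mul_assoc, ih.1, ih.2, hi]
    have h3 : q ^ (k + 1 + 1) = q ^ k := by rw [pow_succ, pow_succ, mul_assoc, ← sq, hq, mul_one]
    have h4 : (q + q) * (q ^ (k + 1) * (k + 1)) = 2 * q ^ (k + 1 + 1) * (k + 1) := by ring
    rw [h4, h3]
    push_cast
    ring

/-- Take a root `q` of `X² - δ X + 1`. If `[k] = 0` then `q^{2k} = 1`, and genericity leaves only
`q² = 1` in characteristic zero, where `[k] = ± k` does not vanish. -/
theorem IsGeneric.quantumInt_ne_zero (hδ : IsGeneric δ) {k : ℕ} (hk : 0 < k) :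
    quantumInt δ k ≠ 0 := by
  intro h0
  let L := AlgebraicClosure K
  let p : Polynomial L := Polynomial.X ^ 2 - Polynomial.C (algebraMap K L δ) * Polynomial.X + 1
  obtain ⟨q, hq⟩ : ∃ q, p.IsRoot q := by
    refine IsAlgClosed.exists_root p ?_
    have : p.degree = 2 := by
      simp only [p]
      compute_degree!
    rw [this]
    decide
  have hq : q ^ 2 - algebraMap K L δ * q + 1 = 0 := by simpa [p] using hq
  have hq0 : q ≠ 0 := by
    rintro rfl
    simp at hq
  have hδq : q + q⁻¹ = algebraMap K L δ := by
    have := mul_inv_cancel₀ hq0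
    apply mul_left_cancel₀ hq0
    linear_combination hq + this
  have h1 := (quantumInt_mul L hq0 hδq k).1
  rw [h0, map_zero, mul_zero] at h1
  obtain ⟨h2, h3⟩ := hδ q hq0 hδq (2 * k) (by omega) (sub_eq_zero.1 h1.symm)
  have h4 := (quantumInt_of_sq_eq_one L h2 hδq k).1
  rw [h0, map_zero, zero_mul] at h4
  have : CharZero L := charZero_of_injective_algebraMap (algebraMap K L).injective
  rcases mul_eq_zero.1 h4.symm with h5 | h5
  · exact pow_ne_zero k hq0 h5
  · exact hk.ne' (by exact_mod_cast h5)

theorem IsGeneric.ne_zero (hδ : IsGeneric δ) : δ ≠ 0 := by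
  have := hδ.quantumInt_ne_zero (k := 2) (by norm_num)
  simpa [quantumInt] using this

end Quantum

/-! ### Wenzl's recursion in an algebra with Temperley–Lieb relations -/

section Wenzl

variable {K : Type u} [Field K] {A : Type*} [Ring A] [Algebra K A]

/-- Wenzl's recursion. -/
def wenzl (δ : K) (e : ℕ → A) : ℕ → A
  | 0 => 1
  | k + 1 => wenzl δ e k - (quantumInt δ (k + 1) / quantumInt δ (k + 2)) •
      (wenzl δ e k * e k * wenzl δ e k)

variable {δ : K} {e : ℕ → A}

/-- The properties of the elements defined by Wenzl's recursion which are proved together. -/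
structure WenzlProps (δ : K) (e : ℕ → A) (k : ℕ) : Prop where
  idem : wenzl δ e k * wenzl δ e k = wenzl δ e k
  left : ∀ i < k, e i * wenzl δ e k = 0
  right : ∀ i < k, wenzl δ e k * e i = 0
  comm : ∀ j, k + 1 ≤ j → e j * wenzl δ e k = wenzl δ e k * e j
  trace_left : e k * wenzl δ e k * e k * wenzl δ e k =
    (quantumInt δ (k + 2) / quantumInt δ (k + 1)) • (e k * wenzl δ e k)
  trace_right : wenzl δ e k * e k * wenzl δ e k * e k =
    (quantumInt δ (k + 2) / quantumInt δ (k + 1)) • (wenzl δ e k * e k)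

/-- The coefficient in the recursion is the inverse of the partial trace ratio `[k+2]/[k+1]`, so
that the new element is killed by `e k`. The old commutation with `e (k + 1)` then yields the next
partial trace, and so on. -/
theorem wenzlProps (hδ : ∀ k, 0 < k → quantumInt δ k ≠ 0) (h1 : ∀ i, e i * e i = δ • e i)
    (h2 : ∀ i, e (i + 1) * e i * e (i + 1) = e (i + 1))
    (h3 : ∀ i j, i + 2 ≤ j → e i * e j = e j * e i) (k : ℕ) : WenzlProps δ e k := by
  induction k with
  | zero =>
    refine ⟨?_, ?_, ?_, ?_, ?_, ?_⟩ <;> simp [wenzl, quantumInt, h1]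
  | succ k ih =>
    obtain ⟨idem, left, right, comm, tl, tr⟩ := ih
    set f := wenzl δ e k with hf
    set c := quantumInt δ (k + 1) / quantumInt δ (k + 2) with hc
    set t := quantumInt δ (k + 2) / quantumInt δ (k + 1) with ht
    have hq1 := hδ (k + 1) (by omega)
    have hq2 := hδ (k + 2) (by omega)
    have hct : c * t = 1 := by rw [hc, ht]; field_simp
    have hg : wenzl δ e (k + 1) = f - c • (f * e k * f) := rfl
    set g := wenzl δ e (k + 1) with hgdef
    have hfg : f * g = g := by
      rw [hg, mul_sub, idem, mul_smul_comm, ← mul_assoc, ← mul_assoc, idem]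
    have hgf : g * f = g := by
      rw [hg, sub_mul, idem, smul_mul_assoc, mul_assoc _ f f, idem]
    -- The two terms of the recursion cancel by `trace_left` and `c t = 1`.
    have hek : e k * g = 0 := by
      rw [hg, mul_sub, mul_smul_comm, ← mul_assoc, ← mul_assoc, tl, smul_smul, hct, one_smul,
        sub_self]
    have hke : g * e k = 0 := by
      rw [hg, sub_mul, smul_mul_assoc, tr, smul_smul, hct, one_smul, sub_self]
    have hidem : g * g = g := by
      have h0 : g * g = (f - c • (f * e k * f)) * g := by rw [← hg]
      rw [h0, sub_mul, hfg, smul_mul_assoc, mul_assoc, hfg, mul_assoc, hek, mul_zero, smul_zero,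
        sub_zero]
    have hcomm : ∀ j, k + 1 + 1 ≤ j → e j * g = g * e j := by
      intro j hj
      have e1 := comm j (by omega)
      have e2 := h3 k j hj
      rw [hg, mul_sub, sub_mul, e1, mul_smul_comm, smul_mul_assoc, ← mul_assoc, ← mul_assoc, e1,
        mul_assoc f, ← e2, mul_assoc (f * e k), ← e1]
      simp only [mul_assoc]
    have e1 := comm (k + 1) le_rfl
    -- Squaring `e (k + 1)` gives `δ` and the braid relation gives `1`, so the scalar is `δ -
    -- [k+1]/[k+2] = [k+3]/[k+2]`, which is the recursion for quantum integers.
    have hegE : e (k + 1) * g * e (k + 1) =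
        (quantumInt δ (k + 1 + 2) / quantumInt δ (k + 1 + 1)) • (e (k + 1) * f) := by
      have e2 : e (k + 1) * (f * e k * f) * e (k + 1) = f * e (k + 1) := by
        calc e (k + 1) * (f * e k * f) * e (k + 1) = e (k + 1) * f * e k * (f * e (k + 1)) := by
              simp only [mul_assoc]
          _ = f * e (k + 1) * e k * (e (k + 1) * f) := by rw [e1]
          _ = f * (e (k + 1) * e k * e (k + 1)) * f := by simp only [mul_assoc]
          _ = f * e (k + 1) := by rw [h2, mul_assoc, e1, ← mul_assoc, idem]
      have e3 : quantumInt δ (k + 1 + 2) = δ * quantumInt δ (k + 2) - quantumInt δ (k + 1) := rfl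
      rw [hg, mul_sub, sub_mul, mul_smul_comm, smul_mul_assoc, e2, e1, mul_assoc, h1,
        mul_smul_comm, ← sub_smul, e3, hc]
      congr 1
      field_simp
    refine ⟨hidem, ?_, ?_, hcomm, ?_, ?_⟩
    · intro i hi
      rcases Nat.lt_succ_iff_lt_or_eq.1 hi with h | rfl
      · change e i * g = 0
        rw [← hfg, ← mul_assoc, left i h, zero_mul]
      · exact hek
    · intro i hi
      rcases Nat.lt_succ_iff_lt_or_eq.1 hi with h | rfl
      · change g * e i = 0
        rw [← hgf, mul_assoc, right i h, mul_zero]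
      · exact hke
    · rw [hegE, smul_mul_assoc, mul_assoc, hfg]
    · rw [mul_assoc, mul_assoc, ← mul_assoc (e (k + 1)), hegE, mul_smul_comm, e1, ← mul_assoc, hgf]

/-- Used to see that the projector is the identity modulo diagrams with an upper arc: every other
term begins with a generator. The mirror statement does the same for lower arcs. -/
theorem wenzl_eq_left (k : ℕ) :
    ∃ x : ℕ → A, wenzl δ e k = 1 + ∑ i ∈ Finset.range k, e i * x i := by
  induction k with
  | zero => exact ⟨0, by simp [wenzl]⟩
  | succ k ih =>
    obtain ⟨x, hx⟩ := ih
    set c := quantumInt δ (k + 1) / quantumInt δ (k + 2)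
    set y := e k * wenzl δ e k with hy
    -- Only the left factor of the correction term is expanded. Its `1` leaves `- c y`, which starts
    -- with `e k` and gives the new coefficient; the rest keeps starting with the old generators.
    refine ⟨fun i => (if i = k then 0 else x i - c • (x i * y)) +
      if i = k then - c • wenzl δ e k else 0, ?_⟩
    have h : wenzl δ e (k + 1) = wenzl δ e k - c • (wenzl δ e k * y) := by
      rw [hy, ← mul_assoc]; rfl
    rw [Finset.sum_range_succ]
    have h2 : ∀ i ∈ Finset.range k, e i * ((if i = k then 0 else x i - c • (x i * y)) +
        if i = k then - c • wenzl δ e k else 0) = e i * x i - c • (e i * x i * y) := by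
      intro i hi
      have : i ≠ k := (Finset.mem_range.1 hi).ne
      simp [this, mul_sub, mul_assoc]
    rw [Finset.sum_congr rfl h2, Finset.sum_sub_distrib, ← Finset.smul_sum, ← Finset.sum_mul, h]
    nth_rw 1 2 [hx]
    simp [add_mul, smul_add, hy]
    abel

theorem wenzl_eq_right (k : ℕ) :
    ∃ x : ℕ → A, wenzl δ e k = 1 + ∑ i ∈ Finset.range k, x i * e i := by
  induction k with
  | zero => exact ⟨0, by simp [wenzl]⟩
  | succ k ih =>
    obtain ⟨x, hx⟩ := ih
    set c := quantumInt δ (k + 1) / quantumInt δ (k + 2)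
    set y := wenzl δ e k * e k with hy
    refine ⟨fun i => (if i = k then 0 else x i - c • (y * x i)) +
      if i = k then - c • wenzl δ e k else 0, ?_⟩
    have h : wenzl δ e (k + 1) = wenzl δ e k - c • (y * wenzl δ e k) := rfl
    rw [Finset.sum_range_succ]
    have h2 : ∀ i ∈ Finset.range k, ((if i = k then 0 else x i - c • (y * x i)) +
        if i = k then - c • wenzl δ e k else 0) * e i = x i * e i - c • (y * (x i * e i)) := by
      intro i hi
      have : i ≠ k := (Finset.mem_range.1 hi).ne
      simp [this, sub_mul, mul_assoc]
    rw [Finset.sum_congr rfl h2, Finset.sum_sub_distrib, ← Finset.smul_sum, ← Finset.mul_sum, h]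
    nth_rw 1 2 [hx]
    simp [mul_add, smul_add, hy]
    abel

end Wenzl

end TemperleyLieb

namespace TemperleyLieb

/-! ### Jones–Wenzl projectors in `TL_n` and the split semisimplicity of `TL_n` -/

section Projector

variable {K : Type u} [Field K] {δ : K}

local notation:70 x:70 " ⬝ " y:71 => Hom.comp x y

theorem Hom.induction {m n : ℕ} {P : Hom δ m n → Prop} (h0 : P 0)
    (hadd : ∀ x y, P x → P y → P (x + y)) (hsmul : ∀ (c : K) x, P x → P (c • x))
    (hof : ∀ d, P (Hom.of d)) (x : Hom δ m n) : P x := by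
  refine Finsupp.induction_linear (motive := P) x h0 hadd fun d c => ?_
  have h := hsmul c _ (hof d)
  have e : (c • Hom.of d : Hom δ m n) = (Finsupp.single d c : Diagram m n →₀ K) := by
    change c • (Finsupp.single d 1 : Diagram m n →₀ K) = _
    simp
  rwa [e] at h

/-- The elements of `TL_n`, as morphisms of the Temperley-Lieb category. -/
noncomputable def TL.hom {n : ℕ} : TL δ n ≃ₗ[K] Hom δ n n :=
  LinearEquiv.refl K (Hom δ n n)

theorem TL.hom_mul {n : ℕ} (x y : TL δ n) : TL.hom (x * y) = TL.hom x ⬝ TL.hom y := rfl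

theorem TL.hom_of {n : ℕ} (d : Diagram n n) : TL.hom (TL.of d : TL δ n) = Hom.of d := rfl

theorem TL.hom_one {n : ℕ} : TL.hom (1 : TL δ n) = Hom.of (Diagram.ident n) := rfl

theorem Hom.smul_eq {m n : ℕ} (a : TL δ m) (x : Hom δ m n) : a • x = TL.hom a ⬝ x := rfl

theorem Hom.of_gen {n i : ℕ} (hi : i ≤ n) :
    (Hom.of (Diagram.gen (n + 2) i (by omega)) : Hom δ (n + 2) (n + 2)) =
      Hom.of (Diagram.cupTop n i hi) ⬝ Hom.of (Diagram.capBot n i hi) := by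
  rw [Hom.comp_of, (Diagram.cupTop_comp_capBot hi).1, (Diagram.cupTop_comp_capBot hi).2, pow_zero,
    one_smul]

/-- The generators of the Temperley-Lieb algebra. -/
noncomputable def TL.e (δ : K) (n i : ℕ) : TL δ n :=
  if h : i + 1 < n then TL.of (Diagram.gen n i h) else 0

theorem TL.e_of_lt {n i : ℕ} (h : i + 1 < n) : TL.e δ n i = TL.of (Diagram.gen n i h) := dif_pos h

theorem TL.e_of_ge {n i : ℕ} (h : ¬ i + 1 < n) : TL.e δ n i = 0 := dif_neg h

/-- Out of range the generator is zero, which satisfies the relations too. So Wenzl's recursion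
applies to a sequence indexed by all of `ℕ`. -/
theorem TL.e_mul_self (n i : ℕ) : TL.e δ n i * TL.e δ n i = δ • TL.e δ n i := by
  by_cases h : i + 1 < n
  · rw [TL.e_of_lt h, TL.of_mul, (Diagram.comp_gen h (Diagram.gen_rel_bot h)).1,
      (Diagram.comp_gen h (Diagram.gen_rel_bot h)).2, pow_one]
  · rw [TL.e_of_ge h, mul_zero, smul_zero]

/-- Each generator factors as an upper arc followed by a lower arc. In the triple product the two
inner pairs are zigzags and straighten to identities. -/
theorem TL.e_braid (n i : ℕ) :
    TL.e δ n (i + 1) * TL.e δ n i * TL.e δ n (i + 1) = TL.e δ n (i + 1) := by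
  by_cases h : i + 1 + 1 < n
  · obtain ⟨n, rfl⟩ : ∃ k, n = k + 2 := ⟨n - 2, by omega⟩
    have hi : i + 1 ≤ n := by omega
    have h1 := Hom.of_gen (δ := δ) hi
    have h2 := Hom.of_gen (δ := δ) (show i ≤ n by omega)
    have h3 := Diagram.capBot_succ_comp_cupTop hi
    have h4 := Diagram.capBot_comp_cupTop_succ hi
    rw [TL.e_of_lt h, TL.e_of_lt (by omega)]
    change Hom.of _ ⬝ Hom.of _ ⬝ Hom.of _ = Hom.of _
    rw [h1, h2]
    have e1 : (Hom.of (Diagram.capBot n (i + 1) hi) : Hom δ _ _) ⬝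
        Hom.of (Diagram.cupTop n i (by omega)) = Hom.of (Diagram.ident n) := by
      rw [Hom.comp_of, h3.1, h3.2, pow_zero, one_smul]
    have e2 : (Hom.of (Diagram.capBot n i (by omega)) : Hom δ _ _) ⬝
        Hom.of (Diagram.cupTop n (i + 1) hi) = Hom.of (Diagram.ident n) := by
      rw [Hom.comp_of, h4.1, h4.2, pow_zero, one_smul]
    rw [Hom.comp_assoc (Hom.of _) (Hom.of _) (Hom.of _ ⬝ Hom.of _), ← Hom.comp_assoc (Hom.of _)
      (Hom.of _) (Hom.of (Diagram.capBot n i _)), e1, Hom.id_comp, Hom.comp_assoc (Hom.of _)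
      (Hom.of _) (Hom.of _ ⬝ Hom.of _), ← Hom.comp_assoc (Hom.of _) (Hom.of _)
      (Hom.of (Diagram.capBot n (i + 1) _)), e2, Hom.id_comp]
  · rw [TL.e_of_ge h, mul_zero]

theorem juxtLin_e_one {a b n : ℕ} (h : a + b = n) {i : ℕ} (hi : i + 1 < a) :
    juxtLin h (TL.e δ a i) 1 = TL.e δ n i := by
  rw [TL.e_of_lt hi, TL.e_of_lt (by omega), TL.one_def, juxtLin_of, Diagram.juxt_gen_ident]

theorem juxtLin_one_e {a b n : ℕ} (h : a + b = n) {i : ℕ} (hi : i + 1 < b) :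
    juxtLin h 1 (TL.e δ b i) = TL.e δ n (a + i) := by
  rw [TL.e_of_lt hi, TL.e_of_lt (by omega), TL.one_def, juxtLin_of, Diagram.juxt_ident_gen]

/-- Cutting after `i + 2` points puts the two generators into different tensor factors. -/
theorem TL.e_comm (n i j : ℕ) (hij : i + 2 ≤ j) :
    TL.e δ n i * TL.e δ n j = TL.e δ n j * TL.e δ n i := by
  by_cases h : j + 1 < n
  · obtain ⟨j, rfl⟩ := Nat.exists_eq_add_of_le hij
    have hn : (i + 2) + (n - (i + 2)) = n := by omega
    rw [← juxtLin_e_one hn (by omega), ← juxtLin_one_e hn (by omega), ← juxtLin_mul, ← juxtLin_mul,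
      one_mul, one_mul, mul_one, mul_one]
  · rw [TL.e_of_ge h, mul_zero, zero_mul]

/-- The Jones-Wenzl projector. -/
noncomputable def jw (δ : K) (n : ℕ) : TL δ n := wenzl δ (TL.e δ n) (n - 1)

/-- The step `k` of the recursion involves `e 0, …, e (k - 1)`, that is `k + 1` strings, whence `n -
1`; for `n = 0` the truncated index gives the element `1`. -/
theorem jw_props (hδ : IsGeneric δ) (n : ℕ) : WenzlProps δ (TL.e δ n) (n - 1) :=
  wenzlProps (fun _ hk => hδ.quantumInt_ne_zero hk) (TL.e_mul_self n) (TL.e_braid n)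
    (TL.e_comm n) (n - 1)

theorem jw_idem (hδ : IsGeneric δ) (n : ℕ) : jw δ n * jw δ n = jw δ n := (jw_props hδ n).idem

theorem e_mul_jw (hδ : IsGeneric δ) (n i : ℕ) : TL.e δ n i * jw δ n = 0 := by
  by_cases h : i + 1 < n
  · exact (jw_props hδ n).left i (by omega)
  · rw [TL.e_of_ge h, zero_mul]

theorem jw_mul_e (hδ : IsGeneric δ) (n i : ℕ) : jw δ n * TL.e δ n i = 0 := by
  by_cases h : i + 1 < n
  · exact (jw_props hδ n).right i (by omega)
  · rw [TL.e_of_ge h, mul_zero]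

/-- The Jones-Wenzl projector, as a morphism. -/
noncomputable def jwHom (δ : K) (n : ℕ) : Hom δ n n := TL.hom (jw δ n)

theorem hom_jw (n : ℕ) : TL.hom (jw δ n) = jwHom δ n := rfl

theorem jwHom_comp_self (hδ : IsGeneric δ) (n : ℕ) : jwHom δ n ⬝ jwHom δ n = jwHom δ n := by
  rw [← hom_jw, ← TL.hom_mul, jw_idem hδ]

theorem jwHom_comp_e (hδ : IsGeneric δ) (n i : ℕ) : jwHom δ n ⬝ TL.hom (TL.e δ n i) = 0 := by
  rw [← hom_jw, ← TL.hom_mul, jw_mul_e hδ, map_zero]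

theorem e_comp_jwHom (hδ : IsGeneric δ) (n i : ℕ) : TL.hom (TL.e δ n i) ⬝ jwHom δ n = 0 := by
  rw [← hom_jw, ← TL.hom_mul, e_mul_jw hδ, map_zero]

/-- Absorbing `e_i` costs one loop, and `δ` is invertible. So whatever is killed by the generators
is killed by diagrams with arcs. -/
theorem Hom.of_eq_gen_comp (hδ : δ ≠ 0) {m n : ℕ} {d : Diagram m n} (h : d.HasTopCup) :
    ∃ i, (Hom.of d : Hom δ m n) = δ⁻¹ • (TL.hom (TL.e δ m i) ⬝ Hom.of d) := by
  obtain ⟨i, hi, h⟩ := h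
  refine ⟨i, ?_⟩
  have h1 := Diagram.gen_comp hi h
  rw [TL.e_of_lt hi, TL.hom_of, Hom.comp_of, h1.1, h1.2, pow_one, smul_smul, inv_mul_cancel₀ hδ,
    one_smul]

theorem Hom.of_eq_comp_gen (hδ : δ ≠ 0) {m n i : ℕ} {d : Diagram m n} (h : d.HasCapAt i) :
    (Hom.of d : Hom δ m n) = δ⁻¹ • (Hom.of d ⬝ TL.hom (TL.e δ n i)) := by
  obtain ⟨hi, h⟩ := h
  have h1 := Diagram.comp_gen hi h
  rw [TL.e_of_lt hi, TL.hom_of, Hom.comp_of, h1.1, h1.2, pow_one, smul_smul, inv_mul_cancel₀ hδ,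
    one_smul]

theorem jw_comp_of (hδ : IsGeneric δ) {m n : ℕ} {d : Diagram m n} (h : d.HasTopCup) :
    jwHom δ m ⬝ (Hom.of d : Hom δ m n) = 0 := by
  obtain ⟨i, hi⟩ := Hom.of_eq_gen_comp hδ.ne_zero h
  rw [hi, map_smul, ← Hom.comp_assoc, jwHom_comp_e hδ, map_zero, LinearMap.zero_apply, smul_zero]

theorem of_comp_jw (hδ : IsGeneric δ) {m n i : ℕ} {d : Diagram m n} (h : d.HasCapAt i) :
    (Hom.of d : Hom δ m n) ⬝ jwHom δ n = 0 := by
  rw [Hom.of_eq_comp_gen hδ.ne_zero h, map_smul, LinearMap.smul_apply, Hom.comp_assoc,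
    e_comp_jwHom hδ, map_zero, smul_zero]

/-- Between two projectors only diagrams without arcs inside a row survive, and these are
identities. The same remark gives `jw_corner`. -/
theorem jw_orth (hδ : IsGeneric δ) {m n : ℕ} (hmn : m ≠ n) (x : Hom δ m n) :
    jwHom δ m ⬝ x ⬝ jwHom δ n = 0 := by
  induction x using Hom.induction with
  | h0 => simp
  | hadd x y hx hy => rw [map_add, map_add, LinearMap.add_apply, hx, hy, add_zero]
  | hsmul c x hx => rw [map_smul, map_smul, LinearMap.smul_apply, hx, smul_zero]
  | hof d =>
    by_cases h1 : d.HasTopCup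
    · rw [jw_comp_of hδ h1, map_zero, LinearMap.zero_apply]
    by_cases h2 : ∃ a, d.HasCapAt a
    · obtain ⟨a, ha⟩ := h2
      rw [Hom.comp_assoc, of_comp_jw hδ ha, map_zero]
    · exact absurd (Diagram.eq_ident h1 (not_exists.1 h2)).1 hmn

theorem jw_corner (hδ : IsGeneric δ) {m : ℕ} (x : Hom δ m m) :
    ∃ c : K, jwHom δ m ⬝ x ⬝ jwHom δ m = c • jwHom δ m := by
  induction x using Hom.induction with
  | h0 => exact ⟨0, by simp⟩
  | hadd x y hx hy =>
    obtain ⟨c, hc⟩ := hx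
    obtain ⟨d, hd⟩ := hy
    exact ⟨c + d, by rw [map_add, map_add, LinearMap.add_apply, hc, hd, add_smul]⟩
  | hsmul c x hx =>
    obtain ⟨d, hd⟩ := hx
    exact ⟨c * d, by rw [map_smul, map_smul, LinearMap.smul_apply, hd, mul_smul]⟩
  | hof d =>
    by_cases h1 : d.HasTopCup
    · exact ⟨0, by rw [jw_comp_of hδ h1, map_zero, LinearMap.zero_apply, zero_smul]⟩
    by_cases h2 : ∃ a, d.HasCapAt a
    · obtain ⟨a, ha⟩ := h2
      exact ⟨0, by rw [Hom.comp_assoc, of_comp_jw hδ ha, map_zero, zero_smul]⟩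
    · have h3 : d = Diagram.ident m := (Diagram.eq_ident h1 (not_exists.1 h2)).2 rfl
      exact ⟨1, by rw [h3, Hom.comp_id, one_smul, jwHom_comp_self hδ]⟩

/-- An arc at the left end, closed up by its mirror image, is a loop; dividing by `δ` makes `m` a
retract of `m + 2`, and this is iterated. -/
theorem exists_retract (hδ : δ ≠ 0) (m p : ℕ) :
    ∃ (u : Hom δ (m + 2 * p) m) (v : Hom δ m (m + 2 * p)), v ⬝ u = Hom.of (Diagram.ident m) := by
  induction p with
  | zero => exact ⟨Hom.of (Diagram.ident m), Hom.of (Diagram.ident m), Hom.id_comp _⟩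
  | succ p ih =>
    obtain ⟨u, v, h⟩ := ih
    have h1 := Diagram.capBot_comp_cupTop_self (Nat.zero_le (m + 2 * p))
    refine ⟨Hom.of (Diagram.cupTop _ 0 (Nat.zero_le (m + 2 * p))) ⬝ u,
      δ⁻¹ • (v ⬝ Hom.of (Diagram.capBot _ 0 (Nat.zero_le (m + 2 * p)))), ?_⟩
    rw [map_smul, LinearMap.smul_apply, Hom.comp_assoc, ← Hom.comp_assoc (Hom.of _) (Hom.of _) u,
      Hom.comp_of, h1.1, h1.2, pow_one, map_smul, LinearMap.smul_apply, map_smul, smul_smul,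
      Hom.id_comp, h, inv_mul_cancel₀ hδ, one_smul]

theorem exists_simpleIdem (hδ : δ ≠ 0) {n p : ℕ} (h : 2 * p ≤ n) :
    ∃ (ε : TL δ n) (u : Hom δ n (n - 2 * p)) (v : Hom δ (n - 2 * p) n),
      v ⬝ u = Hom.of (Diagram.ident _) ∧ TL.hom ε = u ⬝ jwHom δ (n - 2 * p) ⬝ v := by
  obtain ⟨m, rfl⟩ : ∃ m, n = m + 2 * p := ⟨n - 2 * p, by omega⟩
  rw [Nat.add_sub_cancel]
  obtain ⟨u, v, h⟩ := exists_retract hδ m p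
  exact ⟨TL.hom.symm (u ⬝ jwHom δ m ⬝ v), u, v, h, LinearEquiv.apply_symm_apply _ _⟩

open Classical in
/-- The primitive idempotent of `TL_n` which belongs to the cell module `Δ_n(p)`. -/
noncomputable def simpleIdem (δ : K) (n p : ℕ) : TL δ n :=
  if h : δ ≠ 0 ∧ 2 * p ≤ n then (exists_simpleIdem h.1 h.2).choose else 0

theorem simpleIdem_spec (hδ : δ ≠ 0) {m p n : ℕ} (h : m + 2 * p = n) :
    ∃ (u : Hom δ n m) (v : Hom δ m n), v ⬝ u = Hom.of (Diagram.ident _) ∧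
      TL.hom (simpleIdem δ n p) = u ⬝ jwHom δ m ⬝ v := by
  obtain rfl : m = n - 2 * p := by omega
  have h' : δ ≠ 0 ∧ 2 * p ≤ n := ⟨hδ, by omega⟩
  rw [simpleIdem, dif_pos h']
  exact (exists_simpleIdem h'.1 h'.2).choose_spec

theorem jwHom_eq_left (n : ℕ) : ∃ x : ℕ → Hom δ n n, jwHom δ n = Hom.of (Diagram.ident n) +
    ∑ i ∈ Finset.range (n - 1), TL.hom (TL.e δ n i) ⬝ x i := by
  obtain ⟨x, hx⟩ := wenzl_eq_left (δ := δ) (e := TL.e δ n) (n - 1)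
  exact ⟨fun i => TL.hom (x i), by rw [← hom_jw, jw, hx, map_add, map_sum]; rfl⟩

theorem jw_eq_right (n : ℕ) : ∃ x : ℕ → TL δ n, jw δ n = 1 + ∑ i ∈ Finset.range (n - 1),
    x i * TL.e δ n i := wenzl_eq_right _

/-- The identity is the projector minus terms `e_i x_i`. Each `e_i` factors through the identity of
`n - 2`, to which the induction hypothesis applies. -/
theorem ident_mem_span (n : ℕ) : (Hom.of (Diagram.ident n) : Hom δ n n) ∈
    Submodule.span K {z | ∃ m p, m + 2 * p = n ∧ ∃ (x : Hom δ n m) (y : Hom δ m n),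
      z = x ⬝ jwHom δ m ⬝ y} := by
  induction n using Nat.strong_induction_on with
  | _ n ih =>
  obtain ⟨x, hx⟩ := jwHom_eq_left (δ := δ) n
  have h1 : (Hom.of (Diagram.ident n) : Hom δ n n) =
      jwHom δ n - ∑ i ∈ Finset.range (n - 1), TL.hom (TL.e δ n i) ⬝ x i :=
    (sub_eq_of_eq_add hx).symm
  rw [h1]
  refine Submodule.sub_mem _ (Submodule.subset_span ⟨n, 0, rfl, Hom.of (Diagram.ident n),
    Hom.of (Diagram.ident n), ?_⟩) (Submodule.sum_mem _ fun i hi => ?_)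
  · rw [Hom.id_comp, Hom.comp_id]
  · rw [Finset.mem_range] at hi
    obtain ⟨k, rfl⟩ : ∃ k, n = k + 2 := ⟨n - 2, by omega⟩
    have hik : i ≤ k := by omega
    have h2 : TL.hom (TL.e δ (k + 2) i) ⬝ x i = Hom.of (Diagram.cupTop k i hik) ⬝
        Hom.of (Diagram.ident k) ⬝ (Hom.of (Diagram.capBot k i hik) ⬝ x i) := by
      rw [TL.e_of_lt (by omega), Hom.comp_id, ← Hom.comp_assoc, ← Hom.of_gen, TL.hom_of]
    rw [h2]
    have h3 := ih k (by omega)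
    -- The membership is linear in the identity placed in the middle, so that element is replaced by
    -- an arbitrary element of the span.
    generalize (Hom.of (Diagram.ident k) : Hom δ k k) = z at h3
    induction h3 using Submodule.span_induction with
    | zero => rw [map_zero, map_zero, LinearMap.zero_apply]; exact Submodule.zero_mem _
    | add y z _ _ hy hz =>
      rw [map_add, map_add, LinearMap.add_apply]
      exact Submodule.add_mem _ hy hz
    | smul c y _ hy =>
      rw [map_smul, map_smul, LinearMap.smul_apply]
      exact Submodule.smul_mem _ c hy
    | mem y hy =>
      obtain ⟨m, p, hmp, a, b, rfl⟩ := hy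
      refine Submodule.subset_span ⟨m, p + 1, by omega, Hom.of (Diagram.cupTop k i hik) ⬝ a,
        b ⬝ (Hom.of (Diagram.capBot k i hik) ⬝ x i), ?_⟩
      simp only [Hom.comp_assoc]

/-- Through the retractions, idempotency, corners and orthogonality reduce to the facts about
projectors on `n - 2 p` strings; `ident_mem_span` provides the unit. -/
theorem isSplit_TL (hδ : IsGeneric δ) (n : ℕ) :
    IsSplit K (fun p : Fin (n / 2 + 1) => simpleIdem δ n p) where
  idem p := by
    obtain ⟨u, v, h1, h2⟩ := simpleIdem_spec hδ.ne_zero (show n - 2 * p.1 + 2 * p.1 = n by omega)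
    apply TL.hom.injective
    rw [TL.hom_mul, h2, Hom.comp_assoc (u ⬝ jwHom δ _), Hom.comp_assoc u (jwHom δ _) v,
      ← Hom.comp_assoc v u, h1, Hom.id_comp, ← Hom.comp_assoc, Hom.comp_assoc u,
      jwHom_comp_self hδ, Hom.comp_assoc]
  corner p x := by
    obtain ⟨u, v, h1, h2⟩ := simpleIdem_spec hδ.ne_zero (show n - 2 * p.1 + 2 * p.1 = n by omega)
    obtain ⟨c, hc⟩ := jw_corner hδ (v ⬝ TL.hom x ⬝ u)
    refine ⟨c, TL.hom.injective ?_⟩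
    have h3 : u ⬝ jwHom δ _ ⬝ v ⬝ TL.hom x ⬝ (u ⬝ jwHom δ _ ⬝ v) =
        u ⬝ (jwHom δ _ ⬝ (v ⬝ TL.hom x ⬝ u) ⬝ jwHom δ _) ⬝ v := by simp only [Hom.comp_assoc]
    rw [TL.hom_mul, TL.hom_mul, map_smul, h2, h3, hc, map_smul, map_smul, LinearMap.smul_apply]
  orth p q hpq x := by
    obtain ⟨u, v, h1, h2⟩ := simpleIdem_spec hδ.ne_zero (show n - 2 * p.1 + 2 * p.1 = n by omega)
    obtain ⟨u', v', h1', h2'⟩ := simpleIdem_spec hδ.ne_zero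
      (show n - 2 * q.1 + 2 * q.1 = n by omega)
    apply TL.hom.injective
    have h3 : u ⬝ jwHom δ _ ⬝ v ⬝ TL.hom x ⬝ (u' ⬝ jwHom δ _ ⬝ v') =
        u ⬝ (jwHom δ _ ⬝ (v ⬝ TL.hom x ⬝ u') ⬝ jwHom δ _) ⬝ v' := by simp only [Hom.comp_assoc]
    rw [TL.hom_mul, TL.hom_mul, h2, h2', h3, jw_orth hδ (fun h => hpq (Fin.ext (by omega))),
      map_zero, map_zero, LinearMap.zero_apply, map_zero]
  one_mem := by
    have h := Submodule.mem_map_of_mem (f := (TL.hom.symm : Hom δ n n ≃ₗ[K] TL δ n).toLinearMap)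
      (ident_mem_span (δ := δ) n)
    rw [Submodule.map_span] at h
    refine Submodule.span_mono ?_ h
    rintro _ ⟨z, ⟨m, p, hmp, x, y, rfl⟩, rfl⟩
    obtain ⟨u, v, h1, h2⟩ := simpleIdem_spec hδ.ne_zero hmp
    refine ⟨TL.hom.symm (x ⬝ v), ⟨p, by omega⟩, TL.hom.symm (u ⬝ y), TL.hom.injective ?_⟩
    -- As `v u = 1`, the element `x jw y` is `(x v)(u jw v)(u y)`, which lies in the ideal of the
    -- idempotent.
    have h3 : x ⬝ v ⬝ (u ⬝ jwHom δ m ⬝ v) ⬝ (u ⬝ y) =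
        x ⬝ (v ⬝ u ⬝ (jwHom δ m ⬝ (v ⬝ u ⬝ y))) := by simp only [Hom.comp_assoc]
    rw [TL.hom_mul, TL.hom_mul, h2, LinearEquiv.coe_coe]
    simp only [LinearEquiv.apply_symm_apply]
    rw [h3, h1, Hom.id_comp, Hom.id_comp, ← Hom.comp_assoc]

end Projector

end TemperleyLieb

namespace TemperleyLieb

/-! ### Spans of diagrams and cell modules -/

namespace Diagram

theorem HasTopCup.comp {m n p : ℕ} {d : Diagram m n} (h : d.HasTopCup) (e : Diagram n p) :
    (d.comp e).HasTopCup := by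
  obtain ⟨a, ha, h⟩ := h
  exact ⟨a, ha, glue_top e.rel h⟩

theorem HasCapAt.comp {m n p a : ℕ} {e : Diagram n p} (h : e.HasCapAt a) (d : Diagram m n) :
    (d.comp e).HasCapAt a := by
  obtain ⟨ha, h⟩ := h
  exact ⟨ha, glue_bot d.rel h⟩

theorem gen_hasTopCup {n i : ℕ} (hi : i + 1 < n) : (gen n i hi).HasTopCup :=
  ⟨i, hi, gen_rel_top hi⟩

theorem gen_hasCapAt {n i : ℕ} (hi : i + 1 < n) : (gen n i hi).HasCapAt i :=
  ⟨hi, gen_rel_bot hi⟩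

theorem hasLowerArc_iff {m n : ℕ} (d : Diagram m n) : d.HasLowerArc ↔ ∃ a, d.HasCapAt a := by
  constructor
  · rintro ⟨i, j, hij, h⟩
    rcases lt_or_gt_of_ne hij with h1 | h1
    · exact (hasCapAt_of_rel h1 h).imp fun _ h => h.2.2
    · exact (hasCapAt_of_rel h1 (d.rel.symm' h)).imp fun _ h => h.2.2
  · rintro ⟨a, ha, h⟩
    exact ⟨_, _, by simp, h⟩

theorem HasLowerArc.comp {m n p : ℕ} {e : Diagram n p} (h : e.HasLowerArc) (d : Diagram m n) :
    (d.comp e).HasLowerArc := by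
  rw [hasLowerArc_iff] at h ⊢
  exact h.imp fun _ h => h.comp d

end Diagram

section Span

variable {K : Type u} [Field K] {δ : K}

local notation:70 x:70 " ⬝ " y:71 => Hom.comp x y

/-- The span of the diagrams with a given property. -/
noncomputable def diagramSpan (δ : K) {m n : ℕ} (P : Diagram m n → Prop) : Submodule K (Hom δ m n) :=
  Submodule.span K {v | ∃ d, P d ∧ v = Hom.of d}

theorem of_mem_diagramSpan {m n : ℕ} {P : Diagram m n → Prop} {d : Diagram m n} (h : P d) :
    Hom.of d ∈ diagramSpan δ P := Submodule.subset_span ⟨d, h, rfl⟩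

theorem diagramSpan_le {m n : ℕ} {P : Diagram m n → Prop} {S : Submodule K (Hom δ m n)}
    (h : ∀ d, P d → Hom.of d ∈ S) : diagramSpan δ P ≤ S := by
  refine Submodule.span_le.2 ?_
  rintro _ ⟨d, hd, rfl⟩
  exact h d hd

theorem diagramSpan_mono {m n : ℕ} {P Q : Diagram m n → Prop} (h : ∀ d, P d → Q d) :
    diagramSpan δ P ≤ diagramSpan δ Q :=
  diagramSpan_le fun d hd => of_mem_diagramSpan (h d hd)

theorem comp_mem_left {m n p : ℕ} {P : Diagram m n → Prop} {Q : Diagram m p → Prop}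
    
    (h : ∀ (d : Diagram m n) (e : Diagram n p), P d → Q (d.comp e)) {x : Hom δ m n} (hx : x ∈ diagramSpan δ P)
    (y : Hom δ n p) : x ⬝ y ∈ diagramSpan δ Q := by
  refine diagramSpan_le (S := (diagramSpan δ Q).comap (Hom.comp.flip y)) (fun d hd => ?_) hx
  rw [Submodule.mem_comap, LinearMap.flip_apply]
  induction y using Hom.induction with
  | h0 => rw [map_zero]; exact Submodule.zero_mem _
  | hadd x y hx hy => rw [map_add]; exact Submodule.add_mem _ hx hy
  | hsmul c x hx => rw [map_smul]; exact Submodule.smul_mem _ c hx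
  | hof e => rw [Hom.comp_of]; exact Submodule.smul_mem _ _ (of_mem_diagramSpan (h d e hd))

theorem comp_mem_right {m n p : ℕ} {P : Diagram n p → Prop} {Q : Diagram m p → Prop}
    
    (h : ∀ (d : Diagram m n) (e : Diagram n p), P e → Q (d.comp e)) (x : Hom δ m n) {y : Hom δ n p}
    (hy : y ∈ diagramSpan δ P) : x ⬝ y ∈ diagramSpan δ Q := by
  refine diagramSpan_le (S := (diagramSpan δ Q).comap (Hom.comp x)) (fun e he => ?_) hy
  rw [Submodule.mem_comap]
  induction x using Hom.induction with
  | h0 => rw [map_zero, LinearMap.zero_apply]; exact Submodule.zero_mem _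
  | hadd x y hx hy => rw [map_add, LinearMap.add_apply]; exact Submodule.add_mem _ hx hy
  | hsmul c x hx => rw [map_smul, LinearMap.smul_apply]; exact Submodule.smul_mem _ c hx
  | hof d => rw [Hom.comp_of]; exact Submodule.smul_mem _ _ (of_mem_diagramSpan (h d e he))

theorem comp_mem_lower {m n p : ℕ} (x : Hom δ m n) {y : Hom δ n p}
    (hy : y ∈ diagramSpan δ Diagram.HasLowerArc) : x ⬝ y ∈ diagramSpan δ Diagram.HasLowerArc :=
  comp_mem_right (fun d _ he => he.comp d) x hy

theorem e_comp_mem {m n : ℕ} (i : ℕ) (x : Hom δ m n) :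
    TL.hom (TL.e δ m i) ⬝ x ∈ diagramSpan δ Diagram.HasTopCup := by
  by_cases h : i + 1 < m
  · rw [TL.e_of_lt h, TL.hom_of]
    exact comp_mem_left (P := Diagram.HasTopCup) (fun d e hd => hd.comp e)
      (of_mem_diagramSpan (Diagram.gen_hasTopCup h)) x
  · rw [TL.e_of_ge h, map_zero, map_zero, LinearMap.zero_apply]
    exact Submodule.zero_mem _

theorem comp_e_mem {m n : ℕ} (i : ℕ) (x : Hom δ m n) :
    x ⬝ TL.hom (TL.e δ n i) ∈ diagramSpan δ (fun d => d.HasCapAt i) := by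
  by_cases h : i + 1 < n
  · rw [TL.e_of_lt h, TL.hom_of]
    exact comp_mem_right (P := fun d => d.HasCapAt i) (fun d e hd => hd.comp d) x
      (of_mem_diagramSpan (Diagram.gen_hasCapAt h))
  · rw [TL.e_of_ge h, map_zero, map_zero]
    exact Submodule.zero_mem _

theorem jw_comp_sub_mem {m n : ℕ} (x : Hom δ m n) :
    jwHom δ m ⬝ x - x ∈ diagramSpan δ Diagram.HasTopCup := by
  obtain ⟨y, hy⟩ := jwHom_eq_left (δ := δ) m
  rw [hy, map_add, LinearMap.add_apply, Hom.id_comp, add_sub_cancel_left, map_sum,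
    LinearMap.sum_apply]
  refine Submodule.sum_mem _ fun i _ => ?_
  rw [Hom.comp_assoc]
  exact e_comp_mem i _

/-- The subspace spanned by the diagrams with property `P` does not contain other diagrams. -/
theorem of_mem_diagramSpan_iff {m n : ℕ} {P : Diagram m n → Prop} {d : Diagram m n} :
    Hom.of d ∈ diagramSpan δ P ↔ P d := by
  classical
  refine ⟨fun h => ?_, of_mem_diagramSpan⟩
  by_contra hd
  have h1 : diagramSpan δ P ≤ LinearMap.ker (Hom.lift fun e => if e = d then (1 : K) else 0) :=
    diagramSpan_le fun e he => by
      rw [LinearMap.mem_ker, Hom.lift_of, if_neg]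
      rintro rfl
      exact hd he
  have h2 := h1 h
  rw [LinearMap.mem_ker, Hom.lift_of, if_pos rfl] at h2
  exact one_ne_zero h2

/-- Stacking on top preserves lower arcs, so the linear span of these diagrams is already a
submodule. -/
theorem cellRelations_eq {n r : ℕ} (h : 2 * r ≤ n) (x : Hom δ n (n - 2 * r)) :
    x ∈ cellRelations δ n r ↔ x ∈ diagramSpan δ (Diagram.HasLowerArc) := by
  constructor
  · intro hx
    induction hx using Submodule.span_induction with
    | zero => exact Submodule.zero_mem _
    | add x y _ _ hx hy => exact Submodule.add_mem _ hx hy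
    | smul a x _ hx =>
      rw [Hom.smul_eq]
      exact comp_mem_lower _ hx
    | mem x hx =>
      obtain ⟨d, hd, rfl⟩ := hx
      exact of_mem_diagramSpan (hd.resolve_right (by omega))
  · intro hx
    refine diagramSpan_le (S := (cellRelations δ n r).restrictScalars K) (fun d hd => ?_) hx
    exact Submodule.subset_span ⟨d, Or.inl hd, rfl⟩

/-- Modulo upper arcs the projector is the identity diagram, which has arcs in neither row. -/
theorem jwHom_notMem (m : ℕ) :
    jwHom δ m ∉ diagramSpan δ Diagram.HasLowerArc := by
  intro h
  have h2 := jw_comp_sub_mem (Hom.of (Diagram.ident m) : Hom δ m m)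
  rw [Hom.comp_id] at h2
  have h3 : (Hom.of (Diagram.ident m) : Hom δ m m) ∈
      diagramSpan δ (fun d : Diagram m m => d.HasLowerArc ∨ d.HasTopCup) := by
    have h4 := Submodule.sub_mem _
      (diagramSpan_mono (Q := fun d : Diagram m m => d.HasLowerArc ∨ d.HasTopCup)
        (fun d hd => Or.inl hd) h)
      (diagramSpan_mono (Q := fun d : Diagram m m => d.HasLowerArc ∨ d.HasTopCup)
        (fun d hd => Or.inr hd) h2)
    rwa [sub_sub_cancel] at h4
  rcases of_mem_diagramSpan_iff.1 h3 with h4 | h4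
  · rw [Diagram.hasLowerArc_iff] at h4
    obtain ⟨a, ha⟩ := h4
    exact Diagram.ident_not_hasCapAt m a ha
  · exact Diagram.ident_not_hasTopCup m h4

theorem jwHom_comp_mem (hδ : IsGeneric δ) {m k : ℕ} (hmk : m ≠ k) (x : Hom δ m k) :
    jwHom δ m ⬝ x ∈ diagramSpan δ Diagram.HasLowerArc := by
  induction x using Hom.induction with
  | h0 => rw [map_zero]; exact Submodule.zero_mem _
  | hadd x y hx hy => rw [map_add]; exact Submodule.add_mem _ hx hy
  | hsmul c x hx => rw [map_smul]; exact Submodule.smul_mem _ c hx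
  | hof d =>
    by_cases h1 : d.HasTopCup
    · rw [jw_comp_of hδ h1]; exact Submodule.zero_mem _
    · refine comp_mem_lower _ (of_mem_diagramSpan ?_)
      rw [Diagram.hasLowerArc_iff]
      by_contra h2
      exact hmk (Diagram.eq_ident h1 (not_exists.1 h2)).1

theorem exists_jwHom_comp_sub_mem (hδ : IsGeneric δ) {m : ℕ} (x : Hom δ m m) :
    ∃ c : K, jwHom δ m ⬝ x - c • jwHom δ m ∈ diagramSpan δ Diagram.HasLowerArc := by
  induction x using Hom.induction with
  | h0 => exact ⟨0, by simp⟩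
  | hadd x y hx hy =>
    obtain ⟨c, hc⟩ := hx
    obtain ⟨d, hd⟩ := hy
    refine ⟨c + d, ?_⟩
    rw [map_add, add_smul, add_sub_add_comm]
    exact Submodule.add_mem _ hc hd
  | hsmul a x hx =>
    obtain ⟨c, hc⟩ := hx
    refine ⟨a * c, ?_⟩
    rw [map_smul, mul_smul, ← smul_sub]
    exact Submodule.smul_mem _ a hc
  | hof d =>
    by_cases h1 : d.HasTopCup
    · exact ⟨0, by rw [jw_comp_of hδ h1, zero_smul, sub_zero]; exact Submodule.zero_mem _⟩
    by_cases h2 : d.HasLowerArc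
    · refine ⟨0, ?_⟩
      rw [zero_smul, sub_zero]
      exact comp_mem_lower _ (of_mem_diagramSpan h2)
    · rw [Diagram.hasLowerArc_iff] at h2
      have h3 : d = Diagram.ident m := (Diagram.eq_ident h1 (not_exists.1 h2)).2 rfl
      exact ⟨1, by rw [h3, Hom.comp_id, one_smul, sub_self]; exact Submodule.zero_mem _⟩

/-- With `ε_p = u jw v`, everything reduces to `jw Hom(n - 2p, n - 2r)` modulo lower arcs. Only an
identity diagram can survive there, so the space is zero for `p ≠ r` and the line of `jw` for `p =
r`. So the cell modules are dual to the idempotents. -/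
theorem rankAt_cell (hδ : IsGeneric δ) {n p r : ℕ} (hp : 2 * p ≤ n) (hr : 2 * r ≤ n) :
    (cell δ n r).rankAt (simpleIdem δ n p) = if p = r then 1 else 0 := by
  obtain ⟨u, v, h1, h2⟩ := simpleIdem_spec hδ.ne_zero (show n - 2 * p + 2 * p = n by omega)
  let π : Hom δ n (n - 2 * r) →ₗ[K] (cell δ n r).carrier :=
    (cellRelations δ n r).mkQ.restrictScalars K
  have hπ : ∀ x, π x = 0 ↔ x ∈ diagramSpan δ Diagram.HasLowerArc := fun x => by
    rw [← cellRelations_eq hr]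
    exact Submodule.Quotient.mk_eq_zero (cellRelations δ n r)
  have hs : ∀ x, Algebra.lsmul K K (cell δ n r).carrier (simpleIdem δ n p) (π x) =
      π (u ⬝ (jwHom δ _ ⬝ (v ⬝ x))) := fun x => by
    rw [← Hom.comp_assoc, ← Hom.comp_assoc, ← h2, ← Hom.smul_eq]
    rfl
  have hπs : Function.Surjective π := Submodule.Quotient.mk_surjective _
  have hu : ∀ x ∈ diagramSpan δ Diagram.HasLowerArc, π (u ⬝ x) = 0 := fun x hx => by
    rw [hπ]
    exact comp_mem_lower u hx
  by_cases hpr : p = r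
  · subst hpr
    rw [if_pos rfl]
    have h3 : π (u ⬝ jwHom δ _) ≠ 0 := by
      rw [Ne, hπ]
      intro h
      apply jwHom_notMem (δ := δ) (n - 2 * p)
      have h4 := comp_mem_lower v h
      rwa [← Hom.comp_assoc, h1, Hom.id_comp] at h4
    have h5 : LinearMap.range (Algebra.lsmul K K (cell δ n p).carrier (simpleIdem δ n p)) =
        Submodule.span K {π (u ⬝ jwHom δ _)} := by
      apply le_antisymm
      · rintro _ ⟨x, rfl⟩
        obtain ⟨x, rfl⟩ := hπs x
        rw [hs]
        obtain ⟨c, hc⟩ := exists_jwHom_comp_sub_mem hδ (v ⬝ x)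
        refine Submodule.mem_span_singleton.2 ⟨c, ?_⟩
        have h6 := hu _ hc
        rw [map_sub, map_smul, map_sub, map_smul, sub_eq_zero] at h6
        exact h6.symm
      · rw [Submodule.span_singleton_le_iff_mem]
        refine ⟨π u, ?_⟩
        rw [hs, h1, Hom.comp_id]
    rw [FDModule.rankAt, h5, finrank_span_singleton h3]
  · rw [if_neg hpr, FDModule.rankAt]
    have h5 : Algebra.lsmul K K (cell δ n r).carrier (simpleIdem δ n p) = 0 := by
      ext x
      obtain ⟨x, rfl⟩ := hπs x
      rw [hs, LinearMap.zero_apply]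
      exact hu _ (jwHom_comp_mem hδ (by omega) _)
    rw [h5, LinearMap.range_zero, finrank_bot]

theorem cls_cell_eq_zero {n r : ℕ} (h : n < 2 * r) : cls (cell δ n r) = 0 := by
  have h1 : cellRelations δ n r = ⊤ := by
    rw [eq_top_iff]
    intro x _
    induction x using Hom.induction with
    | h0 => exact Submodule.zero_mem _
    | hadd x y hx hy => exact Submodule.add_mem _ (hx trivial) (hy trivial)
    | hsmul c x hx => exact ((cellRelations δ n r).restrictScalars K).smul_mem c (hx trivial)
    | hof d => exact Submodule.subset_span ⟨d, Or.inr h, rfl⟩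
  have : Subsingleton (cell δ n r).carrier := Submodule.Quotient.subsingleton_iff.2 h1
  exact cls_eq_zero _

end Span

end TemperleyLieb

namespace TemperleyLieb

/-! ### Fusion of the projectors -/

section Fusion

variable {K : Type u} [Field K] {δ : K}

local notation:70 x:70 " ⬝ " y:71 => Hom.comp x y

/-- Juxtaposition of morphisms. -/
noncomputable def juxtHom {a b c d m n : ℕ} (h : a + c = m) (h' : b + d = n) :
    Hom δ a b →ₗ[K] Hom δ c d →ₗ[K] Hom δ m n :=
  Hom.lift fun x => Hom.lift fun y => Hom.of (Diagram.juxt h h' x y)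

theorem juxtHom_of {a b c d m n : ℕ} (h : a + c = m) (h' : b + d = n) (x : Diagram a b)
    (y : Diagram c d) :
    juxtHom h h' (Hom.of x : Hom δ a b) (Hom.of y) = Hom.of (Diagram.juxt h h' x y) := by
  rw [juxtHom, Hom.lift_of, Hom.lift_of]

theorem hom_juxtLin {k l n : ℕ} (h : k + l = n) (x : TL δ k) (y : TL δ l) :
    TL.hom (juxtLin h x y) = juxtHom h h (TL.hom x) (TL.hom y) := rfl

theorem juxtHom_comp {a b c a' b' c' m n p : ℕ} (h : a + a' = m) (h' : b + b' = n)
    (h'' : c + c' = p) (x : Hom δ a b) (y : Hom δ b c) (x' : Hom δ a' b') (y' : Hom δ b' c') :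
    juxtHom h h'' (x ⬝ y) (x' ⬝ y') = juxtHom h h' x x' ⬝ juxtHom h' h'' y y' := by
  induction x using Hom.induction with
  | h0 => simp
  | hadd x y hx hy => simp only [map_add, LinearMap.add_apply, hx, hy]
  | hsmul c x hx => simp only [map_smul, LinearMap.smul_apply, hx]
  | hof x =>
    induction y using Hom.induction with
    | h0 => simp
    | hadd x y hx hy => simp only [map_add, LinearMap.add_apply, hx, hy]
    | hsmul c x hx => simp only [map_smul, LinearMap.smul_apply, hx]
    | hof y =>
      induction x' using Hom.induction with
      | h0 => simp
      | hadd x y hx hy => simp only [map_add, LinearMap.add_apply, hx, hy]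
      | hsmul c x hx => simp only [map_smul, LinearMap.smul_apply, hx]
      | hof x' =>
        induction y' using Hom.induction with
        | h0 => simp
        | hadd x y hx hy => simp only [map_add, hx, hy]
        | hsmul c x hx => simp only [map_smul, hx]
        | hof y' =>
          have h1 := glue_juxt (splitFin h) (splitFin h') (splitFin h'') x.rel x'.rel y.rel y'.rel
          have h2 : (Diagram.juxt h h' x x').loops (Diagram.juxt h' h'' y y') =
            x.loops y + x'.loops y' := h1.1
          have h3 : (Diagram.juxt h h' x x').comp (Diagram.juxt h' h'' y y') =
            Diagram.juxt h h'' (x.comp y) (x'.comp y') := Diagram.ext h1.2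
          rw [Hom.comp_of, Hom.comp_of, map_smul, map_smul, LinearMap.smul_apply, smul_smul, juxtHom_of,
            juxtHom_of, juxtHom_of, Hom.comp_of, h2, h3, pow_add, mul_comm]

/-- The dimension of `x Hom(m, n) y`. -/
noncomputable def homRank {m n : ℕ} (x : Hom δ m m) (y : Hom δ n n) : ℕ :=
  Module.finrank K (LinearMap.range (Hom.comp.flip y ∘ₗ Hom.comp x : Hom δ m n →ₗ[K] Hom δ m n))

theorem cornerRank_eq_homRank {n : ℕ} (e f : TL δ n) :
    cornerRank K e f = homRank (TL.hom e) (TL.hom f) := rfl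

/-- The map `z ↦ u z v'` has the left inverse `z ↦ v z u'`, so it preserves ranks. This strips the
idempotents down to bare projectors. -/
theorem homRank_retract {m m' n n' : ℕ} {u : Hom δ m m'} {v : Hom δ m' m} {u' : Hom δ n n'}
    {v' : Hom δ n' n} (h : v ⬝ u = Hom.of (Diagram.ident m'))
    (h' : v' ⬝ u' = Hom.of (Diagram.ident n')) (x : Hom δ m' m') (y : Hom δ n' n') :
    homRank (u ⬝ x ⬝ v) (u' ⬝ y ⬝ v') = homRank x y := by
  let F : Hom δ m' n' →ₗ[K] Hom δ m n := Hom.comp.flip v' ∘ₗ Hom.comp u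
  let G : Hom δ m n →ₗ[K] Hom δ m' n' := Hom.comp.flip u' ∘ₗ Hom.comp v
  have hGF : ∀ z, G (F z) = z := fun z => by
    change v ⬝ (u ⬝ z ⬝ v') ⬝ u' = z
    rw [Hom.comp_assoc, Hom.comp_assoc, h', Hom.comp_id, ← Hom.comp_assoc, h, Hom.id_comp]
  have hG : Function.Surjective G := fun z => ⟨F z, hGF z⟩
  have hF : Function.Injective F := Function.LeftInverse.injective hGF
  have hE : (Hom.comp.flip (u' ⬝ y ⬝ v') ∘ₗ Hom.comp (u ⬝ x ⬝ v) : Hom δ m n →ₗ[K] Hom δ m n) =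
      F ∘ₗ (Hom.comp.flip y ∘ₗ Hom.comp x) ∘ₗ G := by
    ext z : 1
    change u ⬝ x ⬝ v ⬝ z ⬝ (u' ⬝ y ⬝ v') = u ⬝ (x ⬝ (v ⬝ z ⬝ u') ⬝ y) ⬝ v'
    simp only [Hom.comp_assoc]
  rw [homRank, hE, LinearMap.range_comp, LinearMap.range_comp, LinearMap.range_eq_top.2 hG,
    Submodule.map_top, homRank]
  exact LinearEquiv.finrank_eq (Submodule.equivMapOfInjective F hF _).symm

/-- The basis of diagrams. -/
noncomputable def Hom.basis (δ : K) (m n : ℕ) : Module.Basis (Diagram m n) K (Hom δ m n) :=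
  .ofRepr (LinearEquiv.refl K (Diagram m n →₀ K))

theorem finrank_diagramSpan {m n : ℕ} (P : Diagram m n → Prop) :
    Module.finrank K (diagramSpan δ P) = Nat.card {d // P d} := by
  have := Fintype.ofFinite {d : Diagram m n // P d}
  have h : diagramSpan δ P =
      Submodule.span K (Set.range fun d : {d // P d} => Hom.basis δ m n d) := by
    rw [diagramSpan]
    congr 1
    ext v
    constructor
    · rintro ⟨d, hd, rfl⟩
      exact ⟨⟨d, hd⟩, rfl⟩
    · rintro ⟨d, rfl⟩
      exact ⟨d.1, d.2, rfl⟩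
  rw [h, Nat.card_eq_fintype_card]
  exact finrank_span_eq_card ((Hom.basis δ m n).linearIndependent.comp _ Subtype.val_injective)

theorem finrank_hom (m n : ℕ) : Module.finrank K (Hom δ m n) = Nat.card (Diagram m n) :=
  Module.finrank_eq_nat_card_basis (Hom.basis δ m n)

/-- A linear map which vanishes on some of the diagrams, and is the identity modulo their span, has
as rank the number of the other diagrams. -/
theorem finrank_range_of_sub_mem {m n : ℕ} {P : Diagram m n → Prop}
    (f : Hom δ m n →ₗ[K] Hom δ m n) (h1 : ∀ d, P d → f (Hom.of d) = 0)
    (h2 : ∀ x, f x - x ∈ diagramSpan δ P) :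
    Module.finrank K (LinearMap.range f) = Nat.card {d // ¬ P d} := by
  classical
  have hk : LinearMap.ker f = diagramSpan δ P := by
    apply le_antisymm
    · intro x hx
      have := h2 x
      rwa [LinearMap.mem_ker.1 hx, zero_sub, Submodule.neg_mem_iff] at this
    · exact diagramSpan_le h1
  have h3 := LinearMap.finrank_range_add_finrank_ker f
  rw [hk, finrank_diagramSpan, finrank_hom] at h3
  have h4 : Nat.card (Diagram m n) = Nat.card {d : Diagram m n // P d} +
      Nat.card {d : Diagram m n // ¬ P d} := by
    rw [← Nat.card_sum]
    exact Nat.card_congr (Equiv.sumCompl P).symm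
  omega

/-- The diagrams which are annihilated by projectors on the upper row and on the two parts of the
lower row. -/
def Diagram.IsReducible {m n : ℕ} (a : ℕ) (d : Diagram m n) : Prop :=
  d.HasTopCup ∨ ∃ i, i + 1 ≠ a ∧ d.HasCapAt i

/-- For `i + 1 ≠ a` the generator does not straddle the cut between the two parts, so it is killed
by one of the projectors or is out of range. -/
theorem e_mul_juxtLin_jw (hδ : IsGeneric δ) {a b n i : ℕ} (h : a + b = n) (hi : i + 1 ≠ a) :
    TL.e δ n i * juxtLin h (jw δ a) (jw δ b) = 0 := by
  by_cases h1 : i + 1 < a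
  · rw [← juxtLin_e_one h h1, ← juxtLin_mul, e_mul_jw hδ, map_zero, LinearMap.zero_apply]
  by_cases h2 : i + 1 < n
  · obtain ⟨j, rfl⟩ : ∃ j, i = a + j := ⟨i - a, by omega⟩
    rw [← juxtLin_one_e h (by omega), ← juxtLin_mul, e_mul_jw hδ, map_zero]
  · rw [TL.e_of_ge h2, zero_mul]

theorem juxtLin_jw_eq {a b n : ℕ} (h : a + b = n) :
    ∃ x y : ℕ → TL δ n, juxtLin h (jw δ a) (jw δ b) = 1 +
      (∑ i ∈ Finset.range (a - 1), x i * TL.e δ n i +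
        ∑ i ∈ Finset.range (b - 1), y i * TL.e δ n (a + i)) := by
  obtain ⟨x, hx⟩ := jw_eq_right (δ := δ) a
  obtain ⟨y, hy⟩ := jw_eq_right (δ := δ) b
  have h1 : juxtLin h (jw δ a) 1 =
      1 + ∑ i ∈ Finset.range (a - 1), juxtLin h (x i) 1 * TL.e δ n i := by
    rw [hx, map_add, LinearMap.add_apply, map_sum, LinearMap.sum_apply]
    congr 1
    · rw [TL.one_def, TL.one_def, juxtLin_of, Diagram.juxt_ident, TL.one_def]
    · refine Finset.sum_congr rfl fun i hi => ?_
      rw [Finset.mem_range] at hi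
      rw [← juxtLin_e_one h (by omega), ← juxtLin_mul, one_mul]
  have h2 : juxtLin h 1 (jw δ b) =
      1 + ∑ i ∈ Finset.range (b - 1), juxtLin h 1 (y i) * TL.e δ n (a + i) := by
    rw [hy, map_add, map_sum]
    congr 1
    · rw [TL.one_def, TL.one_def, juxtLin_of, Diagram.juxt_ident, TL.one_def]
    · refine Finset.sum_congr rfl fun i hi => ?_
      rw [Finset.mem_range] at hi
      rw [← juxtLin_one_e h (by omega), ← juxtLin_mul, one_mul]
  have h3 : juxtLin h (jw δ a) (jw δ b) = juxtLin h (jw δ a) 1 * juxtLin h 1 (jw δ b) := by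
    rw [← juxtLin_mul, one_mul, mul_one]
  refine ⟨fun i => juxtLin h (x i) 1, fun i => juxtLin h (jw δ a) 1 * juxtLin h 1 (y i), ?_⟩
  rw [h3, h2, mul_add, mul_one, Finset.mul_sum, ← add_assoc]
  simp only [← mul_assoc]
  rw [h1]

theorem comp_juxtHom_jw_sub_mem {a b m n : ℕ} (h : a + b = n) (x : Hom δ m n) :
    x ⬝ juxtHom h h (jwHom δ a) (jwHom δ b) - x ∈ diagramSpan δ (Diagram.IsReducible a) := by
  obtain ⟨y, z, hyz⟩ := juxtLin_jw_eq (δ := δ) h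
  have hyz := congrArg TL.hom hyz
  rw [hom_juxtLin, hom_jw, hom_jw, map_add, map_add, map_sum, map_sum, TL.hom_one] at hyz
  rw [hyz, map_add, Hom.comp_id, add_sub_cancel_left, map_add, map_sum, map_sum]
  refine Submodule.add_mem _ (Submodule.sum_mem _ fun i hi => ?_)
    (Submodule.sum_mem _ fun i hi => ?_) <;>
  · rw [Finset.mem_range] at hi
    rw [TL.hom_mul, ← Hom.comp_assoc]
    exact diagramSpan_mono (fun d hd => Or.inr ⟨_, by omega, hd⟩) (comp_e_mem _ _)

/-- Sandwiching by the projectors kills the reducible diagrams and is the identity modulo their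
span. A fusion multiplicity thus becomes a number of diagrams. -/
theorem homRank_jw (hδ : IsGeneric δ) {a b m n : ℕ} (h : a + b = n) :
    homRank (jwHom δ m) (juxtHom h h (jwHom δ a) (jwHom δ b)) =
      Nat.card {d : Diagram m n // ¬ d.IsReducible a} := by
  refine finrank_range_of_sub_mem _ (fun d hd => ?_) (fun x => ?_)
  · rw [LinearMap.comp_apply, LinearMap.flip_apply]
    rcases hd with hd | ⟨i, hi, hd⟩
    · rw [jw_comp_of hδ hd, map_zero, LinearMap.zero_apply]
    · have h1 := congrArg TL.hom (e_mul_juxtLin_jw hδ h hi)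
      rw [TL.hom_mul, hom_juxtLin, hom_jw, hom_jw, map_zero] at h1
      rw [Hom.comp_assoc, Hom.of_eq_comp_gen hδ.ne_zero hd, map_smul, LinearMap.smul_apply,
        Hom.comp_assoc, h1, map_zero, smul_zero, map_zero]
  · rw [LinearMap.comp_apply, LinearMap.flip_apply]
    have h1 := comp_juxtHom_jw_sub_mem h x
    -- The projectors are removed one at a time: the upper one up to upper arcs, then the lower ones
    -- up to arcs inside a part.
    have h2 : jwHom δ m ⬝ x ⬝ juxtHom h h (jwHom δ a) (jwHom δ b) - x =
        (jwHom δ m ⬝ x - x) ⬝ juxtHom h h (jwHom δ a) (jwHom δ b) +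
          (x ⬝ juxtHom h h (jwHom δ a) (jwHom δ b) - x) := by
      rw [map_sub, LinearMap.sub_apply]
      abel
    rw [h2]
    refine Submodule.add_mem _ ?_ h1
    exact comp_mem_left (P := Diagram.HasTopCup) (fun d e hd => Or.inl (hd.comp e))
      (jw_comp_sub_mem x) _

/-- The only adjacent arc allowed is the lower one across the cut. As one part has at most one
point, that arc sits at an end of the row and no other arc fits around it. There remain the identity
and a single arc. -/
theorem card_not_isReducible {a b m n : ℕ} (h : a + b = n) (hab : a ≤ 1 ∨ b ≤ 1) :
    Nat.card {d : Diagram m n // ¬ d.IsReducible a} =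
      (if m = n then 1 else 0) + if m + 2 = n ∧ 1 ≤ a ∧ 1 ≤ b then 1 else 0 := by
  have key : ∀ d : Diagram m n, ¬ d.IsReducible a →
      (m = n ∧ ∀ hmn : n = m, d = hmn ▸ Diagram.ident n) ∨
      (1 ≤ a ∧ 1 ≤ b ∧ d.HasCapAt (a - 1)) := by
    intro d hd
    rw [Diagram.IsReducible, not_or] at hd
    obtain ⟨h1, h2⟩ := hd
    by_cases h3 : ∃ i, d.HasCapAt i
    · obtain ⟨i, hi⟩ := h3
      have h4 : i + 1 = a := by
        by_contra h4
        exact h2 ⟨i, h4, hi⟩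
      obtain rfl : i = a - 1 := by omega
      have := hi.1
      exact Or.inr ⟨by omega, by omega, hi⟩
    · exact Or.inl (Diagram.eq_ident h1 (not_exists.1 h3))
  have hcap : ∀ d : Diagram m n, ¬ d.IsReducible a → ∀ i, d.HasCapAt i → i = a - 1 := by
    intro d hd i hi
    by_contra h1
    exact hd (Or.inr ⟨i, by omega, hi⟩)
  by_cases hmn : m = n
  · subst hmn
    rw [if_pos rfl, if_neg (by omega), Nat.card_eq_one_iff_unique]
    refine ⟨⟨fun d d' => Subtype.ext ?_⟩, ⟨⟨Diagram.ident m, ?_⟩⟩⟩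
    · have : ∀ d : Diagram m m, ¬ d.IsReducible a → d = Diagram.ident m := by
        intro d hd
        rcases key d hd with h1 | ⟨h1, h2, h3⟩
        · exact h1.2 rfl
        · obtain ⟨k, rfl⟩ : ∃ k, m = k + 2 := ⟨m - 2, by omega⟩
          have h4 := Diagram.eq_capBot (by omega) (fun h => hd (Or.inl h)) (hcap d hd) h3
          omega
      rw [this _ d.2, this _ d'.2]
    · rintro (h1 | ⟨i, -, h1⟩)
      · exact Diagram.ident_not_hasTopCup m h1
      · exact Diagram.ident_not_hasCapAt m i h1
  rw [if_neg hmn, zero_add]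
  by_cases h1 : m + 2 = n ∧ 1 ≤ a ∧ 1 ≤ b
  · obtain ⟨rfl, ha, hb⟩ := h1
    rw [if_pos ⟨rfl, ha, hb⟩, Nat.card_eq_one_iff_unique]
    refine ⟨⟨fun d d' => Subtype.ext ?_⟩, ⟨⟨Diagram.capBot m (a - 1) (by omega), ?_⟩⟩⟩
    · have : ∀ d : Diagram m (m + 2), ¬ d.IsReducible a →
          d = Diagram.capBot m (a - 1) (by omega) := by
        intro d hd
        rcases key d hd with h1 | ⟨-, -, h3⟩
        · exact absurd h1.1 hmn
        · exact (Diagram.eq_capBot (by omega) (fun h => hd (Or.inl h)) (hcap d hd) h3).2 rfl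
      rw [this _ d.2, this _ d'.2]
    · rintro (h1 | ⟨i, hi, h1⟩)
      · exact Diagram.capBot_not_hasTopCup _ h1
      · rw [Diagram.capBot_hasCapAt] at h1
        omega
  · rw [if_neg h1, Nat.card_eq_zero]
    refine Or.inl ⟨fun d => ?_⟩
    rcases key d.1 d.2 with h2 | ⟨h2, h3, h4⟩
    · exact hmn h2.1
    · obtain ⟨d, hd⟩ := d
      obtain ⟨k, rfl⟩ : ∃ k, n = k + 2 := ⟨n - 2, by omega⟩
      have h5 := Diagram.eq_capBot (by omega) (fun h => hd (Or.inl h)) (hcap d hd) h4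
      omega

/-- This is the Clebsch–Gordan rule for the widths `m - 2q` and `n - 2r`, one of which is at most
one. The extra arc needs a string on both sides of the cut, which is the condition on `q` and `r`.
-/
theorem cornerRank_rho (hδ : IsGeneric δ) {m n k p q r : ℕ} (h : m + n = k)
    (hmn : m ≤ 1 ∨ n ≤ 1) (hp : 2 * p ≤ k) (hq : 2 * q ≤ m) (hr : 2 * r ≤ n) :
    cornerRank K (simpleIdem δ k p) (rho h (simpleIdem δ m q ⊗ₜ simpleIdem δ n r)) =
      (if p = q + r then 1 else 0) +
        if p = q + r + 1 ∧ 2 * q < m ∧ 2 * r < n then 1 else 0 := by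
  obtain ⟨u, v, h1, h2⟩ := simpleIdem_spec hδ.ne_zero (show k - 2 * p + 2 * p = k by omega)
  obtain ⟨u', v', h1', h2'⟩ := simpleIdem_spec hδ.ne_zero (show m - 2 * q + 2 * q = m by omega)
  obtain ⟨u'', v'', h1'', h2''⟩ :=
    simpleIdem_spec hδ.ne_zero (show n - 2 * r + 2 * r = n by omega)
  have hM : m - 2 * q + (n - 2 * r) = k - 2 * (q + r) := by omega
  have h3 : TL.hom (rho h (simpleIdem δ m q ⊗ₜ simpleIdem δ n r)) =
      juxtHom h hM u' u'' ⬝ juxtHom hM hM (jwHom δ _) (jwHom δ _) ⬝ juxtHom hM h v' v'' := by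
    rw [← juxtHom_comp, ← juxtHom_comp, ← h2', ← h2'', ← hom_juxtLin]
    rfl
  have h4 : juxtHom hM h v' v'' ⬝ juxtHom h hM u' u'' = Hom.of (Diagram.ident _) := by
    rw [← juxtHom_comp, h1', h1'', juxtHom_of, Diagram.juxt_ident]
  rw [cornerRank_eq_homRank, h2, h3, homRank_retract h1 h4, homRank_jw hδ hM,
    card_not_isReducible hM (by omega)]
  congr 1
  · exact if_congr (by omega) rfl rfl
  · exact if_congr (by omega) rfl rfl

end Fusion

end TemperleyLieb

namespace TemperleyLieb

/-! ### Induction and restriction of cell modules -/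

theorem G0.induction {K A : Type u} [Field K] [Ring A] [Algebra K A] {P : G0 K A → Prop}
    (hcls : ∀ M, P (cls M)) (hadd : ∀ x y, P x → P y → P (x + y)) (hneg : ∀ x, P x → P (-x))
    (hzero : P 0) (x : G0 K A) : P x := by
  obtain ⟨x, rfl⟩ := QuotientAddGroup.mk_surjective x
  induction x using FreeAbelianGroup.induction_on with
  | zero => exact hzero
  | of M => exact hcls M
  | neg M h => exact hneg _ h
  | add x y hx hy => exact hadd _ _ hx hy

theorem G0.tensor_induction {K A B : Type u} [Field K] [Ring A] [Algebra K A] [Ring B]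
    [Algebra K B] {P : G0 K A ⊗[ℤ] G0 K B → Prop} (hcls : ∀ M N, P (cls M ⊗ₜ cls N))
    (hadd : ∀ x y, P x → P y → P (x + y)) (hneg : ∀ x, P x → P (-x)) (hzero : P 0)
    (x : G0 K A ⊗[ℤ] G0 K B) : P x := by
  induction x with
  | zero => exact hzero
  | add x y hx hy => exact hadd x y hx hy
  | tmul x y =>
    induction x using G0.induction with
    | hzero => rwa [TensorProduct.zero_tmul]
    | hadd x x' hx hx' => rw [TensorProduct.add_tmul]; exact hadd _ _ hx hx'
    | hneg x hx => rw [TensorProduct.neg_tmul]; exact hneg _ hx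
    | hcls M =>
      induction y using G0.induction with
      | hzero => rwa [TensorProduct.tmul_zero]
      | hadd x x' hx hx' => rw [TensorProduct.tmul_add]; exact hadd _ _ hx hx'
      | hneg x hx => rw [TensorProduct.tmul_neg]; exact hneg _ hx
      | hcls N => exact hcls M N

section Branching

variable {K : Type u} [Field K] {δ : K}

theorem rankAt_cell' (hδ : IsGeneric δ) {n : ℕ} (p : Fin (n / 2 + 1)) (r : ℕ) :
    (cell δ n r).rankAt (simpleIdem δ n p) = if p = r then 1 else 0 := by
  by_cases hr : 2 * r ≤ n
  · exact rankAt_cell hδ (by omega) hr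
  · have h := congrArg (G0.rankAt _ ((isSplit_TL hδ n).idem p))
      (cls_cell_eq_zero (δ := δ) (not_le.1 hr))
    rw [G0.rankAt_cls, map_zero] at h
    rw [if_neg (by omega)]
    exact_mod_cast h

/-- Induction along `ρ`, as a product on Grothendieck groups. -/
noncomputable def indMul (hδ : IsGeneric δ) {m n k : ℕ} (h : m + n = k) :
    FromTensor ℤ (G0 K (TL δ m)) (G0 K (TL δ n)) (G0 K (TL δ k)) :=
  (G0.ind ((isSplit_TL hδ m).tensor (isSplit_TL hδ n)) (rho h)).toIntLinearMap ∘ₗ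
    G0.tensor K (TL δ m) (TL δ n)

theorem indMul_cls (hδ : IsGeneric δ) {m n k : ℕ} (h : m + n = k) (M : FDModule K (TL δ m))
    (N : FDModule K (TL δ n)) :
    indMul hδ h (cls M ⊗ₜ cls N) = cls ((M.tensor N).ind (rho h)) := by
  rw [indMul, LinearMap.comp_apply, G0.tensor_cls, AddMonoidHom.coe_toIntLinearMap, G0.ind_cls]

/-- Induction along `twistedRho`. -/
noncomputable def indTwist (hδ : IsGeneric δ) {t t' s s' k l : ℕ} (hk : t + s = k)
    (hl : t' + s' = l) : FromTensor ℤ (G0 K (TL δ t ⊗[K] TL δ t')) (G0 K (TL δ s ⊗[K] TL δ s'))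
      (G0 K (TL δ k ⊗[K] TL δ l)) :=
  (G0.ind (((isSplit_TL hδ t).tensor (isSplit_TL hδ t')).tensor
    ((isSplit_TL hδ s).tensor (isSplit_TL hδ s'))) (twistedRho hk hl)).toIntLinearMap ∘ₗ
    G0.tensor K (TL δ t ⊗[K] TL δ t') (TL δ s ⊗[K] TL δ s')

theorem indTwist_cls (hδ : IsGeneric δ) {t t' s s' k l : ℕ} (hk : t + s = k) (hl : t' + s' = l)
    (M : FDModule K (TL δ t ⊗[K] TL δ t')) (N : FDModule K (TL δ s ⊗[K] TL δ s')) :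
    indTwist hδ hk hl (cls M ⊗ₜ cls N) = cls ((M.tensor N).ind (twistedRho hk hl)) := by
  rw [indTwist, LinearMap.comp_apply, G0.tensor_cls, AddMonoidHom.coe_toIntLinearMap, G0.ind_cls]

/-- On ranks, both sides are the same sum over four indices, as corner ranks are multiplicative on
tensor products; only the order of the indices differs. -/
theorem cls_ind_twistedRho (hδ : IsGeneric δ) {t t' s s' k l : ℕ} (hk : t + s = k)
    (hl : t' + s' = l) (M : FDModule K (TL δ t)) (M' : FDModule K (TL δ t'))
    (N : FDModule K (TL δ s)) (N' : FDModule K (TL δ s')) :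
    cls (((M.tensor M').tensor (N.tensor N')).ind (twistedRho hk hl)) =
      cls (((M.tensor N).ind (rho hk)).tensor ((M'.tensor N').ind (rho hl))) := by
  refine ((isSplit_TL hδ k).tensor (isSplit_TL hδ l)).cls_ext fun i => ?_
  rw [rankAt_ind (((isSplit_TL hδ t).tensor (isSplit_TL hδ t')).tensor
    ((isSplit_TL hδ s).tensor (isSplit_TL hδ s'))) _ _
    (((isSplit_TL hδ k).tensor (isSplit_TL hδ l)).idem i), rankAt_tensor,
    rankAt_ind ((isSplit_TL hδ t).tensor (isSplit_TL hδ s)) _ _ ((isSplit_TL hδ k).idem i.1),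
    rankAt_ind ((isSplit_TL hδ t').tensor (isSplit_TL hδ s')) _ _ ((isSplit_TL hδ l).idem i.2),
    Finset.sum_mul_sum, ← Fintype.sum_prod_type']
  refine Fintype.sum_equiv (Equiv.prodProdProdComm _ _ _ _) _ _ fun j => ?_
  simp only [rankAt_tensor, twistedRho_tmul, cornerRank_tmul, Equiv.prodProdProdComm_apply]
  ring

/-- The twisted induction is the product of `G₀ ⊗ G₀` in disguise. This serves both to evaluate the
right side of the identity and to recognize it in `Δ(x)Δ(y)`. -/
theorem indTwist_tensor (hδ : IsGeneric δ) {t t' s s' k l : ℕ} (hk : t + s = k)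
    (hl : t' + s' = l) (x : G0 K (TL δ t) ⊗[ℤ] G0 K (TL δ t'))
    (y : G0 K (TL δ s) ⊗[ℤ] G0 K (TL δ s')) :
    indTwist hδ hk hl (G0.tensor K _ _ x ⊗ₜ G0.tensor K _ _ y) =
      G0.tensor K _ _ (TensorProduct.map (indMul hδ hk) (indMul hδ hl)
        (TensorProduct.tensorTensorTensorComm ℤ _ _ _ _ (x ⊗ₜ y))) := by
  induction x using G0.tensor_induction with
  | hzero => simp only [map_zero, TensorProduct.zero_tmul]
  | hadd x x' hx hx' => simp only [map_add, TensorProduct.add_tmul, hx, hx']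
  | hneg x hx => simp only [map_neg, TensorProduct.neg_tmul, hx]
  | hcls M M' =>
    induction y using G0.tensor_induction with
    | hzero => simp only [map_zero, TensorProduct.tmul_zero]
    | hadd x x' hx hx' => simp only [map_add, TensorProduct.tmul_add, hx, hx']
    | hneg x hx => simp only [map_neg, TensorProduct.tmul_neg, hx]
    | hcls N N' =>
      rw [TensorProduct.tensorTensorTensorComm_tmul, TensorProduct.map_tmul, G0.tensor_cls,
        G0.tensor_cls, indTwist_cls, indMul_cls, indMul_cls, G0.tensor_cls, cls_ind_twistedRho hδ]

/-- The cell modules are dual to the idempotents, so one term of `rankAt_ind` remains, and it is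
given by the fusion rule. -/
theorem cls_ind_cell (hδ : IsGeneric δ) {m n k q r : ℕ} (h : m + n = k) (hmn : m ≤ 1 ∨ n ≤ 1)
    (hq : 2 * q ≤ m) (hr : 2 * r ≤ n) :
    cls (((cell δ m q).tensor (cell δ n r)).ind (rho h)) = cls (cell δ k (q + r)) +
      if 2 * q < m ∧ 2 * r < n then cls (cell δ k (q + r + 1)) else 0 := by
  refine (isSplit_TL hδ k).ext fun i => ?_
  have h1 : (((cell δ m q).tensor (cell δ n r)).ind (rho h)).rankAt (simpleIdem δ k i) =
      (if (i : ℕ) = q + r then 1 else 0) +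
        if (i : ℕ) = q + r + 1 ∧ 2 * q < m ∧ 2 * r < n then 1 else 0 := by
    rw [rankAt_ind ((isSplit_TL hδ m).tensor (isSplit_TL hδ n)) _ _ ((isSplit_TL hδ k).idem i),
      Fintype.sum_eq_single (⟨q, by omega⟩, ⟨r, by omega⟩), rankAt_tensor, rankAt_cell' hδ,
      rankAt_cell' hδ, if_pos rfl, if_pos rfl, one_mul, one_mul,
      cornerRank_rho hδ h hmn (by omega) hq hr]
    rintro ⟨a, b⟩ hab
    rw [rankAt_tensor, rankAt_cell' hδ, rankAt_cell' hδ]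
    by_cases ha : (a : ℕ) = q
    · rw [if_neg (c := (b : ℕ) = r), mul_zero, zero_mul]
      exact fun hb => hab (Prod.ext (Fin.ext ha) (Fin.ext hb))
    · rw [if_neg ha, zero_mul, zero_mul]
  rw [map_add, G0.rankAt_cls, G0.rankAt_cls, h1, rankAt_cell' hδ]
  by_cases h2 : 2 * q < m ∧ 2 * r < n
  · simp only [h2, and_self, and_true, if_true, G0.rankAt_cls, rankAt_cell' hδ]
    push_cast
    rfl
  · simp only [h2, and_false, if_false, map_zero, add_zero]

/-- By `rankAt_eq_sum` the multiplicities of a restriction are the fusion numbers of induction, read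
with `p` fixed. -/
theorem rankAt_res_cell (hδ : IsGeneric δ) {m n k p : ℕ} (h : m + n = k) (hmn : m ≤ 1 ∨ n ≤ 1)
    (hp : 2 * p ≤ k) (i : Fin (m / 2 + 1) × Fin (n / 2 + 1)) :
    ((cell δ k p).res (rho h)).rankAt (simpleIdem δ m i.1 ⊗ₜ simpleIdem δ n i.2) =
      (if p = i.1 + i.2 then 1 else 0) +
        if p = i.1 + i.2 + 1 ∧ 2 * (i.1 : ℕ) < m ∧ 2 * (i.2 : ℕ) < n then 1 else 0 := by
  have he : IsIdempotentElem (rho h (simpleIdem δ m i.1 ⊗ₜ simpleIdem δ n i.2) : TL δ k) :=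
    (((isSplit_TL hδ m).tensor (isSplit_TL hδ n)).idem i).map (rho h)
  rw [rankAt_res, rankAt_eq_sum (isSplit_TL hδ k) _ he, Fintype.sum_eq_single ⟨p, by omega⟩,
    rankAt_cell' hδ, if_pos rfl, one_mul,
    cornerRank_rho hδ h hmn (by omega) (by omega) (by omega)]
  intro a ha
  rw [rankAt_cell' hδ, if_neg (fun h => ha (Fin.ext h)), zero_mul]

theorem cls_res_cell_left (hδ : IsGeneric δ) {a n k p : ℕ} (h : a + n = k) (ha : a ≤ 1)
    (hp : 2 * p ≤ k) :
    cls ((cell δ k p).res (rho h)) = cls ((cell δ a 0).tensor (cell δ n p)) +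
      if a = 1 ∧ 1 ≤ p then cls ((cell δ a 0).tensor (cell δ n (p - 1))) else 0 := by
  refine ((isSplit_TL hδ a).tensor (isSplit_TL hδ n)).ext fun i => ?_
  have h1 : (i.1 : ℕ) = 0 := by omega
  rw [map_add, G0.rankAt_cls, G0.rankAt_cls, rankAt_res_cell hδ h (Or.inl ha) hp, rankAt_tensor,
    rankAt_cell' hδ, rankAt_cell' hδ]
  by_cases h2 : a = 1 ∧ 1 ≤ p
  · rw [if_pos h2, G0.rankAt_cls, rankAt_tensor, rankAt_cell' hδ, rankAt_cell' hδ]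
    have := i.2.2
    split_ifs <;> first | rfl | omega
  · rw [if_neg h2, map_zero]
    split_ifs <;> first | rfl | omega

theorem cls_res_cell_right (hδ : IsGeneric δ) {a n k p : ℕ} (h : n + a = k) (ha : a ≤ 1)
    (hp : 2 * p ≤ k) :
    cls ((cell δ k p).res (rho h)) = cls ((cell δ n p).tensor (cell δ a 0)) +
      if a = 1 ∧ 1 ≤ p then cls ((cell δ n (p - 1)).tensor (cell δ a 0)) else 0 := by
  refine ((isSplit_TL hδ n).tensor (isSplit_TL hδ a)).ext fun i => ?_
  have h1 : (i.2 : ℕ) = 0 := by omega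
  rw [map_add, G0.rankAt_cls, G0.rankAt_cls, rankAt_res_cell hδ h (Or.inr ha) hp, rankAt_tensor,
    rankAt_cell' hδ, rankAt_cell' hδ]
  by_cases h2 : a = 1 ∧ 1 ≤ p
  · rw [if_pos h2, G0.rankAt_cls, rankAt_tensor, rankAt_cell' hδ, rankAt_cell' hδ]
    have := i.1.2
    split_ifs <;> first | rfl | omega
  · rw [if_neg h2, map_zero]
    split_ifs <;> first | rfl | omega

theorem indMul_cell_one (hδ : IsGeneric δ) {n k p : ℕ} (h : n + 1 = k) (hp : 2 * p ≤ n) :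
    indMul hδ h (cls (cell δ n p) ⊗ₜ cls (cell δ 1 0)) =
      cls (cell δ k p) + cls (cell δ k (p + 1)) := by
  rw [indMul_cls, cls_ind_cell hδ h (Or.inr le_rfl) hp (by omega), add_zero]
  by_cases h1 : 2 * p < n
  · rw [if_pos ⟨h1, by omega⟩]
  -- For `2 p = n` the second summand vanishes because `2 (p + 1) > n + 1`, so the formula stays
  -- uniform.
  · rw [if_neg (fun h => h1 h.1), cls_cell_eq_zero (r := p + 1) (by omega)]

theorem indMul_cell_zero (hδ : IsGeneric δ) {n k p : ℕ} (h : n + 0 = k) (hp : 2 * p ≤ n) :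
    indMul hδ h (cls (cell δ n p) ⊗ₜ cls (cell δ 0 0)) = cls (cell δ k p) := by
  rw [indMul_cls, cls_ind_cell hδ h (Or.inr zero_le_one) hp (by omega),
    if_neg (fun h => absurd h.2 (by omega)), add_zero, add_zero]

theorem indMul_zero_cell (hδ : IsGeneric δ) {n k p : ℕ} (h : 0 + n = k) (hp : 2 * p ≤ n) :
    indMul hδ h (cls (cell δ 0 0) ⊗ₜ cls (cell δ n p)) = cls (cell δ k p) := by
  rw [indMul_cls, cls_ind_cell hδ h (Or.inl zero_le_one) (by omega) hp,
    if_neg (fun h => absurd h.1 (by omega)), zero_add, add_zero]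

theorem mackeyLeft_eq (hδ : IsGeneric δ) {n k l p : ℕ} (h : k + l = n + 1) (hp : 2 * p ≤ n) :
    mackeyLeft h (cell δ n p) (cell δ 1 0) =
      G0.res (rho h) (cls (cell δ (n + 1) p)) + G0.res (rho h) (cls (cell δ (n + 1) (p + 1))) := by
  rw [mackeyLeft, ← G0.res_cls, ← indMul_cls hδ, indMul_cell_one hδ _ hp, map_add]

/-- Induction gives `Δ_{n+1}(p)` and `Δ_{n+1}(p+1)`, and the restriction of each contains `Δ_n(p)`
once; the second one is zero for `2 p = n`. -/
theorem mackeyLeft_one (hδ : IsGeneric δ) {n p : ℕ} (hp1 : 1 ≤ p) (hp : 2 * p ≤ n) :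
    mackeyLeft (Nat.add_comm 1 n) (cell δ n p) (cell δ 1 0) =
      cls ((cell δ 1 0).tensor (cell δ n p)) + cls ((cell δ 1 0).tensor (cell δ n (p - 1))) +
        if 2 * p < n then cls ((cell δ 1 0).tensor (cell δ n (p + 1))) +
          cls ((cell δ 1 0).tensor (cell δ n p)) else 0 := by
  rw [mackeyLeft_eq hδ _ hp, G0.res_cls, cls_res_cell_left hδ _ le_rfl (by omega),
    if_pos ⟨rfl, hp1⟩]
  congr 1
  by_cases h : 2 * p < n
  · rw [if_pos h, G0.res_cls, cls_res_cell_left hδ _ le_rfl (by omega), if_pos ⟨rfl, by omega⟩,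
      Nat.add_sub_cancel]
  · rw [if_neg h, cls_cell_eq_zero (by omega), map_zero]

theorem mackeyLeft_last (hδ : IsGeneric δ) {n p : ℕ} (hp1 : 1 ≤ p) (hp : 2 * p ≤ n) :
    mackeyLeft (rfl : n + 1 = n + 1) (cell δ n p) (cell δ 1 0) =
      cls ((cell δ n p).tensor (cell δ 1 0)) + cls ((cell δ n (p - 1)).tensor (cell δ 1 0)) +
        if 2 * p < n then cls ((cell δ n (p + 1)).tensor (cell δ 1 0)) +
          cls ((cell δ n p).tensor (cell δ 1 0)) else 0 := by
  rw [mackeyLeft_eq hδ _ hp, G0.res_cls, cls_res_cell_right hδ _ le_rfl (by omega),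
    if_pos ⟨rfl, hp1⟩]
  congr 1
  by_cases h : 2 * p < n
  · rw [if_pos h, G0.res_cls, cls_res_cell_right hδ _ le_rfl (by omega), if_pos ⟨rfl, by omega⟩,
      Nat.add_sub_cancel]
  · rw [if_neg h, cls_cell_eq_zero (by omega), map_zero]

/-- One of the summands of `mackeyRight`. -/
noncomputable def mackeyTerm {m n t t' s s' k l : ℕ} (ht : t + t' = m) (hs : s + s' = n)
    (hk : t + s = k) (hl : t' + s' = l) (M : FDModule K (TL δ m)) (N : FDModule K (TL δ n)) :
    G0 K (TL δ k ⊗[K] TL δ l) :=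
  cls (((M.res (rho ht)).tensor (N.res (rho hs))).ind (twistedRho hk hl))

theorem mackeyRight_eq_add {m n t t' s s' v v' w w' k l : ℕ} (h : k + l = m + n) (ht : t + t' = m)
    (hs : s + s' = n) (hk : t + s = k) (hl : t' + s' = l) (hv : v + v' = m) (hw : w + w' = n)
    (hk' : v + w = k) (hl' : v' + w' = l) (htv : t ≠ v)
    (H : ∀ a b, a ≤ m → b ≤ n → a + b = k → a = t ∨ a = v) (M : FDModule K (TL δ m))
    (N : FDModule K (TL δ n)) :
    mackeyRight h M N = mackeyTerm ht hs hk hl M N + mackeyTerm hv hw hk' hl' M N := by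
  obtain rfl : t' = m - t := by omega
  obtain rfl : s' = n - s := by omega
  obtain rfl : v' = m - v := by omega
  obtain rfl : w' = n - w := by omega
  rw [mackeyRight, ← Fintype.sum_prod_type', Fintype.sum_eq_add
    ((⟨t, by omega⟩, ⟨s, by omega⟩) : Fin (m + 1) × Fin (n + 1)) (⟨v, by omega⟩, ⟨w, by omega⟩)]
  · rw [dif_pos hk, dif_pos hk']
    rfl
  · intro h1
    exact htv (congrArg (fun x => (x.1 : ℕ)) h1)
  · rintro ⟨a, b⟩ ⟨h1, h2⟩
    refine dif_neg fun hab => ?_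
    change (a : ℕ) + b = k at hab
    rcases H a b (by omega) (by omega) hab with h3 | h3
    · exact h1 (Prod.ext (Fin.ext h3) (Fin.ext (by change (b : ℕ) = s; omega)))
    · exact h2 (Prod.ext (Fin.ext h3) (Fin.ext (by change (b : ℕ) = w; omega)))

theorem mackeyTerm_eq (hδ : IsGeneric δ) {m n t t' s s' k l : ℕ} (ht : t + t' = m)
    (hs : s + s' = n) (hk : t + s = k) (hl : t' + s' = l) {M : FDModule K (TL δ m)}
    {N : FDModule K (TL δ n)} {x : G0 K (TL δ t) ⊗[ℤ] G0 K (TL δ t')}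
    {y : G0 K (TL δ s) ⊗[ℤ] G0 K (TL δ s')} (hx : cls (M.res (rho ht)) = G0.tensor K _ _ x)
    (hy : cls (N.res (rho hs)) = G0.tensor K _ _ y) :
    mackeyTerm ht hs hk hl M N = G0.tensor K _ _ (TensorProduct.map (indMul hδ hk) (indMul hδ hl)
      (TensorProduct.tensorTensorTensorComm ℤ _ _ _ _ (x ⊗ₜ y))) := by
  rw [mackeyTerm, ← indTwist_cls hδ, hx, hy, indTwist_tensor]

/-- The pair `t = 1`, `s = 0` removes a string from `M` and adds the one of `N`, and for `p ≥ 1` it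
reproduces the left side. The pair `t = 0`, `s = 1` leaves `M` whole and is the surplus term. -/
theorem mackeyRight_one (hδ : IsGeneric δ) {n p : ℕ} (hp1 : 1 ≤ p) (hp : 2 * p ≤ n) :
    mackeyRight (Nat.add_comm 1 n) (cell δ n p) (cell δ 1 0) =
      mackeyLeft (Nat.add_comm 1 n) (cell δ n p) (cell δ 1 0) +
        cls ((cell δ 1 0).tensor (cell δ n p)) := by
  obtain ⟨m, rfl⟩ : ∃ m, n = m + 1 := ⟨n - 1, by omega⟩
  have h0 : cls ((cell δ 1 0).res (rho (add_zero 1))) =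
      G0.tensor K _ _ (cls (cell δ 1 0) ⊗ₜ cls (cell δ 0 0)) := by
    rw [cls_res_cell_right hδ _ zero_le_one (by omega), if_neg (by omega), add_zero, G0.tensor_cls]
  have h1 : cls ((cell δ 1 0).res (rho (zero_add 1))) =
      G0.tensor K _ _ (cls (cell δ 0 0) ⊗ₜ cls (cell δ 1 0)) := by
    rw [cls_res_cell_left hδ _ zero_le_one (by omega), if_neg (by omega), add_zero, G0.tensor_cls]
  have h2 : cls ((cell δ (m + 1) p).res (rho (zero_add (m + 1)))) =
      G0.tensor K _ _ (cls (cell δ 0 0) ⊗ₜ cls (cell δ (m + 1) p)) := by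
    rw [cls_res_cell_left hδ _ zero_le_one hp, if_neg (by omega), add_zero, G0.tensor_cls]
  have h3 : cls ((cell δ (m + 1) p).res (rho (Nat.add_comm 1 m))) =
      G0.tensor K _ _ (cls (cell δ 1 0) ⊗ₜ (cls (cell δ m p) + cls (cell δ m (p - 1)))) := by
    rw [cls_res_cell_left hδ _ le_rfl hp, if_pos ⟨rfl, hp1⟩, TensorProduct.tmul_add, map_add,
      G0.tensor_cls, G0.tensor_cls]
  rw [mackeyRight_eq_add (Nat.add_comm 1 (m + 1)) (zero_add (m + 1)) (add_zero 1) (zero_add 1)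
    (add_zero (m + 1)) (Nat.add_comm 1 m) (zero_add 1) (add_zero 1) rfl zero_ne_one
    (fun a b _ _ _ => by omega), mackeyTerm_eq hδ _ _ _ _ h2 h0, mackeyTerm_eq hδ _ _ _ _ h3 h1,
    TensorProduct.tensorTensorTensorComm_tmul, TensorProduct.tensorTensorTensorComm_tmul,
    TensorProduct.map_tmul, TensorProduct.map_tmul, TensorProduct.add_tmul, map_add,
    indMul_zero_cell hδ _ (by omega), indMul_cell_zero hδ _ hp, indMul_cell_zero hδ _ (by omega),
    indMul_cell_one hδ _ (show 2 * (p - 1) ≤ m by omega), Nat.sub_add_cancel hp1,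
    mackeyLeft_one hδ hp1 hp]
  by_cases h : 2 * p < m + 1
  · rw [indMul_cell_one hδ _ (by omega), if_pos h]
    simp only [TensorProduct.tmul_add, map_add, G0.tensor_cls]
    abel
  -- For `2 p = m + 1` the module `Δ_m(p)` is zero, just as the conditional part of the left side is
  -- absent.
  · rw [cls_cell_eq_zero (show m < 2 * p by omega), if_neg h, TensorProduct.zero_tmul, map_zero]
    simp only [TensorProduct.tmul_add, map_add, G0.tensor_cls, zero_add]
    abel

theorem mackeyRight_last (hδ : IsGeneric δ) {n p : ℕ} (hp1 : 1 ≤ p) (hp : 2 * p ≤ n) :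
    mackeyRight (rfl : n + 1 = n + 1) (cell δ n p) (cell δ 1 0) =
      mackeyLeft (rfl : n + 1 = n + 1) (cell δ n p) (cell δ 1 0) +
        cls ((cell δ n p).tensor (cell δ 1 0)) := by
  obtain ⟨m, rfl⟩ : ∃ m, n = m + 1 := ⟨n - 1, by omega⟩
  have h0 : cls ((cell δ 1 0).res (rho (add_zero 1))) =
      G0.tensor K _ _ (cls (cell δ 1 0) ⊗ₜ cls (cell δ 0 0)) := by
    rw [cls_res_cell_right hδ _ zero_le_one (by omega), if_neg (by omega), add_zero, G0.tensor_cls]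
  have h1 : cls ((cell δ 1 0).res (rho (zero_add 1))) =
      G0.tensor K _ _ (cls (cell δ 0 0) ⊗ₜ cls (cell δ 1 0)) := by
    rw [cls_res_cell_left hδ _ zero_le_one (by omega), if_neg (by omega), add_zero, G0.tensor_cls]
  have h2 : cls ((cell δ (m + 1) p).res (rho (add_zero (m + 1)))) =
      G0.tensor K _ _ (cls (cell δ (m + 1) p) ⊗ₜ cls (cell δ 0 0)) := by
    rw [cls_res_cell_right hδ _ zero_le_one hp, if_neg (by omega), add_zero, G0.tensor_cls]
  have h3 : cls ((cell δ (m + 1) p).res (rho rfl)) =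
      G0.tensor K _ _ ((cls (cell δ m p) + cls (cell δ m (p - 1))) ⊗ₜ cls (cell δ 1 0)) := by
    rw [cls_res_cell_right hδ _ le_rfl hp, if_pos ⟨rfl, hp1⟩, TensorProduct.add_tmul, map_add,
      G0.tensor_cls, G0.tensor_cls]
  rw [mackeyRight_eq_add rfl (add_zero (m + 1)) (zero_add 1) (add_zero (m + 1))
    (zero_add 1) rfl (add_zero 1) rfl (add_zero 1) (Nat.succ_ne_self m)
    (fun a b _ _ _ => by omega), mackeyTerm_eq hδ _ _ _ _ h2 h1, mackeyTerm_eq hδ _ _ _ _ h3 h0,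
    TensorProduct.tensorTensorTensorComm_tmul, TensorProduct.tensorTensorTensorComm_tmul,
    TensorProduct.map_tmul, TensorProduct.map_tmul, TensorProduct.add_tmul, map_add,
    indMul_zero_cell hδ _ (by omega), indMul_cell_zero hδ _ hp, indMul_cell_zero hδ _ (by omega),
    indMul_cell_one hδ _ (show 2 * (p - 1) ≤ m by omega), Nat.sub_add_cancel hp1,
    mackeyLeft_last hδ hp1 hp]
  by_cases h : 2 * p < m + 1
  · rw [indMul_cell_one hδ _ (by omega), if_pos h]
    simp only [TensorProduct.add_tmul, map_add, G0.tensor_cls]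
    abel
  · rw [cls_cell_eq_zero (show m < 2 * p by omega), if_neg h, TensorProduct.zero_tmul, map_zero]
    simp only [TensorProduct.add_tmul, map_add, G0.tensor_cls, zero_add]
    abel

/-- The idempotent `ε_p ⊗ ε_q` has rank one on this module, and ranks are defined on `G₀`. -/
theorem cls_cell_tensor_ne_zero (hδ : IsGeneric δ) {m n p q : ℕ} (hp : 2 * p ≤ m)
    (hq : 2 * q ≤ n) : cls ((cell δ m p).tensor (cell δ n q)) ≠ 0 := by
  intro h
  have h1 := congrArg (G0.rankAt _ (((isSplit_TL hδ m).tensor (isSplit_TL hδ n)).idem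
    (⟨p, by omega⟩, ⟨q, by omega⟩))) h
  rw [G0.rankAt_cls, map_zero, rankAt_tensor, rankAt_cell hδ hp hp, rankAt_cell hδ hq hq,
    if_pos rfl, if_pos rfl] at h1
  norm_num at h1

end Branching

end TemperleyLieb

namespace TemperleyLieb

/-! ### The operations on the Grothendieck group -/

section Components

variable {R : Type*} [CommRing R] {H : ℕ → Type*} [∀ n, AddCommGroup (H n)]
  [∀ n, Module R (H n)]

/-- The component of degree `(k, l)` of an element of `(⨁ n, H n) ⊗ (⨁ n, H n)`. -/
noncomputable def tensorComponent (R : Type*) [CommRing R] (H : ℕ → Type*)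
    [∀ n, AddCommGroup (H n)] [∀ n, Module R (H n)] (k l : ℕ) :
    (⨁ n, H n) ⊗[R] (⨁ n, H n) →ₗ[R] H k ⊗[R] H l :=
  TensorProduct.map (DirectSum.component R ℕ H k) (DirectSum.component R ℕ H l)

theorem tensorComponent_lof (k l : ℕ) (z : H k ⊗[R] H l) :
    tensorComponent R H k l
      (TensorProduct.map (DirectSum.lof R ℕ H k) (DirectSum.lof R ℕ H l) z) = z := by
  rw [tensorComponent, ← LinearMap.comp_apply, ← TensorProduct.map_comp]
  have h : ∀ k, DirectSum.component R ℕ H k ∘ₗ DirectSum.lof R ℕ H k = LinearMap.id := fun k =>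
    LinearMap.ext fun x => DirectSum.component.lof_self R k x
  rw [h, h, TensorProduct.map_id, LinearMap.id_apply]

theorem tensorComponent_lof_ne {k l k' l' : ℕ} (hk : k' ≠ k) (z : H k' ⊗[R] H l') :
    tensorComponent R H k l
      (TensorProduct.map (DirectSum.lof R ℕ H k') (DirectSum.lof R ℕ H l') z) = 0 := by
  rw [tensorComponent, ← LinearMap.comp_apply, ← TensorProduct.map_comp]
  have h : DirectSum.component R ℕ H k ∘ₗ DirectSum.lof R ℕ H k' = 0 := LinearMap.ext fun x => by
    rw [LinearMap.comp_apply, DirectSum.component.of, dif_neg hk, LinearMap.zero_apply]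
  rw [h, TensorProduct.map_zero_left, LinearMap.zero_apply]

theorem gradedMul_lof (i : ∀ m n : ℕ, FromTensor R (H m) (H n) (H (m + n))) {m n : ℕ}
    (x : H m) (y : H n) :
    gradedMul i (DirectSum.lof R ℕ H m x ⊗ₜ DirectSum.lof R ℕ H n y) =
      DirectSum.lof R ℕ H (m + n) (i m n (x ⊗ₜ y)) := by
  rw [gradedMul, LinearMap.comp_apply, LinearEquiv.coe_coe,
    TensorProduct.directSum_lof_tmul_lof, DirectSum.toModule_lof]
  rfl

theorem gradedComul_lof (r : ∀ k l n : ℕ, k + l = n → ToTensor R (H n) (H k) (H l)) {n : ℕ}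
    (x : H n) : gradedComul r (DirectSum.lof R ℕ H n x) = ∑ k : Fin (n + 1),
      TensorProduct.map (DirectSum.lof R ℕ H k) (DirectSum.lof R ℕ H (n - k))
        (r k (n - k) n (show (k : ℕ) + (n - k) = n by omega) x) := by
  rw [gradedComul, DirectSum.toModule_lof, LinearMap.sum_apply]
  rfl

theorem tensorComponent_gradedComul (r : ∀ k l n : ℕ, k + l = n → ToTensor R (H n) (H k) (H l))
    {k l n : ℕ} (h : k + l = n) (x : H n) :
    tensorComponent R H k l (gradedComul r (DirectSum.lof R ℕ H n x)) = r k l n h x := by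
  obtain rfl : l = n - k := by omega
  rw [gradedComul_lof, map_sum, Fintype.sum_eq_single ⟨k, by omega⟩, tensorComponent_lof]
  intro t ht
  exact tensorComponent_lof_ne (fun h => ht (Fin.ext h)) _

theorem mulTensor_lof (i : ∀ m n : ℕ, FromTensor R (H m) (H n) (H (m + n))) {t t' s s' : ℕ}
    (x : H t ⊗[R] H t') (y : H s ⊗[R] H s') :
    mulTensor (gradedMul i)
        (TensorProduct.map (DirectSum.lof R ℕ H t) (DirectSum.lof R ℕ H t') x)
        (TensorProduct.map (DirectSum.lof R ℕ H s) (DirectSum.lof R ℕ H s') y) =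
      TensorProduct.map (DirectSum.lof R ℕ H (t + s)) (DirectSum.lof R ℕ H (t' + s'))
        (TensorProduct.map (i t s) (i t' s')
          (TensorProduct.tensorTensorTensorComm R _ _ _ _ (x ⊗ₜ y))) := by
  rw [mulTensor]
  induction x with
  | zero => simp only [map_zero, TensorProduct.zero_tmul]
  | add x x' hx hx' => simp only [map_add, TensorProduct.add_tmul, hx, hx']
  | tmul a b =>
    induction y with
    | zero => simp only [map_zero, TensorProduct.tmul_zero]
    | add x x' hx hx' => simp only [map_add, TensorProduct.tmul_add, hx, hx']
    | tmul c d =>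
      simp only [TensorProduct.map_tmul, TensorProduct.tensorTensorTensorComm_tmul, gradedMul_lof]

theorem mulTensor_sum {ι κ : Type*} {G : Type*} [AddCommGroup G] [Module R G]
    (π : FromTensor R G G G) (s : Finset ι) (t : Finset κ) (f : ι → G ⊗[R] G)
    (g : κ → G ⊗[R] G) :
    mulTensor π (∑ a ∈ s, f a) (∑ b ∈ t, g b) = ∑ a ∈ s, ∑ b ∈ t, mulTensor π (f a) (g b) := by
  simp only [mulTensor, TensorProduct.sum_tmul, TensorProduct.tmul_sum, map_sum]
  exact Finset.sum_comm

end Components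

/-! ### Existence and uniqueness of `i` and `r`, and the failure of compatibility -/

section Operations

variable {K : Type u} [Field K] {δ : K}

/-- The induction maps `i_{m,n}`. -/
noncomputable def inductionMaps (hδ : IsGeneric δ) (m n : ℕ) :
    FromTensor ℤ (G0 K (TL δ m)) (G0 K (TL δ n)) (G0 K (TL δ (m + n))) :=
  indMul hδ rfl

theorem isInduction_inductionMaps (hδ : IsGeneric δ) : IsInduction δ (inductionMaps hδ) :=
  fun _ _ M N => indMul_cls hδ rfl M N

theorem IsInduction.unique
    {i i' : ∀ m n : ℕ, FromTensor ℤ (G0 K (TL δ m)) (G0 K (TL δ n)) (G0 K (TL δ (m + n)))}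
    (hi : IsInduction δ i) (hi' : IsInduction δ i') : i' = i := by
  funext m n
  refine LinearMap.ext fun x => ?_
  induction x using G0.tensor_induction with
  | hcls M N => rw [hi, hi']
  | hadd x y hx hy => rw [map_add, map_add, hx, hy]
  | hneg x hx => rw [map_neg, map_neg, hx]
  | hzero => rw [map_zero, map_zero]

/-- `G₀(TL_k) ⊗ G₀(TL_l) ≃ G₀(TL_k ⊗ TL_l)`. -/
noncomputable def tensorEquiv (hδ : IsGeneric δ) (k l : ℕ) :
    G0 K (TL δ k) ⊗[ℤ] G0 K (TL δ l) ≃ₗ[ℤ] G0 K (TL δ k ⊗[K] TL δ l) :=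
  LinearEquiv.ofBijective (G0.tensor K (TL δ k) (TL δ l))
    (G0.tensor_bijective (isSplit_TL hδ k) (isSplit_TL hδ l))

/-- The restriction maps `r_{k,l}`. -/
noncomputable def restrictionMaps (hδ : IsGeneric δ) (k l n : ℕ) (h : k + l = n) :
    ToTensor ℤ (G0 K (TL δ n)) (G0 K (TL δ k)) (G0 K (TL δ l)) :=
  (tensorEquiv hδ k l).symm.toLinearMap ∘ₗ (G0.res (rho h)).toIntLinearMap

theorem isRestriction_restrictionMaps (hδ : IsGeneric δ) :
    IsRestriction δ (restrictionMaps hδ) := by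
  intro k l n h N
  rw [← G0.res_cls]
  exact (tensorEquiv hδ k l).apply_symm_apply _

/-- The defining property fixes `r` only after the map to `G₀(TL_k ⊗ TL_l)`, so its injectivity is
needed. -/
theorem IsRestriction.unique (hδ : IsGeneric δ)
    {r r' : ∀ k l n : ℕ, k + l = n → ToTensor ℤ (G0 K (TL δ n)) (G0 K (TL δ k)) (G0 K (TL δ l))}
    (hr : IsRestriction δ r) (hr' : IsRestriction δ r') : r' = r := by
  funext k l n h
  refine LinearMap.toAddMonoidHom_injective (G0.hom_ext fun N => ?_)
  apply (tensorEquiv hδ k l).injective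
  exact (hr' k l n h N).trans (hr k l n h N).symm

theorem tensorComponent_comul_mul
    {i : ∀ m n : ℕ, FromTensor ℤ (G0 K (TL δ m)) (G0 K (TL δ n)) (G0 K (TL δ (m + n)))}
    {r : ∀ k l n : ℕ, k + l = n → ToTensor ℤ (G0 K (TL δ n)) (G0 K (TL δ k)) (G0 K (TL δ l))}
    (hi : IsInduction δ i) (hr : IsRestriction δ r) {m n k l : ℕ} (h : k + l = m + n)
    (M : FDModule K (TL δ m)) (N : FDModule K (TL δ n)) :
    G0.tensor K _ _ (tensorComponent ℤ (fun n => G0 K (TL δ n)) k l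
      (gradedComul r (gradedMul i (DirectSum.lof ℤ ℕ (fun n => G0 K (TL δ n)) m (cls M) ⊗ₜ
        DirectSum.lof ℤ ℕ (fun n => G0 K (TL δ n)) n (cls N))))) = mackeyLeft h M N := by
  rw [gradedMul_lof, tensorComponent_gradedComul r h, hi, hr, mackeyLeft]

/-- The product of the pieces of bidegrees `(t, m - t)` and `(s, n - s)` has bidegree `(t + s, …)`.
The `(k, l)` component thus keeps exactly the pairs with `t + s = k`, and each is a summand by
`mackeyTerm_eq`. -/
theorem tensorComponent_mulTensor (hδ : IsGeneric δ)
    {i : ∀ m n : ℕ, FromTensor ℤ (G0 K (TL δ m)) (G0 K (TL δ n)) (G0 K (TL δ (m + n)))}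
    {r : ∀ k l n : ℕ, k + l = n → ToTensor ℤ (G0 K (TL δ n)) (G0 K (TL δ k)) (G0 K (TL δ l))}
    (hi : IsInduction δ i) (hr : IsRestriction δ r) {m n k l : ℕ} (h : k + l = m + n)
    (M : FDModule K (TL δ m)) (N : FDModule K (TL δ n)) :
    G0.tensor K _ _ (tensorComponent ℤ (fun n => G0 K (TL δ n)) k l
      (mulTensor (gradedMul i)
        (gradedComul r (DirectSum.lof ℤ ℕ (fun n => G0 K (TL δ n)) m (cls M)))
        (gradedComul r (DirectSum.lof ℤ ℕ (fun n => G0 K (TL δ n)) n (cls N))))) =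
      mackeyRight h M N := by
  obtain rfl : i = inductionMaps hδ := (isInduction_inductionMaps hδ).unique hi
  rw [gradedComul_lof, gradedComul_lof, mulTensor_sum, map_sum, map_sum, mackeyRight]
  refine Finset.sum_congr rfl fun t _ => ?_
  rw [map_sum, map_sum]
  refine Finset.sum_congr rfl fun s _ => ?_
  rw [mulTensor_lof]
  split_ifs with hk
  · subst hk
    obtain rfl : l = m - t + (n - s) := by omega
    rw [tensorComponent_lof]
    exact (mackeyTerm_eq hδ _ _ rfl rfl (hr _ _ _ _ M).symm (hr _ _ _ _ N).symm).symm
  · rw [tensorComponent_lof_ne hk, map_zero]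

theorem not_gradedComulMulAt (hδ : IsGeneric δ)
    {i : ∀ m n : ℕ, FromTensor ℤ (G0 K (TL δ m)) (G0 K (TL δ n)) (G0 K (TL δ (m + n)))}
    {r : ∀ k l n : ℕ, k + l = n → ToTensor ℤ (G0 K (TL δ n)) (G0 K (TL δ k)) (G0 K (TL δ l))}
    (hi : IsInduction δ i) (hr : IsRestriction δ r) {n p : ℕ} (hp1 : 1 ≤ p) (hp : 2 * p ≤ n) :
    ¬ GradedComulMulAt i r (cls (cell δ n p)) (cls (cell δ 1 0)) := by
  intro h
  -- The single component of degree `(n, 1)` already separates the two elements.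
  have h1 := congrArg (fun z => G0.tensor K _ _
    (tensorComponent ℤ (fun n => G0 K (TL δ n)) n 1 z)) h
  simp only [tensorComponent_comul_mul hi hr (rfl : n + 1 = n + 1),
    tensorComponent_mulTensor hδ hi hr (rfl : n + 1 = n + 1)] at h1
  rw [mackeyRight_last hδ hp1 hp, left_eq_add] at h1
  exact cls_cell_tensor_ne_zero hδ hp (by omega) h1

end Operations

end TemperleyLieb

theorem mainTheorem8 {K : Type u} [Field K] (δ : K) (hδ : IsGeneric δ) :
    -- the two sides of the identity for `M = Δ_n(p)` and `N = Δ_1(0)`, with `(k, l) = (1, n)`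
    (∀ n p : ℕ, 1 ≤ p → 2 * p < n →
      mackeyLeft (Nat.add_comm 1 n) (cell δ n p) (cell δ 1 0) =
        cls ((cell δ 1 0).tensor (cell δ n (p + 1))) +
          2 • cls ((cell δ 1 0).tensor (cell δ n p)) +
            cls ((cell δ 1 0).tensor (cell δ n (p - 1))) ∧
      mackeyRight (Nat.add_comm 1 n) (cell δ n p) (cell δ 1 0) =
        cls ((cell δ 1 0).tensor (cell δ n (p + 1))) +
          3 • cls ((cell δ 1 0).tensor (cell δ n p)) +
            cls ((cell δ 1 0).tensor (cell δ n (p - 1)))) ∧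
    -- the same with `(k, l) = (n, 1)`
    (∀ n p : ℕ, 1 ≤ p → 2 * p < n →
      mackeyLeft (rfl : n + 1 = n + 1) (cell δ n p) (cell δ 1 0) =
        cls ((cell δ n (p + 1)).tensor (cell δ 1 0)) +
          2 • cls ((cell δ n p).tensor (cell δ 1 0)) +
            cls ((cell δ n (p - 1)).tensor (cell δ 1 0)) ∧
      mackeyRight (rfl : n + 1 = n + 1) (cell δ n p) (cell δ 1 0) =
        cls ((cell δ n (p + 1)).tensor (cell δ 1 0)) +
          3 • cls ((cell δ n p).tensor (cell δ 1 0)) +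
            cls ((cell δ n (p - 1)).tensor (cell δ 1 0))) ∧
    -- the identity fails, also for `2 p = n`
    (∀ n p : ℕ, 1 ≤ p → 2 * p ≤ n →
      mackeyLeft (Nat.add_comm 1 n) (cell δ n p) (cell δ 1 0) ≠
        mackeyRight (Nat.add_comm 1 n) (cell δ n p) (cell δ 1 0) ∧
      mackeyLeft (rfl : n + 1 = n + 1) (cell δ n p) (cell δ 1 0) ≠
        mackeyRight (rfl : n + 1 = n + 1) (cell δ n p) (cell δ 1 0)) ∧
    -- the operations on the Grothendieck group are well defined, but it is not a bialgebra
    ∃ i r, (IsInduction δ i ∧ ∀ i', IsInduction δ i' → i' = i) ∧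
      (IsRestriction δ r ∧ ∀ r', IsRestriction δ r' → r' = r) ∧
      (∀ n p : ℕ, 1 ≤ p → 2 * p ≤ n →
        ¬ GradedComulMulAt i r (cls (cell δ n p)) (cls (cell δ 1 0))) ∧
      ¬ IsGradedBialgebra i (unitClass δ) r (counitZero δ) := by
  have hi := isInduction_inductionMaps hδ
  have hr := isRestriction_restrictionMaps hδ
  refine ⟨fun n p hp1 hp => ⟨?_, ?_⟩, fun n p hp1 hp => ⟨?_, ?_⟩, fun n p hp1 hp => ⟨?_, ?_⟩,
    inductionMaps hδ, restrictionMaps hδ, ⟨hi, fun _ => hi.unique⟩,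
    ⟨hr, fun _ => hr.unique hδ⟩, fun n p hp1 hp => not_gradedComulMulAt hδ hi hr hp1 hp,
    fun h => ?_⟩
  · rw [mackeyLeft_one hδ hp1 hp.le, if_pos hp]
    abel
  · rw [mackeyRight_one hδ hp1 hp.le, mackeyLeft_one hδ hp1 hp.le, if_pos hp]
    abel
  · rw [mackeyLeft_last hδ hp1 hp.le, if_pos hp]
    abel
  · rw [mackeyRight_last hδ hp1 hp.le, mackeyLeft_last hδ hp1 hp.le, if_pos hp]
    abel
  · rw [mackeyRight_one hδ hp1 hp, Ne, left_eq_add]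
    exact cls_cell_tensor_ne_zero hδ (by omega) hp
  · rw [mackeyRight_last hδ hp1 hp, Ne, left_eq_add]
    exact cls_cell_tensor_ne_zero hδ hp (by omega)
  -- The smallest case allowed is `n = 2`, `p = 1`.
  · exact not_gradedComulMulAt hδ hi hr (n := 2) (p := 1) le_rfl le_rfl (h.comul_mul _ _)
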